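/- Let $K$ be a field, $S=K[x_1,\dots,x_n]$ with $\deg x_i=1$, and $I\subsetneq S$ a monomial ideal with minimal set of monomial generators $G(I)$. Write $\beta_{ij}(M)=\dim_K\operatorname{Tor}^S_i(K,M)_j$ for graded Betti numbers. Assume that $I$ is componentwise linear, i.e. for every $d$ the ideal $I_{\langle d\rangle}$ generated by the homogeneous elements of degree $d$ of $I$ has a $d$-linear resolution: $\beta_{ij}(I_{\langle d\rangle})=0$ for $j\ne i+d$. A lexsegment ideal is a monomial ideal which contains, with each monomial $u$, every monomial $v$ with $\deg v=\deg u$ and $v>_{\mathrm{lex}}u$, where $x_1>\dots>x_n$. The ideal $I$ is called Gotzmann if $\beta_{ij}(I)=\beta_{ij}(I^{\mathrm{lex}})$ for all $i,j$, where $I^{\mathrm{lex}}$ is the unique lexsegment ideal with the same Hilbert function as $I$. For a monomial $u$ let $m(u)$ be the largest $j$ such that $x_j$ divides $u$. If $K$ is infinite, let $\operatorname{Gin}(I)$ be the generic initial ideal of $I$ with respect to the reverse lexicographic order with $x_1>\dots>x_n$. Then, if $K$ is infinite, the following conditions are equivalent: (a) the Taylor resolution of $S/I$ is minimal; (b) $\max\{m(u)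 : u\in G(\operatorname{Gin}(I))\}=|G(\operatorname{Gin}(I))|$, where the maximum of the empty set is $0$; (c) $I$ is Gotzmann and $|G(I)|\le n$. For an arbitrary field $K$, (a) and (c) are equivalent. -/

import Mathlib

/-!
Throughout, `S = K[x_1, …, x_n]` is `MvPolynomial (Fin n) K`, and a monomial `x^a` is represented
by its exponent vector `a : Fin n →₀ ℕ`. The variables are ordered `x_1 > ⋯ > x_n`, where `x_1`
has index `0 : Fin n`.
-/

namespace MonIdeal

open MvPolynomial

noncomputable section

variable {K : Type*} [Field K] {n : ℕ}

/-! ### Monomial ideals and their generators -/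

/-- `I` is generated by monomials. -/
def IsMonomialIdeal (I : Ideal (MvPolynomial (Fin n) K)) : Prop :=
  ∃ A : Set (Fin n →₀ ℕ), I = Ideal.span ((fun a => monomial a (1 : K)) '' A)

/-- The monomials in `I` that are minimal, with respect to divisibility, among those in `I`. -/
def minGensSet (I : Ideal (MvPolynomial (Fin n) K)) : Set (Fin n →₀ ℕ) :=
  {a | Minimal (fun b : Fin n →₀ ℕ => monomial b (1 : K) ∈ I) a}

theorem minGensSet_finite (I : Ideal (MvPolynomial (Fin n) K)) : (minGensSet I).Finite :=
  WellQuasiOrderedLE.finite_of_isAntichain (setOfPred_minimal_antichain _)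

/-- `G(I)`: the minimal set of monomial generators of a monomial ideal `I`. -/
def minGens (I : Ideal (MvPolynomial (Fin n) K)) : Finset (Fin n →₀ ℕ) :=
  (minGensSet_finite I).toFinset

/-- `m(u)`: the largest (one-based) index of a variable dividing `u`, with `m(1) = 0`. -/
def maxIndex (u : Fin n →₀ ℕ) : ℕ :=
  u.support.sup fun i => (i : ℕ) + 1

/-! ### The Taylor resolution -/

/-- The `p`-th free module of the Taylor resolution of `S / I`: its basis elements `e_σ` are
indexed by the `p`-element subsets `σ` of `G(I)`. -/
abbrev TaylorModule (I : Ideal (MvPolynomial (Fin n) K)) (p : ℕ) : Type _ :=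
  ↥((minGens I).powersetCard p) →₀ MvPolynomial (Fin n) K

/-- The least common multiple of a finite set of monomials. -/
def lcmOf (σ : Finset (Fin n →₀ ℕ)) : Fin n →₀ ℕ := σ.sup id

theorem erase_mem_powersetCard {α : Type*} [DecidableEq α] {G σ : Finset α} {p : ℕ} {u : α}
    (hσ : σ ∈ G.powersetCard (p + 1)) (hu : u ∈ σ) : σ.erase u ∈ G.powersetCard p := by
  rw [Finset.mem_powersetCard] at hσ ⊢
  refine ⟨(Finset.erase_subset u σ).trans hσ.1, ?_⟩
  rw [Finset.card_erase_of_mem hu, hσ.2, Nat.add_sub_cancel]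

/-- The differential of the Taylor resolution,
`d e_σ = ∑_{u ∈ σ} (-1)^{#{v ∈ σ : v < u}} (lcm σ / lcm (σ ∖ {u})) e_{σ ∖ {u}}`,
where `G(I)` is totally ordered lexicographically. -/
def taylorDifferential (I : Ideal (MvPolynomial (Fin n) K)) (p : ℕ) :
    TaylorModule I (p + 1) →ₗ[MvPolynomial (Fin n) K] TaylorModule I p :=
  Finsupp.linearCombination (MvPolynomial (Fin n) K) fun σ =>
    ∑ u ∈ σ.1.attach,
      Finsupp.single (⟨σ.1.erase u.1, erase_mem_powersetCard σ.2 u.2⟩ :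
          ↥((minGens I).powersetCard p))
        (monomial (lcmOf σ.1 - lcmOf (σ.1.erase u.1))
          ((-1 : K) ^ (σ.1.filter fun v => toLex v < toLex u.1).card))

/-- The Taylor resolution of `S / I` is minimal: the image of every differential is contained in
`𝔪 F`, where `𝔪 = (x_1, …, x_n)` and `F` is the target of the differential. -/
def TaylorIsMinimal (I : Ideal (MvPolynomial (Fin n) K)) : Prop :=
  ∀ p : ℕ, LinearMap.range (taylorDifferential I p) ≤
    Ideal.span (Set.range (X : Fin n → MvPolynomial (Fin n) K)) •
      (⊤ : Submodule (MvPolynomial (Fin n) K) (TaylorModule I p))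

/-! ### Graded Betti numbers

`β_{ij}(I) = dim_K Tor_i^S(K, I)_j`, the number of basis elements of degree `j` in the `i`-th
module of the minimal graded free resolution of a homogeneous ideal `I`. The `Tor` is computed by
the Koszul complex of `x_1, …, x_n`, the standard graded free resolution of `K`, tensored
with `I`. -/

/-- The differential of the Koszul complex of `x_1, …, x_n` over `S`. An element
`∑_A c_A e_A`, where `A` runs over the subsets of the set of variables and `e_A` has degree `|A|`,
is represented by the function `A ↦ c_A`, and
`∂ e_B = ∑_{k ∈ B} (-1)^{#{a ∈ B : a < k}} x_k e_{B ∖ {k}}`. -/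
def koszulDifferential (K : Type*) [Field K] (n : ℕ) :
    (Finset (Fin n) → MvPolynomial (Fin n) K) →ₗ[MvPolynomial (Fin n) K]
      (Finset (Fin n) → MvPolynomial (Fin n) K) :=
  LinearMap.pi fun A => ∑ k ∈ Aᶜ,
    ((-1 : MvPolynomial (Fin n) K) ^ (A.filter fun a => a < k).card * X k) •
      LinearMap.proj (insert k A)

/-- The degree `j` part of the `i`-th module of the Koszul complex with coefficients in `I`: the
elements `∑_{|A| = i} c_A e_A` with all `c_A ∈ I` homogeneous of degree `j - i`. -/
def koszulChains (I : Ideal (MvPolynomial (Fin n) K)) (i j : ℕ) :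
    Submodule K (Finset (Fin n) → MvPolynomial (Fin n) K) :=
  Submodule.pi Set.univ fun A =>
    if A.card = i then I.restrictScalars K ⊓ restrictSupport K {a | a.degree + i = j} else ⊥

/-- The cycles of homological degree `i` and internal degree `j`. -/
def koszulCycles (I : Ideal (MvPolynomial (Fin n) K)) (i j : ℕ) :
    Submodule K (Finset (Fin n) → MvPolynomial (Fin n) K) :=
  koszulChains I i j ⊓ LinearMap.ker ((koszulDifferential K n).restrictScalars K)

/-- The boundaries of homological degree `i` and internal degree `j`. -/
def koszulBoundaries (I : Ideal (MvPolynomial (Fin n) K)) (i j : ℕ) :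
    Submodule K (Finset (Fin n) → MvPolynomial (Fin n) K) :=
  (koszulChains I (i + 1) j).map ((koszulDifferential K n).restrictScalars K)

/-- The graded Betti number `β_{ij}(I)` of a homogeneous ideal `I`. -/
def bettiNumber (I : Ideal (MvPolynomial (Fin n) K)) (i j : ℕ) : ℕ :=
  Module.finrank K
    (↥(koszulCycles I i j) ⧸ (koszulBoundaries I i j).comap (koszulCycles I i j).subtype)

/-! ### Componentwise linear ideals -/

/-- `I_{⟨d⟩}`: the ideal generated by the homogeneous polynomials of degree `d` in `I`. -/
def component (I : Ideal (MvPolynomial (Fin n) K)) (d : ℕ) : Ideal (MvPolynomial (Fin n) K) :=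
  Ideal.span {f | f ∈ I ∧ f.IsHomogeneous d}

/-- `I` is componentwise linear: for every `d`, the ideal `I_{⟨d⟩}` has a `d`-linear resolution. -/
def IsComponentwiseLinear (I : Ideal (MvPolynomial (Fin n) K)) : Prop :=
  ∀ d i j : ℕ, j ≠ i + d → bettiNumber (component I d) i j = 0

/-! ### Gotzmann ideals -/

/-- The Hilbert function `d ↦ dim_K I_d` of a homogeneous ideal. -/
def hilbertFunction (I : Ideal (MvPolynomial (Fin n) K)) (d : ℕ) : ℕ :=
  Module.finrank K ↥(I.restrictScalars K ⊓ homogeneousSubmodule (Fin n) K d)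

/-- `L` is a lexsegment ideal: a monomial ideal that contains, with every monomial `u`, every
lexicographically larger monomial `v` of the same degree. -/
def IsLexsegment (L : Ideal (MvPolynomial (Fin n) K)) : Prop :=
  IsMonomialIdeal L ∧ ∀ u v : Fin n →₀ ℕ, u.degree = v.degree → toLex u < toLex v →
    monomial u (1 : K) ∈ L → monomial v (1 : K) ∈ L

/-- `I` is Gotzmann: it has the same graded Betti numbers as the (unique) lexsegment ideal with
the same Hilbert function. -/
def IsGotzmann (I : Ideal (MvPolynomial (Fin n) K)) : Prop :=
  ∃ L : Ideal (MvPolynomial (Fin n) K), IsLexsegment L ∧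
    (∀ d, hilbertFunction L d = hilbertFunction I d) ∧
    ∀ i j, bettiNumber I i j = bettiNumber L i j

/-! ### Generic initial ideals -/

/-- The (degree) reverse lexicographic order induced by `x_1 > ⋯ > x_n`: `a < b` if
`deg a < deg b`, or if the degrees agree and `b k < a k` for the largest `k` with `a k ≠ b k`. -/
def RevLexLT (a b : Fin n →₀ ℕ) : Prop :=
  a.degree < b.degree ∨
    (a.degree = b.degree ∧ ∃ k, b k < a k ∧ ∀ l, k < l → a l = b l)

/-- `x^a` is the initial monomial of `f` with respect to the reverse lexicographic order. -/
def IsInitialMonomial (f : MvPolynomial (Fin n) K) (a : Fin n →₀ ℕ) : Prop :=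
  a ∈ f.support ∧ ∀ b ∈ f.support, b ≠ a → RevLexLT b a

/-- The initial ideal of `I` with respect to the reverse lexicographic order. -/
def initialIdeal (I : Ideal (MvPolynomial (Fin n) K)) : Ideal (MvPolynomial (Fin n) K) :=
  Ideal.span {m | ∃ f ∈ I, ∃ a, IsInitialMonomial f a ∧ m = monomial a (1 : K)}

/-- The linear change of coordinates `x_j ↦ ∑_i g_{ij} x_i`. -/
def coordChange (g : GL (Fin n) K) : MvPolynomial (Fin n) K →ₐ[K] MvPolynomial (Fin n) K :=
  aeval fun j => ∑ i, C ((g : Matrix (Fin n) (Fin n) K) i j) * X i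

/-- For an infinite field `K`, `J` is the generic initial ideal `Gin(I)` with respect to the
reverse lexicographic order: `in(g I) = J` for all `g` in a nonempty Zariski open subset of
`GL_n(K)`, namely wherever some nonzero polynomial `P` in the matrix entries does not vanish. -/
def IsGenericInitialIdeal (I J : Ideal (MvPolynomial (Fin n) K)) : Prop :=
  ∃ P : MvPolynomial (Fin n × Fin n) K, P ≠ 0 ∧ ∀ g : GL (Fin n) K,
    eval (fun e => (g : Matrix (Fin n) (Fin n) K) e.1 e.2) P ≠ 0 →
      initialIdeal (I.map (coordChange g)) = J

end

end MonIdeal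

/-!
The three conditions are compared with an explicit shape of monomial ideals, called a *staircase*:
the ideal is generated by monomials `u_k = w_k x_{i_k}`, where `w_1 ∣ w_2 ∣ ⋯`, the variables
`x_{i_k}` are distinct, and `x_{i_l}` does not divide `w_k / w_l` for `l < k`. The Taylor resolution
is minimal if and only if no generator divides the least common multiple of the others
(`taylorIsMinimal_iff`), and Betti numbers are computed in each multidegree `a` from the upper
Koszul complex, the simplicial complex of all squarefree `x^F ∣ x^a` with `x^a / x^F ∈ I`.

*Minimality of the Taylor resolution gives the other conditions.* If the Taylor resolution is
minimal and `I` is componentwise linear, a first syzygy in multidegree `lcm(u, v)` shows that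
`deg lcm(u, v) = d + 1` for generators `u, v` with `deg u ≤ deg v = d` (`degree_sup_eq`), which
forces `I` to be a staircase ideal (`exists_staircase`). The Betti numbers and the Hilbert function
of a staircase ideal depend only on the degrees of the `u_k` (`Staircase.bettiNumber_ideal`,
`Staircase.hilbertFunction_ideal`), and some lexsegment staircase has generators of the same degrees
(`Staircase.exists_lex_degree_eq`); so `I` is Gotzmann, and it has at most `n` generators as the
`x_{i_k}` are distinct. If `g` is a linear change of coordinates for which certain minors do not
vanish, then the initial ideal of `g I` contains this lexsegment ideal, hence equals it by
comparison of Hilbert functions (`Staircase.initialIdeal_map_eq`); the last variable of its `k`-th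
generator is `x_k`, for `k ≤ m`.

*A Gotzmann ideal with at most `n` generators has a minimal Taylor resolution.* A lexsegment ideal
with `m ≤ n` generators is a staircase ideal (`IsLexsegment.exists_eq_lex`), so that
`β_{m-1}(I) ≠ 0`. In each multidegree the upper Koszul complex is a union of at most `m` simplices,
and if one generator divides the least common multiple of the others, the nerve of this covering
shows that `β_{m-1}(I) = 0` (`taylorIsMinimal_of_not_ex`).

*Condition (b) gives a minimal Taylor resolution.* Let `M` be the common value in (b). Then `I` has
at most `M` generators (`card_minGens_le_initialIdeal`). If its Taylor resolution were not minimal,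
the same nerve argument would show that `S / I` has no Koszul homology in degrees `≥ M`, so that in
generic coordinates the variables `x_n, …, x_M` form a regular sequence on `S / I`
(`exists_regular_columns`). By the properties of the reverse lexicographic order, no minimal
generator of the initial ideal would then have `x_M` as its last variable
(`not_mem_minGens_initialIdeal`), contrary to the choice of `M`.
-/

namespace MonIdeal

open MvPolynomial

noncomputable section

/-! ### Chains on families of finite sets -/

section Simplicial

variable {K : Type*} [Field K] {n : ℕ}

/-- The sign `(-1)^{#{a ∈ A : a < k}}` of the Koszul differential. -/
def orderSign (K : Type*) [Field K] (A : Finset (Fin n)) (k : Fin n) : K :=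
  (-1) ^ (A.filter fun a => a < k).card

theorem orderSign_mul_self (A : Finset (Fin n)) (k : Fin n) :
    orderSign K A k * orderSign K A k = 1 := by
  rw [orderSign, ← pow_add, ← two_mul, pow_mul]; simp

theorem orderSign_ne_zero (A : Finset (Fin n)) (k : Fin n) : orderSign K A k ≠ 0 :=
  left_ne_zero_of_mul_eq_one (orderSign_mul_self A k)

theorem orderSign_insert {A : Finset (Fin n)} {k l : Fin n} (hk : k ∉ A) :
    orderSign K (insert k A) l = (if k < l then -1 else 1) * orderSign K A l := by
  unfold orderSign
  rw [Finset.filter_insert]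
  split_ifs with h
  · rw [Finset.card_insert_of_notMem (by simp [hk]), pow_succ, mul_comm]
  · simp

/-- Removing two elements in the two possible orders gives opposite signs. -/
theorem orderSign_mul_orderSign_insert {A : Finset (Fin n)} {k l : Fin n} (hk : k ∉ A)
    (hl : l ∉ A) (hkl : k ≠ l) :
    orderSign K A k * orderSign K (insert k A) l =
      -(orderSign K A l * orderSign K (insert l A) k) := by
  rw [orderSign_insert hk, orderSign_insert hl]
  rcases lt_or_gt_of_ne hkl with h | h
  · simp [h, not_lt.2 h.le]; ring
  · simp [h, not_lt.2 h.le]; ring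

/-- The boundary map of the full simplex on `Fin n`, augmented by the empty face: a chain is a
function on finite sets, the chain `z` standing for `∑_A z(A) e_A`. -/
def bd (K : Type*) [Field K] (n : ℕ) : (Finset (Fin n) → K) →ₗ[K] (Finset (Fin n) → K) :=
  LinearMap.pi fun A => ∑ k ∈ Aᶜ, orderSign K A k • LinearMap.proj (insert k A)

theorem bd_apply (z : Finset (Fin n) → K) (A : Finset (Fin n)) :
    bd K n z A = ∑ k ∈ Aᶜ, orderSign K A k * z (insert k A) := by
  simp [bd]

theorem bd_bd (z : Finset (Fin n) → K) : bd K n (bd K n z) = 0 := by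
  ext A
  simp only [bd_apply, Finset.mul_sum, Pi.zero_apply]
  rw [Finset.sum_sigma']
  refine Finset.sum_involution (fun p _ => ⟨p.2, p.1⟩) ?_ ?_ ?_ ?_
  · rintro ⟨k, l⟩ h
    simp only [Finset.mem_sigma, Finset.mem_compl, Finset.mem_insert, not_or] at h
    simp only []
    rw [← mul_assoc, ← mul_assoc, orderSign_mul_orderSign_insert h.1 h.2.2 (Ne.symm h.2.1),
      Finset.insert_comm]
    ring
  · rintro ⟨k, l⟩ h _ heq
    simp only [Finset.mem_sigma, Finset.mem_compl, Finset.mem_insert, not_or] at h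
    simp only [Sigma.mk.injEq] at heq
    exact h.2.1 heq.1
  · rintro ⟨k, l⟩ h
    simp only [Finset.mem_sigma, Finset.mem_compl, Finset.mem_insert, not_or] at h ⊢
    exact ⟨h.2.2, Ne.symm h.2.1, h.1⟩
  · intros; rfl

/-- The chain `z` is supported on the members of cardinality `i` of the family `D`. -/
def Supp (D : Set (Finset (Fin n))) (i : ℕ) (z : Finset (Fin n) → K) : Prop :=
  ∀ F, z F ≠ 0 → F ∈ D ∧ F.card = i

theorem Supp.mono {D D' : Set (Finset (Fin n))} {i : ℕ} {z : Finset (Fin n) → K}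
    (h : Supp D i z) (hD : D ⊆ D') : Supp D' i z :=
  fun F hF => ⟨hD (h F hF).1, (h F hF).2⟩

theorem Supp.add {D : Set (Finset (Fin n))} {i : ℕ} {y z : Finset (Fin n) → K}
    (hy : Supp D i y) (hz : Supp D i z) : Supp D i (y + z) := by
  intro F hF
  by_cases h : y F = 0
  · exact hz F (by simpa [h] using hF)
  · exact hy F h

theorem Supp.neg {D : Set (Finset (Fin n))} {i : ℕ} {z : Finset (Fin n) → K}
    (hz : Supp D i z) : Supp D i (-z) :=
  fun F hF => hz F (by simpa using hF)

theorem Supp.bd {D : Set (Finset (Fin n))} (hD : IsLowerSet D) {i : ℕ} {z : Finset (Fin n) → K}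
    (hz : Supp D (i + 1) z) : Supp D i (bd K n z) := by
  intro F hF
  rw [bd_apply] at hF
  obtain ⟨k, hk, hne⟩ := Finset.exists_ne_zero_of_sum_ne_zero hF
  obtain ⟨h1, h2⟩ := hz _ (right_ne_zero_of_mul hne)
  rw [Finset.card_insert_of_notMem (by simpa using hk)] at h2
  exact ⟨hD (Finset.subset_insert k F) h1, by omega⟩

/-- The chain homotopy that joins every face with the vertex `v`. -/
def coneOp (v : Fin n) (z : Finset (Fin n) → K) (A : Finset (Fin n)) : K :=
  if v ∈ A then orderSign K (A.erase v) v * z (A.erase v) else 0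

theorem bd_coneOp_add (v : Fin n) (z : Finset (Fin n) → K) :
    bd K n (coneOp v z) + coneOp v (bd K n z) = z := by
  ext A
  by_cases hv : v ∈ A
  · obtain ⟨B, hB, rfl⟩ : ∃ B, v ∉ B ∧ insert v B = A :=
      ⟨A.erase v, by simp, Finset.insert_erase hv⟩
    simp only [Pi.add_apply, bd_apply, coneOp, Finset.mem_insert_self, if_true,
      Finset.erase_insert hB]
    have hc : (Bᶜ : Finset (Fin n)) = insert v (insert v B)ᶜ := by
      rw [Finset.compl_insert, Finset.insert_erase (by simpa using hB)]
    rw [hc, Finset.sum_insert (by simp), mul_add, ← mul_assoc, orderSign_mul_self, one_mul,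
      Finset.mul_sum, add_comm (z _), ← add_assoc, ← Finset.sum_add_distrib,
      Finset.sum_eq_zero, zero_add]
    intro k hk
    simp only [Finset.mem_compl, Finset.mem_insert, not_or] at hk
    have h1 : (insert k (insert v B)).erase v = insert k B := by
      rw [Finset.insert_comm, Finset.erase_insert]
      simp [hB, Ne.symm hk.1]
    rw [if_pos (by simp), h1, orderSign_insert hB, orderSign_insert hk.2]
    rcases lt_or_gt_of_ne hk.1 with h | h
    · simp [h, not_lt.2 h.le]; ring
    · simp [h, not_lt.2 h.le]; ring
  · simp only [Pi.add_apply, bd_apply, coneOp, hv, if_false, add_zero]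
    rw [Finset.sum_eq_single v]
    · rw [if_pos (by simp), Finset.erase_insert hv, ← mul_assoc, orderSign_mul_self, one_mul]
    · intro k _ hk
      rw [if_neg (by simp [hv, Ne.symm hk]), mul_zero]
    · intro h; simp [hv] at h

/-- A cycle is a boundary if every face it involves can be joined with the vertex `v`. -/
theorem exists_bd_eq_of_apex {D : Set (Finset (Fin n))} {i : ℕ} {z : Finset (Fin n) → K}
    (hz : Supp D i z) (h0 : bd K n z = 0) (v : Fin n)
    (hv : ∀ F, z F ≠ 0 → insert v F ∈ D) :
    ∃ y, Supp D (i + 1) y ∧ bd K n y = z := by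
  refine ⟨coneOp v z, ?_, ?_⟩
  · intro F hF
    unfold coneOp at hF
    split_ifs at hF with h
    · have h1 := right_ne_zero_of_mul hF
      have h2 := hv _ h1
      rw [Finset.insert_erase h] at h2
      have h3 := (hz _ h1).2
      rw [Finset.card_erase_of_mem h] at h3
      have := Finset.card_pos.2 ⟨v, h⟩
      exact ⟨h2, by omega⟩
    · exact absurd rfl hF
  · have h := bd_coneOp_add v z
    rw [h0] at h
    have h2 : coneOp v (0 : Finset (Fin n) → K) = 0 := by ext A; simp [coneOp]
    rwa [h2, add_zero] at h

/-- The chain complex of the family `D` is exact at the faces of cardinality `i`. -/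
def Ex (K : Type*) [Field K] (D : Set (Finset (Fin n))) (i : ℕ) : Prop :=
  ∀ z : Finset (Fin n) → K, Supp D i z → bd K n z = 0 → ∃ y, Supp D (i + 1) y ∧ bd K n y = z

/-- The Mayer–Vietoris sequence, as far as it gives exactness of the union. -/
theorem Ex.union {D E : Set (Finset (Fin n))} (hD : IsLowerSet D) (hE : IsLowerSet E) {i : ℕ}
    (h1 : Ex K D (i + 1)) (h2 : Ex K E (i + 1)) (h3 : Ex K (D ∩ E) i) :
    Ex K (D ∪ E) (i + 1) := by
  classical
  intro z hz h0
  set z1 : Finset (Fin n) → K := fun F => if F ∈ D then z F else 0 with hz1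
  have s1 : Supp D (i + 1) z1 := by
    intro F hF
    simp only [hz1] at hF
    split_ifs at hF with h
    · exact ⟨h, (hz F hF).2⟩
    · exact absurd rfl hF
  have s2 : Supp E (i + 1) (z - z1) := by
    intro F hF
    simp only [hz1, Pi.sub_apply] at hF
    split_ifs at hF with h
    · simp at hF
    · rw [sub_zero] at hF
      exact ⟨(hz F hF).1.resolve_left h, (hz F hF).2⟩
  have hb : bd K n (z - z1) = -bd K n z1 := by rw [map_sub, h0, zero_sub]
  have s3 : Supp (D ∩ E) i (bd K n z1) := by
    intro F hF
    refine ⟨⟨(s1.bd hD F hF).1, (s2.bd hE F ?_).1⟩, (s1.bd hD F hF).2⟩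
    rw [hb]; simpa using hF
  obtain ⟨y, hy, hyz⟩ := h3 _ s3 (bd_bd z1)
  obtain ⟨a, ha, haz⟩ := h1 (z1 - y)
    (by rw [sub_eq_add_neg]; exact s1.add (hy.mono Set.inter_subset_left).neg)
    (by rw [map_sub, hyz, sub_self])
  obtain ⟨b, hb', hbz⟩ := h2 (z - z1 + y) (s2.add (hy.mono Set.inter_subset_right))
    (by rw [map_add, hyz, hb, neg_add_cancel])
  refine ⟨a + b, (ha.mono Set.subset_union_left).add (hb'.mono Set.subset_union_right), ?_⟩
  rw [map_add, haz, hbz]; abel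

/-- The union of the full simplices on the vertex sets `V t`, for `t ∈ T`. -/
def simplexUnion {ι : Type*} (T : Finset ι) (V : ι → Finset (Fin n)) : Set (Finset (Fin n)) :=
  {F | ∃ t ∈ T, F ⊆ V t}

theorem isLowerSet_simplexUnion {ι : Type*} (T : Finset ι) (V : ι → Finset (Fin n)) :
    IsLowerSet (simplexUnion T V) :=
  fun _ _ hFG ⟨t, ht, h⟩ => ⟨t, ht, hFG.trans h⟩

theorem simplexUnion_insert {ι : Type*} [DecidableEq ι] (t : ι) (T : Finset ι)
    (V : ι → Finset (Fin n)) :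
    simplexUnion (insert t T) V = simplexUnion {t} V ∪ simplexUnion T V := by
  ext F; simp [simplexUnion]

theorem simplexUnion_singleton_inter {ι : Type*} (t : ι) (T : Finset ι)
    (V : ι → Finset (Fin n)) :
    simplexUnion {t} V ∩ simplexUnion T V = simplexUnion T fun s => V s ∩ V t := by
  ext F
  simp only [simplexUnion, Set.mem_inter_iff, Set.mem_ofPred_eq, Finset.mem_singleton,
    exists_eq_left, Finset.subset_inter_iff]
  exact ⟨fun ⟨h, s, hs, h'⟩ => ⟨s, hs, h', h⟩, fun ⟨s, hs, h', h⟩ => ⟨h, s, hs, h'⟩⟩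

/-- A union of cones with a common apex is acyclic. -/
theorem ex_simplexUnion_of_common {ι : Type*} {T : Finset ι} {V : ι → Finset (Fin n)} (v : Fin n)
    (hv : ∀ t ∈ T, v ∈ V t) (i : ℕ) : Ex K (simplexUnion T V) i := by
  intro z hz h0
  refine exists_bd_eq_of_apex hz h0 v fun F hF => ?_
  obtain ⟨t, ht, h⟩ := (hz F hF).1
  exact ⟨t, ht, Finset.insert_subset (hv t ht) h⟩

theorem ex_simplex {ι : Type*} (t : ι) (V : ι → Finset (Fin n)) (i : ℕ) :
    Ex K (simplexUnion {t} V) (i + 1) := by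
  rcases (V t).eq_empty_or_nonempty with h | ⟨v, hv⟩
  · intro z hz _
    have : z = 0 := by
      ext F
      by_contra hF
      obtain ⟨⟨s, hs, h1⟩, h2⟩ := hz F hF
      rw [Finset.mem_singleton.1 hs, h, Finset.subset_empty] at h1
      simp [h1] at h2
    exact ⟨0, fun F hF => absurd rfl hF, by simp [this]⟩
  · exact ex_simplexUnion_of_common v (by simpa using hv) _

/-- The union of `r` simplices has no homology at faces of cardinality at least `r`. -/
theorem ex_simplexUnion_of_card_le {ι : Type*} (T : Finset ι) (V : ι → Finset (Fin n)) (i : ℕ)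
    (h : T.card ≤ i) : Ex K (simplexUnion T V) i := by
  classical
  induction T using Finset.induction_on generalizing V i with
  | empty =>
    intro z hz _
    have : z = 0 := by
      ext F
      by_contra hF
      obtain ⟨⟨s, hs, h1⟩, h2⟩ := hz F hF
      simp at hs
    exact ⟨0, fun F hF => absurd rfl hF, by simp [this]⟩
  | insert t T ht ih =>
    rw [Finset.card_insert_of_notMem ht] at h
    obtain ⟨i, rfl⟩ : ∃ j, i = j + 1 := ⟨i - 1, by omega⟩
    rw [simplexUnion_insert]
    refine Ex.union (isLowerSet_simplexUnion _ _) (isLowerSet_simplexUnion _ _) (ex_simplex _ _ _)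
      (ih _ _ (by omega)) ?_
    rw [simplexUnion_singleton_inter]
    exact ih _ _ (by omega)

theorem ex_simplexUnion_insert_of_inter_empty {ι : Type*} [DecidableEq ι] {T : Finset ι}
    (hT : T.Nonempty) {k : ι} (hk : k ∉ T) (V : ι → Finset (Fin n))
    (hV : ∀ x, ∃ l ∈ T, x ∉ V l) : Ex K (simplexUnion (insert k T) V) T.card := by
  induction hT using Finset.Nonempty.cons_induction generalizing V with
  | singleton u =>
    have h : simplexUnion (insert k {u}) V = simplexUnion {k} V := by
      have hu : V u = ∅ := by
        rw [Finset.eq_empty_iff_forall_notMem]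
        intro x; simpa using hV x
      ext F
      simp only [simplexUnion, Finset.mem_insert, Finset.mem_singleton, exists_eq_or_imp,
        exists_eq_left, Set.mem_ofPred_eq, hu, Finset.subset_empty, or_iff_left_iff_imp]
      rintro rfl; simp
    rw [h]
    exact ex_simplex _ _ 0
  | cons u T hu hT ih =>
    rw [Finset.cons_eq_insert] at hk hV ⊢
    rw [Finset.insert_comm, simplexUnion_insert, Finset.card_insert_of_notMem hu]
    have hk' : k ∉ T := fun h => hk (Finset.mem_insert_of_mem h)
    refine Ex.union (isLowerSet_simplexUnion _ _) (isLowerSet_simplexUnion _ _) (ex_simplex _ _ _)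
      (ex_simplexUnion_of_card_le _ _ _ (by rw [Finset.card_insert_of_notMem hk'])) ?_
    rw [simplexUnion_singleton_inter]
    refine ih hk' _ fun x => ?_
    obtain ⟨l, hl, hx⟩ := hV x
    rcases Finset.mem_insert.1 hl with rfl | hl
    · obtain ⟨s, hs⟩ := hT
      exact ⟨s, hs, by simp [hx]⟩
    · exact ⟨l, hl, by simp [hx]⟩

/-- A union of `r ≥ 2` simplices has no homology at faces of cardinality `r - 1` if one of them
contains the intersection of the others: by the nerve of the covering, homology there would need
an empty total intersection and nonempty intersections of any `r - 1` of the simplices. -/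
theorem ex_simplexUnion_insert_of_redundant {ι : Type*} [DecidableEq ι] {T : Finset ι}
    (hT : T.Nonempty) {k : ι} (hk : k ∉ T) (V : ι → Finset (Fin n))
    (hV : ∀ x, (∀ l ∈ T, x ∈ V l) → x ∈ V k) : Ex K (simplexUnion (insert k T) V) T.card := by
  by_cases h : ∃ x, ∀ l ∈ T, x ∈ V l
  · obtain ⟨x, hx⟩ := h
    refine ex_simplexUnion_of_common x (fun t ht => ?_) _
    rcases Finset.mem_insert.1 ht with rfl | ht
    exacts [hV x hx, hx t ht]
  · push Not at h
    exact ex_simplexUnion_insert_of_inter_empty hT hk V h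

end Simplicial

/-! ### Monomial ideals -/

section Monomial

variable {K : Type*} [Field K] {n : ℕ}

theorem monomial_mem_of_le {I : Ideal (MvPolynomial (Fin n) K)} {a b : Fin n →₀ ℕ} (hab : a ≤ b)
    (ha : monomial a (1 : K) ∈ I) : monomial b (1 : K) ∈ I := by
  have h := I.mul_mem_left (monomial (b - a) (1 : K)) ha
  rwa [monomial_mul, one_mul, tsub_add_cancel_of_le hab] at h

theorem monomial_mem_span_iff {A : Set (Fin n →₀ ℕ)} {b : Fin n →₀ ℕ} :
    monomial b (1 : K) ∈ Ideal.span ((fun a => monomial a (1 : K)) '' A) ↔ ∃ a ∈ A, a ≤ b := by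
  rw [mem_ideal_span_monomial_image]
  simp

theorem IsMonomialIdeal.mem_iff {I : Ideal (MvPolynomial (Fin n) K)} (hI : IsMonomialIdeal I)
    {f : MvPolynomial (Fin n) K} : f ∈ I ↔ ∀ b ∈ f.support, monomial b (1 : K) ∈ I := by
  obtain ⟨A, rfl⟩ := hI
  simp_rw [monomial_mem_span_iff]
  exact mem_ideal_span_monomial_image

theorem IsMonomialIdeal.ext {I J : Ideal (MvPolynomial (Fin n) K)} (hI : IsMonomialIdeal I)
    (hJ : IsMonomialIdeal J)
    (h : ∀ a, monomial a (1 : K) ∈ I ↔ monomial a (1 : K) ∈ J) : I = J := by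
  ext f
  rw [hI.mem_iff, hJ.mem_iff]
  exact forall₂_congr fun b _ => h b

theorem mem_minGens {I : Ideal (MvPolynomial (Fin n) K)} {a : Fin n →₀ ℕ} :
    a ∈ minGens I ↔ monomial a (1 : K) ∈ I ∧ ∀ b, monomial b (1 : K) ∈ I → b ≤ a → b = a := by
  rw [minGens, Set.Finite.mem_toFinset, minGensSet, Set.mem_ofPred_eq, minimal_iff]
  exact and_congr_right fun _ => ⟨fun h b hb hba => (h hb hba).symm,
    fun h b hb hba => (h b hb hba).symm⟩

theorem minGens_antichain {I : Ideal (MvPolynomial (Fin n) K)} {a b : Fin n →₀ ℕ}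
    (ha : a ∈ minGens I) (hb : b ∈ minGens I) (h : a ≤ b) : a = b :=
  (mem_minGens.1 hb).2 a (mem_minGens.1 ha).1 h

theorem exists_minGens_le {I : Ideal (MvPolynomial (Fin n) K)} {a : Fin n →₀ ℕ}
    (ha : monomial a (1 : K) ∈ I) : ∃ u ∈ minGens I, u ≤ a := by
  obtain ⟨u, hua, hu⟩ := exists_minimal_le_of_wellFoundedLT
    (fun b : Fin n →₀ ℕ => monomial b (1 : K) ∈ I) a ha
  exact ⟨u, by rw [minGens, Set.Finite.mem_toFinset]; exact hu, hua⟩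

theorem monomial_mem_iff_exists_minGens {I : Ideal (MvPolynomial (Fin n) K)} {a : Fin n →₀ ℕ} :
    monomial a (1 : K) ∈ I ↔ ∃ u ∈ minGens I, u ≤ a :=
  ⟨exists_minGens_le, fun ⟨_, hu, h⟩ => monomial_mem_of_le h (mem_minGens.1 hu).1⟩

theorem isMonomialIdeal_top : IsMonomialIdeal (⊤ : Ideal (MvPolynomial (Fin n) K)) :=
  ⟨{0}, by simp [Ideal.span_singleton_one]⟩

theorem IsMonomialIdeal.eq_top_iff {I : Ideal (MvPolynomial (Fin n) K)}
    (hI : IsMonomialIdeal I) : I = ⊤ ↔ (0 : Fin n →₀ ℕ) ∈ minGens I := by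
  constructor
  · rintro rfl
    rw [mem_minGens]
    exact ⟨trivial, fun b _ hb => le_antisymm hb zero_le⟩
  · intro h
    rw [Ideal.eq_top_iff_one]
    exact (mem_minGens.1 h).1

/-- The component of degree `d` of a monomial ideal is a monomial ideal. -/
theorem IsMonomialIdeal.component_eq {I : Ideal (MvPolynomial (Fin n) K)}
    (hI : IsMonomialIdeal I) (d : ℕ) : component I d =
      Ideal.span ((fun a => monomial a (1 : K)) ''
        {a | monomial a (1 : K) ∈ I ∧ a.degree = d}) := by
  apply le_antisymm
  · refine Ideal.span_le.2 fun f ⟨hf, hd⟩ => ?_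
    rw [SetLike.mem_coe, mem_ideal_span_monomial_image]
    intro b hb
    refine ⟨b, ⟨hI.mem_iff.1 hf b hb, ?_⟩, le_rfl⟩
    by_contra h
    exact mem_support_iff.1 hb (hd.coeff_eq_zero h)
  · refine Ideal.span_mono ?_
    rintro _ ⟨a, ⟨ha, hd⟩, rfl⟩
    exact ⟨ha, isHomogeneous_monomial _ hd⟩

end Monomial

/-! ### Multigraded pieces of the Koszul complex -/

section Slices

variable {K : Type*} [Field K] {n : ℕ}

/-- The exponent vector of the product of the variables in `F`. -/
def indic (F : Finset (Fin n)) : Fin n →₀ ℕ :=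
  Finsupp.equivFunOnFinite.symm fun i => if i ∈ F then 1 else 0

theorem indic_apply (F : Finset (Fin n)) (i : Fin n) : indic F i = if i ∈ F then 1 else 0 := rfl

theorem indic_empty : indic (∅ : Finset (Fin n)) = 0 := by ext; simp [indic_apply]

theorem indic_insert {F : Finset (Fin n)} {k : Fin n} (hk : k ∉ F) :
    indic (insert k F) = indic F + Finsupp.single k 1 := by
  ext i
  simp only [indic_apply, Finsupp.add_apply, Finset.mem_insert, Finsupp.single_apply]
  by_cases h : i = k
  · subst h; simp [hk]
  · simp [h, Ne.symm h]

theorem degree_indic (F : Finset (Fin n)) : (indic F).degree = F.card := by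
  rw [Finsupp.degree_eq_sum]
  simp [indic_apply]

theorem indic_mono {F G : Finset (Fin n)} (h : F ⊆ G) : indic F ≤ indic G := by
  intro i
  simp only [indic_apply]
  split_ifs with h1 h2
  exacts [le_rfl, absurd (h h1) h2, Nat.zero_le _, le_rfl]

/-- The upper Koszul complex of `I` in the multidegree `a`: the sets `F` for which `x^a` is
divisible by `∏_{i ∈ F} x_i` with quotient in `I`. -/
def upper (I : Ideal (MvPolynomial (Fin n) K)) (a : Fin n →₀ ℕ) : Set (Finset (Fin n)) :=
  {F | indic F ≤ a ∧ monomial (a - indic F) (1 : K) ∈ I}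

/-- The part of multidegree `a` of a Koszul chain. -/
def slice (a : Fin n →₀ ℕ) (c : Finset (Fin n) → MvPolynomial (Fin n) K) (F : Finset (Fin n)) :
    K :=
  if indic F ≤ a then coeff (a - indic F) (c F) else 0

theorem slice_add (a : Fin n →₀ ℕ) (c d : Finset (Fin n) → MvPolynomial (Fin n) K) :
    slice a (c + d) = slice a c + slice a d := by
  ext F; simp only [slice, Pi.add_apply, coeff_add]; split_ifs <;> simp

theorem slice_smul (a : Fin n →₀ ℕ) (r : K) (c : Finset (Fin n) → MvPolynomial (Fin n) K) :
    slice a (r • c) = r • slice a c := by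
  ext F; simp only [slice, Pi.smul_apply, coeff_smul]; split_ifs <;> simp

theorem slice_sum {ι : Type*} (T : Finset ι) (a : Fin n →₀ ℕ)
    (c : ι → Finset (Fin n) → MvPolynomial (Fin n) K) :
    slice a (∑ t ∈ T, c t) = ∑ t ∈ T, slice a (c t) := by
  classical
  induction T using Finset.induction_on with
  | empty => ext F; simp [slice]
  | insert t T ht ih => rw [Finset.sum_insert ht, Finset.sum_insert ht, slice_add, ih]

theorem ext_of_slice {c d : Finset (Fin n) → MvPolynomial (Fin n) K}
    (h : ∀ a, slice a c = slice a d) : c = d := by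
  ext F b
  have h1 := congrFun (h (b + indic F)) F
  simpa [slice] using h1

theorem koszulDifferential_apply (c : Finset (Fin n) → MvPolynomial (Fin n) K)
    (A : Finset (Fin n)) : koszulDifferential K n c A =
      ∑ k ∈ Aᶜ, C (orderSign K A k) * (X k * c (insert k A)) := by
  simp [koszulDifferential, orderSign, mul_assoc]

theorem slice_koszulDifferential (a : Fin n →₀ ℕ)
    (c : Finset (Fin n) → MvPolynomial (Fin n) K) :
    slice a (koszulDifferential K n c) = bd K n (slice a c) := by
  ext A
  rw [bd_apply, slice, koszulDifferential_apply]
  split_ifs with h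
  · rw [coeff_sum]
    refine Finset.sum_congr rfl fun k hk => ?_
    rw [Finset.mem_compl] at hk
    rw [coeff_C_mul, coeff_X_mul', slice, indic_insert hk]
    congr 1
    have h1 : k ∈ (a - indic A).support ↔ indic A + Finsupp.single k 1 ≤ a := by
      rw [Finsupp.mem_support_iff, Finsupp.tsub_apply]
      constructor
      · intro hne i
        rw [Finsupp.add_apply, Finsupp.single_apply]
        have := h i
        split_ifs with hi
        · subst hi; omega
        · omega
      · intro hle
        have := hle k
        rw [Finsupp.add_apply, Finsupp.single_eq_same] at this
        omega
    simp only [h1, tsub_add_eq_tsub_tsub]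
  · symm
    refine Finset.sum_eq_zero fun k _ => ?_
    rw [slice, if_neg, mul_zero]
    exact fun h' => h ((indic_mono (Finset.subset_insert k A)).trans h')

/-- The Koszul chain of multidegree `a` with the given coefficients. -/
def incl (a : Fin n →₀ ℕ) (y : Finset (Fin n) → K) (F : Finset (Fin n)) :
    MvPolynomial (Fin n) K :=
  if indic F ≤ a then monomial (a - indic F) (y F) else 0

theorem slice_incl_of_ne {a b : Fin n →₀ ℕ} (h : b ≠ a) (y : Finset (Fin n) → K) :
    slice b (incl a y) = 0 := by
  ext F
  simp only [slice, incl]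
  split_ifs with h1 h2
  · rw [coeff_monomial, if_neg]
    · rfl
    · intro h3
      apply h
      rw [← tsub_add_cancel_of_le h1, ← h3, tsub_add_cancel_of_le h2]
  · simp
  · rfl

theorem slice_incl {I : Ideal (MvPolynomial (Fin n) K)} {i : ℕ} {a : Fin n →₀ ℕ}
    {y : Finset (Fin n) → K} (hy : Supp (upper I a) i y) : slice a (incl a y) = y := by
  ext F
  simp only [slice, incl]
  split_ifs with h1
  · rw [coeff_monomial, if_pos rfl]
  · by_contra h
    exact h1 (hy F (Ne.symm h)).1.1

theorem mem_koszulChains {I : Ideal (MvPolynomial (Fin n) K)} (hI : IsMonomialIdeal I) {i j : ℕ}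
    {c : Finset (Fin n) → MvPolynomial (Fin n) K} : c ∈ koszulChains I i j ↔
      ∀ A b, coeff b (c A) ≠ 0 → A.card = i ∧ b.degree + i = j ∧ monomial b (1 : K) ∈ I := by
  simp only [koszulChains, Submodule.mem_pi, Set.mem_univ, true_imp_iff]
  refine forall_congr' fun A => ?_
  split_ifs with h
  · rw [Submodule.mem_inf, Submodule.restrictScalars_mem, hI.mem_iff, mem_restrictSupport_iff]
    constructor
    · rintro ⟨h1, h2⟩ b hb
      exact ⟨h, h2 (mem_support_iff.2 hb), h1 b (mem_support_iff.2 hb)⟩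
    · intro h1
      exact ⟨fun b hb => (h1 b (mem_support_iff.1 hb)).2.2,
        fun b hb => (h1 b (mem_support_iff.1 (by simpa using hb))).2.1⟩
  · rw [Submodule.mem_bot]
    constructor
    · intro h0 b hb; simp [h0] at hb
    · intro h1
      ext b
      by_contra hb
      exact h (h1 b (by simpa using hb)).1

theorem supp_slice_of_coeff {I : Ideal (MvPolynomial (Fin n) K)} {i : ℕ}
    {c : Finset (Fin n) → MvPolynomial (Fin n) K}
    (hc : ∀ A b, coeff b (c A) ≠ 0 → A.card = i ∧ monomial b (1 : K) ∈ I) (a : Fin n →₀ ℕ) :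
    Supp (upper I a) i (slice a c) := by
  intro F hF
  rw [slice] at hF
  split_ifs at hF with h
  · obtain ⟨h1, h2⟩ := hc F _ hF
    exact ⟨⟨h, h2⟩, h1⟩
  · exact absurd rfl hF

theorem supp_slice {I : Ideal (MvPolynomial (Fin n) K)} (hI : IsMonomialIdeal I) {i j : ℕ}
    {c : Finset (Fin n) → MvPolynomial (Fin n) K} (hc : c ∈ koszulChains I i j)
    (a : Fin n →₀ ℕ) : Supp (upper I a) i (slice a c) :=
  supp_slice_of_coeff (fun A b hb => ((mem_koszulChains hI).1 hc A b hb).imp_right And.right) a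

theorem slice_eq_zero {I : Ideal (MvPolynomial (Fin n) K)} (hI : IsMonomialIdeal I) {i j : ℕ}
    {c : Finset (Fin n) → MvPolynomial (Fin n) K} (hc : c ∈ koszulChains I i j)
    {a : Fin n →₀ ℕ} (ha : a.degree ≠ j) : slice a c = 0 := by
  ext F
  by_contra hF
  apply ha
  rw [Pi.zero_apply, slice] at hF
  split_ifs at hF with h
  · obtain ⟨h1, h2, h3⟩ := (mem_koszulChains hI).1 hc F _ hF
    rw [← h2, ← h1, ← degree_indic, ← map_add, tsub_add_cancel_of_le h]
  · exact absurd rfl hF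

theorem coeff_incl_ne_zero {I : Ideal (MvPolynomial (Fin n) K)} {i : ℕ} {a : Fin n →₀ ℕ}
    {y : Finset (Fin n) → K} (hy : Supp (upper I a) i y) {A : Finset (Fin n)} {b : Fin n →₀ ℕ}
    (hb : coeff b (incl a y A) ≠ 0) :
    A.card = i ∧ b.degree + i = a.degree ∧ monomial b (1 : K) ∈ I := by
  rw [incl] at hb
  split_ifs at hb with h
  · rw [coeff_monomial] at hb
    split_ifs at hb with h1
    · obtain ⟨h2, h3⟩ := hy A hb
      subst h1
      refine ⟨h3, ?_, h2.2⟩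
      rw [← h3, ← degree_indic, ← map_add, tsub_add_cancel_of_le h]
    · exact absurd rfl hb
  · simp at hb

theorem incl_mem_koszulChains {I : Ideal (MvPolynomial (Fin n) K)} (hI : IsMonomialIdeal I)
    {i : ℕ} {a : Fin n →₀ ℕ} {y : Finset (Fin n) → K} (hy : Supp (upper I a) i y) :
    incl a y ∈ koszulChains I i a.degree :=
  (mem_koszulChains hI).2 fun _ _ hb => coeff_incl_ne_zero hy hb

theorem koszulDifferential_incl {I : Ideal (MvPolynomial (Fin n) K)} {i : ℕ} {a : Fin n →₀ ℕ}
    {y : Finset (Fin n) → K} (hy : Supp (upper I a) i y) (h0 : bd K n y = 0) :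
    koszulDifferential K n (incl a y) = 0 := by
  refine ext_of_slice fun b => ?_
  rw [slice_koszulDifferential]
  have hz : slice b (0 : Finset (Fin n) → MvPolynomial (Fin n) K) = 0 := by ext F; simp [slice]
  rw [hz]
  by_cases h : b = a
  · subst h; rw [slice_incl hy, h0]
  · rw [slice_incl_of_ne h, map_zero]

theorem finite_degree_eq (n j : ℕ) : {a : Fin n →₀ ℕ | a.degree = j}.Finite :=
  (Finset.finsuppAntidiag (Finset.univ : Finset (Fin n)) j).finite_toSet.subset fun a ha => by
    rw [Finset.mem_coe, Finset.mem_finsuppAntidiag]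
    exact ⟨by rw [← Finsupp.degree_eq_sum]; exact ha, Finset.subset_univ _⟩

/-- A Koszul chain is a boundary if its multigraded parts are. -/
theorem exists_koszulDifferential_eq {I : Ideal (MvPolynomial (Fin n) K)} {i : ℕ}
    {c : Finset (Fin n) → MvPolynomial (Fin n) K} (T : Finset (Fin n →₀ ℕ))
    (hT : ∀ a ∉ T, slice a c = 0)
    (h : ∀ a ∈ T, ∃ y, Supp (upper I a) (i + 1) y ∧ bd K n y = slice a c) :
    ∃ y : Finset (Fin n) → MvPolynomial (Fin n) K, koszulDifferential K n y = c ∧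
      ∀ A b, coeff b (y A) ≠ 0 → A.card = i + 1 ∧ monomial b (1 : K) ∈ I ∧
        ∃ a ∈ T, b.degree + (i + 1) = a.degree := by
  classical
  choose! y hy hyc using h
  refine ⟨∑ a ∈ T, incl a (y a), ext_of_slice fun b => ?_, fun A b hb => ?_⟩
  · rw [slice_koszulDifferential, slice_sum]
    by_cases hb : b ∈ T
    · rw [Finset.sum_eq_single_of_mem b hb
        fun a _ ha => slice_incl_of_ne (Ne.symm ha) _, slice_incl (hy b hb), hyc b hb]
    · rw [hT b hb, Finset.sum_eq_zero, map_zero]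
      intro a ha
      exact slice_incl_of_ne (fun h => hb (by rw [h]; exact ha)) _
  · rw [Finset.sum_apply, coeff_sum] at hb
    obtain ⟨a, ha, hne⟩ := Finset.exists_ne_zero_of_sum_ne_zero hb
    obtain ⟨h1, h2, h3⟩ := coeff_incl_ne_zero (hy a ha) hne
    exact ⟨h1, h3, a, ha, h2⟩

theorem mem_koszulBoundaries_of_slice {I : Ideal (MvPolynomial (Fin n) K)}
    (hI : IsMonomialIdeal I) {i j : ℕ} {c : Finset (Fin n) → MvPolynomial (Fin n) K}
    (hc : c ∈ koszulChains I i j)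
    (h : ∀ a : Fin n →₀ ℕ, a.degree = j →
      ∃ y, Supp (upper I a) (i + 1) y ∧ bd K n y = slice a c) :
    c ∈ koszulBoundaries I i j := by
  have hT : ∀ a, a ∈ (finite_degree_eq n j).toFinset ↔ a.degree = j := by simp
  obtain ⟨y, hyc, hy⟩ := exists_koszulDifferential_eq (finite_degree_eq n j).toFinset
    (fun a ha => slice_eq_zero hI hc fun h' => ha ((hT a).2 h')) fun a ha => h a ((hT a).1 ha)
  refine ⟨y, (mem_koszulChains hI).2 fun A b hb => ?_, hyc⟩
  obtain ⟨h1, h2, a, ha, h3⟩ := hy A b hb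
  exact ⟨h1, by rw [h3, (hT a).1 ha], h2⟩

theorem finite_koszulChains {I : Ideal (MvPolynomial (Fin n) K)} (hI : IsMonomialIdeal I)
    (i j : ℕ) : Module.Finite K (koszulChains I i j) := by
  let s : Set (Fin n →₀ ℕ) := {a | a.degree + i = j}
  have hs : s.Finite := (finite_degree_eq n (j - i)).subset fun a ha => by
    simp only [s, Set.mem_ofPred_eq] at ha ⊢; omega
  have := hs.to_subtype
  let φ : koszulChains I i j →ₗ[K] (Finset (Fin n) × s → K) :=
    { toFun := fun c p => coeff p.2.1 (c.1 p.1)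
      map_add' := fun c d => by ext p; simp
      map_smul' := fun r c => by ext p; simp }
  refine Module.Finite.of_injective φ fun c d h => Subtype.ext ?_
  ext A b
  by_cases hb : b ∈ s
  · exact congrFun h (A, ⟨b, hb⟩)
  · have hz : ∀ e ∈ koszulChains I i j, coeff b (e A) = 0 := fun e he => by
      by_contra h0
      exact hb ((mem_koszulChains hI).1 he A b h0).2.1
    rw [hz _ c.2, hz _ d.2]

theorem ex_upper_of_bettiNumber_eq_zero {I : Ideal (MvPolynomial (Fin n) K)}
    (hI : IsMonomialIdeal I) {i : ℕ} {a : Fin n →₀ ℕ} (h : bettiNumber I i a.degree = 0) :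
    Ex K (upper I a) i := by
  intro z hz h0
  have := finite_koszulChains hI i a.degree
  have : Module.Finite K (koszulCycles I i a.degree) :=
    Submodule.finiteDimensional_of_le (S₂ := koszulChains I i a.degree) inf_le_left
  rw [bettiNumber, Module.finrank_zero_iff, Submodule.Quotient.subsingleton_iff] at h
  have hc : incl a z ∈ koszulCycles I i a.degree :=
    ⟨incl_mem_koszulChains hI hz, koszulDifferential_incl hz h0⟩
  have h1 : (⟨incl a z, hc⟩ : koszulCycles I i a.degree) ∈
      (koszulBoundaries I i a.degree).comap (koszulCycles I i a.degree).subtype := by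
    rw [h]; trivial
  obtain ⟨y, hy, hyz⟩ := h1
  refine ⟨slice a y, supp_slice hI hy a, ?_⟩
  rw [← slice_koszulDifferential]
  exact (congrArg (slice a) hyz).trans (slice_incl hz)

/-- Betti numbers are counted by critical faces. Suppose that some multidegrees `a t` come with a
facet `B t` of the upper Koszul complex such that some cycle of multidegree `a t` involves `B t`,
and that all cycles which avoid these faces are boundaries. Then the coefficients at the faces
`B t` identify the homology with `K^T`. -/
theorem bettiNumber_eq_card {I : Ideal (MvPolynomial (Fin n) K)} (hI : IsMonomialIdeal I)
    {i j : ℕ} {ι : Type*} (T : Finset ι) (a : ι → Fin n →₀ ℕ) (B : ι → Finset (Fin n))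
    (hinj : Set.InjOn a T) (hdeg : ∀ t ∈ T, (a t).degree = j)
    (hB : ∀ t ∈ T, indic (B t) ≤ a t ∧ a t - indic (B t) ∈ minGens I)
    (hcyc : ∀ t ∈ T, ∃ z, Supp (upper I (a t)) i z ∧ bd K n z = 0 ∧ z (B t) ≠ 0)
    (hbd : ∀ (b : Fin n →₀ ℕ) (z : Finset (Fin n) → K), b.degree = j → Supp (upper I b) i z →
      bd K n z = 0 → (∀ t ∈ T, a t = b → z (B t) = 0) →
      ∃ y, Supp (upper I b) (i + 1) y ∧ bd K n y = z) :
    bettiNumber I i j = T.card := by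
  classical
  let φ : koszulCycles I i j →ₗ[K] (T → K) :=
    { toFun := fun c t => slice (a t) c.1 (B t)
      map_add' := fun c d => by ext t; simp [slice_add]
      map_smul' := fun r c => by ext t; simp [slice_smul] }
  have hφ : Function.Surjective φ := by
    rw [← LinearMap.range_eq_top, eq_top_iff, ← (Pi.basisFun K T).span_eq, Submodule.span_le]
    rintro _ ⟨t, rfl⟩
    obtain ⟨z, hz, h0, hne⟩ := hcyc t t.2
    have hc : incl (a t) z ∈ koszulCycles I i j := by
      refine ⟨?_, koszulDifferential_incl hz h0⟩
      have := incl_mem_koszulChains hI hz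
      rwa [hdeg t t.2] at this
    refine ⟨(z (B t))⁻¹ • ⟨_, hc⟩, ?_⟩
    rw [map_smul]
    ext s
    change (z (B t))⁻¹ * slice (a s) (incl (a t) z) (B s) = _
    rw [Pi.basisFun_apply, Pi.single_apply]
    split_ifs with h
    · subst h; rw [slice_incl hz, inv_mul_cancel₀ hne]
    · rw [slice_incl_of_ne (fun h' => h (Subtype.ext (hinj s.2 t.2 h')))]; simp
  have hker : LinearMap.ker φ =
      (koszulBoundaries I i j).comap (koszulCycles I i j).subtype := by
    ext ⟨c, hc⟩
    rw [LinearMap.mem_ker, Submodule.mem_comap, Submodule.subtype_apply]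
    constructor
    · intro h
      refine mem_koszulBoundaries_of_slice hI hc.1 fun b hb => ?_
      refine hbd b _ hb (supp_slice hI hc.1 b) ?_ ?_
      · rw [← slice_koszulDifferential]
        have h2 : koszulDifferential K n c = 0 := hc.2
        rw [h2]; ext F; simp [slice]
      · rintro t ht rfl
        exact congrFun h ⟨t, ht⟩
    · rintro ⟨y, hy, rfl⟩
      ext t
      change slice (a t) (koszulDifferential K n y) (B t) = 0
      rw [slice_koszulDifferential, bd_apply]
      refine Finset.sum_eq_zero fun k hk => ?_
      rw [Finset.mem_compl] at hk
      by_contra hne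
      -- `x^a / x^B` is a minimal generator, so no larger face lies in the complex
      obtain ⟨⟨h1, h2⟩, -⟩ := supp_slice hI hy (a t) _ (right_ne_zero_of_mul hne)
      rw [indic_insert hk] at h1 h2
      have h3 := (mem_minGens.1 (hB t t.2).2).2 _ h2
        (by rw [tsub_add_eq_tsub_tsub]; exact tsub_le_self)
      have h4 := DFunLike.congr_fun h3 k
      have h5 := h1 k
      simp only [Finsupp.tsub_apply, Finsupp.add_apply, Finsupp.single_eq_same] at h4 h5
      omega
  rw [bettiNumber, ← hker, (φ.quotKerEquivOfSurjective hφ).finrank_eq]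
  simp

theorem exists_not_ex_of_bettiNumber_ne_zero {I : Ideal (MvPolynomial (Fin n) K)}
    (hI : IsMonomialIdeal I) {i j : ℕ} (h : bettiNumber I i j ≠ 0) :
    ∃ a : Fin n →₀ ℕ, ¬ Ex K (upper I a) i := by
  by_contra! h'
  refine h (bettiNumber_eq_card hI (∅ : Finset (Fin n →₀ ℕ)) id (fun _ => ∅) ?_ ?_ ?_ ?_ ?_) <;>
    simp
  exact fun b z _ hz h0 => h' b z hz h0

/-- The Betti numbers `β_{0j}` count the minimal generators of degree `j`. -/
theorem bettiNumber_zero {I : Ideal (MvPolynomial (Fin n) K)} (hI : IsMonomialIdeal I) (j : ℕ) :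
    bettiNumber I 0 j = ((minGens I).filter fun a => a.degree = j).card := by
  refine bettiNumber_eq_card hI _ id (fun _ => ∅) (Set.injOn_id _) ?_ ?_ ?_ ?_
  · intro t ht; exact (Finset.mem_filter.1 ht).2
  · intro t ht
    simpa [indic_empty] using (Finset.mem_filter.1 ht).1
  · intro t ht
    refine ⟨fun F => if F = ∅ then 1 else 0, ?_, ?_, by simp⟩
    · intro F hF
      have h : F = ∅ := by by_contra h; simp [h] at hF
      subst h
      exact ⟨⟨by simp [indic_empty],
        by simpa [indic_empty] using (mem_minGens.1 (Finset.mem_filter.1 ht).1).1⟩, rfl⟩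
    · ext F; simp [bd_apply]
  · intro b z hb hz _ h
    have hF : ∀ F, z F ≠ 0 → F = ∅ := fun F hF => Finset.card_eq_zero.1 (hz F hF).2
    by_cases h0 : z ∅ = 0
    · refine ⟨0, fun F hF => absurd rfl hF, ?_⟩
      ext F
      by_contra hne
      have h1 : z F ≠ 0 := fun h2 => hne (by simp [h2])
      exact h1 (hF F h1 ▸ h0)
    · have h1 : monomial b (1 : K) ∈ I := by simpa [indic_empty] using (hz _ h0).1.2
      have h2 : b ∉ minGens I := fun hb' =>
        h0 (h b (Finset.mem_filter.2 ⟨hb', hb⟩) rfl)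
      obtain ⟨u, hu, hub⟩ := exists_minGens_le h1
      obtain ⟨v, hv⟩ : ∃ v, u v < b v := by
        by_contra! h3
        exact h2 (le_antisymm hub h3 ▸ hu)
      refine exists_bd_eq_of_apex hz ?_ v ?_
      · ext F
        rw [bd_apply]
        refine Finset.sum_eq_zero fun k _ => ?_
        rw [not_ne_iff.1 fun h4 => Finset.insert_ne_empty k F (hF _ h4), mul_zero]
      · intro F h4
        rw [hF F h4]
        have h5 : indic (insert v (∅ : Finset (Fin n))) = Finsupp.single v 1 := by
          rw [indic_insert (by simp), indic_empty, zero_add]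
        refine ⟨?_, monomial_mem_of_le (a := u) ?_ (mem_minGens.1 hu).1⟩
        · rw [h5, Finsupp.single_le_iff]; omega
        · rw [h5]
          intro i
          have := hub i
          rw [Finsupp.tsub_apply, Finsupp.single_apply]
          split_ifs with h6
          · subst h6; omega
          · simpa using this

end Slices

/-! ### Minimality of the Taylor resolution -/

section Taylor

variable {K : Type*} [Field K] {n : ℕ}

theorem lcmOf_apply (σ : Finset (Fin n →₀ ℕ)) (x : Fin n) : lcmOf σ x = σ.sup fun u => u x := by
  rw [lcmOf]
  exact Finset.apply_sup_eq_sup_comp (fun u : Fin n →₀ ℕ => u x) (fun _ _ => rfl) rfl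

theorem le_lcmOf {σ : Finset (Fin n →₀ ℕ)} {u : Fin n →₀ ℕ} (hu : u ∈ σ) : u ≤ lcmOf σ :=
  Finset.le_sup (f := id) hu

theorem monomial_mem_maximal_iff {b : Fin n →₀ ℕ} {c : K} (hc : c ≠ 0) :
    monomial b c ∈ Ideal.span (Set.range (X : Fin n → MvPolynomial (Fin n) K)) ↔ b ≠ 0 := by
  classical
  rw [← Set.image_univ, mem_ideal_span_X_image, support_monomial, if_neg hc]
  simp only [Finset.mem_singleton, forall_eq, Set.mem_univ, true_and, ne_eq]
  rw [← not_forall, DFunLike.ext_iff]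
  rfl

theorem taylorDifferential_single (I : Ideal (MvPolynomial (Fin n) K)) (p : ℕ)
    (σ : ↥((minGens I).powersetCard (p + 1))) :
    taylorDifferential I p (Finsupp.single σ 1) = ∑ u ∈ σ.1.attach,
      Finsupp.single (⟨σ.1.erase u.1, erase_mem_powersetCard σ.2 u.2⟩ :
          ↥((minGens I).powersetCard p))
        (monomial (lcmOf σ.1 - lcmOf (σ.1.erase u.1))
          ((-1 : K) ^ (σ.1.filter fun v => toLex v < toLex u.1).card)) := by
  rw [taylorDifferential, Finsupp.linearCombination_single, one_smul]

/-- The Taylor resolution is minimal if and only if no generator divides the least common multiple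
of the others. -/
theorem taylorIsMinimal_iff (I : Ideal (MvPolynomial (Fin n) K)) :
    TaylorIsMinimal I ↔ ∀ u ∈ minGens I, ¬ u ≤ lcmOf ((minGens I).erase u) := by
  constructor
  · intro h u hu hle
    have hcard : (minGens I).card = (minGens I).card - 1 + 1 := by
      have := Finset.card_pos.2 ⟨u, hu⟩; omega
    let σ : ↥((minGens I).powersetCard ((minGens I).card - 1 + 1)) :=
      ⟨minGens I, by rw [Finset.mem_powersetCard]; exact ⟨subset_rfl, hcard⟩⟩
    let τ : ↥((minGens I).powersetCard ((minGens I).card - 1)) :=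
      ⟨(minGens I).erase u, erase_mem_powersetCard σ.2 hu⟩
    have h1 := h _ (LinearMap.mem_range_self _ (Finsupp.single σ 1))
    have h2 := Submodule.mem_map_of_mem
      (f := (Finsupp.lapply τ : TaylorModule I _ →ₗ[MvPolynomial (Fin n) K] _)) h1
    rw [Submodule.map_smul'', taylorDifferential_single, map_sum,
      Finset.sum_eq_single_of_mem ⟨u, hu⟩ (Finset.mem_attach _ _)] at h2
    · have h3 := Submodule.smul_mono le_rfl le_top h2
      rw [smul_eq_mul, Ideal.mul_top, Finsupp.lapply_apply, Finsupp.single_eq_same,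
        monomial_mem_maximal_iff (pow_ne_zero _ (by simp))] at h3
      apply h3
      have h4 : lcmOf (minGens I) = lcmOf ((minGens I).erase u) := by
        conv_lhs => rw [← Finset.insert_erase hu]
        rw [lcmOf, Finset.sup_insert]
        exact sup_eq_right.2 hle
      exact tsub_eq_zero_of_le h4.le
    · intro v _ hv
      rw [Finsupp.lapply_apply, Finsupp.single_eq_of_ne]
      intro heq
      have h4 : (minGens I).erase u = (minGens I).erase v.1 := congrArg Subtype.val heq
      apply hv
      by_contra hne
      have : v.1 ∈ (minGens I).erase u :=
        Finset.mem_erase.2 ⟨fun h => hne (Subtype.ext h), v.2⟩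
      rw [h4] at this
      simp at this
  · intro h p
    rw [taylorDifferential, Finsupp.range_linearCombination, Submodule.span_le]
    rintro _ ⟨σ, rfl⟩
    refine Submodule.sum_mem _ fun u _ => ?_
    rw [← mul_one (monomial _ _), ← smul_eq_mul, ← Finsupp.smul_single]
    refine Submodule.smul_mem_smul ?_ trivial
    rw [monomial_mem_maximal_iff (pow_ne_zero _ (by simp))]
    intro h0
    have hσ := (Finset.mem_powersetCard.1 σ.2).1
    exact h u.1 (hσ u.2) ((le_lcmOf u.2).trans ((tsub_eq_zero_iff_le.1 h0).trans
      (Finset.sup_mono (Finset.erase_subset_erase _ hσ))))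

theorem TaylorIsMinimal.exists_private {I : Ideal (MvPolynomial (Fin n) K)}
    (h : TaylorIsMinimal I) {u : Fin n →₀ ℕ} (hu : u ∈ minGens I) :
    ∃ p, 0 < u p ∧ ∀ v ∈ minGens I, v ≠ u → v p < u p := by
  have h1 := (taylorIsMinimal_iff I).1 h u hu
  obtain ⟨p, hp⟩ : ∃ p, lcmOf ((minGens I).erase u) p < u p := by
    by_contra! h2; exact h1 h2
  exact ⟨p, by omega, fun v hv hne =>
    (le_lcmOf (Finset.mem_erase.2 ⟨hne, hv⟩) p).trans_lt hp⟩

theorem upper_eq_simplexUnion (I : Ideal (MvPolynomial (Fin n) K)) (a : Fin n →₀ ℕ) :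
    upper I a = simplexUnion ((minGens I).filter (· ≤ a))
      fun u => Finset.univ.filter fun i => u i < a i := by
  ext F
  simp only [upper, simplexUnion, Set.mem_ofPred_eq, monomial_mem_iff_exists_minGens,
    Finset.mem_filter]
  constructor
  · rintro ⟨h1, u, hu, h2⟩
    refine ⟨u, ⟨hu, h2.trans tsub_le_self⟩, fun i hi => ?_⟩
    have h3 := h1 i
    have h4 := h2 i
    simp only [indic_apply, hi, if_true, Finsupp.tsub_apply] at h3 h4
    simp; omega
  · rintro ⟨u, ⟨hu, hua⟩, h⟩
    have h1 : u + indic F ≤ a := by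
      intro i
      have := hua i
      rw [Finsupp.add_apply, indic_apply]
      split_ifs with hi
      · have := h hi; simp at this; omega
      · omega
    exact ⟨le_of_add_le_right h1, u, hu, le_tsub_of_add_le_right h1⟩

/-- An ideal with at most `i + 1` generators and nonzero homology in degree `i` has a minimal
Taylor resolution: by the nerve lemma, otherwise the upper Koszul complexes have no homology in
this degree. -/
theorem taylorIsMinimal_of_not_ex {I : Ideal (MvPolynomial (Fin n) K)} (hI : IsMonomialIdeal I)
    (htop : I ≠ ⊤) {i : ℕ} (hcard : (minGens I).card ≤ i + 1) {a : Fin n →₀ ℕ}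
    (ha : ¬ Ex K (upper I a) i) : TaylorIsMinimal I := by
  rw [taylorIsMinimal_iff]
  intro u hu hle
  apply ha
  rw [upper_eq_simplexUnion]
  by_cases hc : ((minGens I).filter (· ≤ a)).card ≤ i
  · exact ex_simplexUnion_of_card_le _ _ _ hc
  · have hG : (minGens I).filter (· ≤ a) = minGens I :=
      Finset.eq_of_subset_of_card_le (Finset.filter_subset _ _) (by omega)
    rw [hG] at hc ⊢
    have hne : ((minGens I).erase u).Nonempty := by
      rw [Finset.nonempty_iff_ne_empty]
      intro h0
      rw [h0, lcmOf, Finset.sup_empty] at hle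
      have h1 : u = 0 := le_antisymm hle bot_le
      exact htop (hI.eq_top_iff.2 (h1 ▸ hu))
    have hi : ((minGens I).erase u).card = i := by
      rw [Finset.card_erase_of_mem hu]; omega
    have := ex_simplexUnion_insert_of_redundant (K := K) hne (Finset.notMem_erase u _)
      (fun u => Finset.univ.filter fun i => u i < a i) (fun x hx => ?_)
    · rwa [Finset.insert_erase hu, hi] at this
    · simp only [Finset.mem_filter, Finset.mem_univ, true_and] at hx ⊢
      obtain ⟨l, hl⟩ := hne
      have h0 : 0 < a x := (Nat.zero_le _).trans_lt (hx l hl)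
      refine (hle x).trans_lt ?_
      rw [lcmOf_apply]
      exact (Finset.sup_lt_iff h0).2 hx

end Taylor

/-! ### Staircases -/

/-- The shape of the componentwise linear monomial ideals with minimal Taylor resolution:
monomials `u_k = w_k x_{i_k}`, where the variables `x_{i_k}` are distinct, `w_1 ∣ w_2 ∣ ⋯`, and
`x_{i_l}` does not divide `w_k / w_l` for `l < k`. -/
structure Staircase (m n : ℕ) where
  /-- The index `i_k` of the special variable of the `k`-th generator. -/
  idx : Fin m → Fin n
  /-- The exponent vector of `w_k`. -/
  base : Fin m → Fin n →₀ ℕ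
  idx_injective : Function.Injective idx
  base_mono : Monotone base
  base_idx : ∀ l k, l < k → base k (idx l) = base l (idx l)

namespace Staircase

variable {m n : ℕ} (s : Staircase m n)

/-- The exponent vector of the generator `u_k = w_k x_{i_k}`. -/
def gen (k : Fin m) : Fin n →₀ ℕ := s.base k + Finsupp.single (s.idx k) 1

/-- The ideal generated by the monomials `u_k`. -/
def ideal (K : Type*) [Field K] : Ideal (MvPolynomial (Fin n) K) :=
  Ideal.span ((fun a => monomial a (1 : K)) '' Set.range s.gen)

end Staircase

section Structure

variable {K : Type*} [Field K] {n : ℕ}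

theorem exists_degree_eq_between {u b : Fin n →₀ ℕ} (hub : u ≤ b) {d : ℕ} (hu : u.degree ≤ d)
    (hb : d ≤ b.degree) : ∃ a, u ≤ a ∧ a ≤ b ∧ a.degree = d := by
  induction d, hu using Nat.le_induction with
  | base => exact ⟨u, le_rfl, hub, rfl⟩
  | succ d hd ih =>
    obtain ⟨a, h1, h2, h3⟩ := ih (by omega)
    obtain ⟨i, hi⟩ : ∃ i, a i < b i := by
      by_contra! h
      have := le_antisymm h2 h
      subst this; omega
    refine ⟨a + Finsupp.single i 1, h1.trans le_self_add, fun j => ?_, by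
      rw [map_add, h3, Finsupp.degree_single]⟩
    have := h2 j
    rw [Finsupp.add_apply, Finsupp.single_apply]
    split_ifs with h
    · subst h; omega
    · omega

/-- If two disjoint sets `A` and `B` cover every edge of `D`, then the vertices in `A` are not
connected with those in `B`. -/
theorem not_ex_one_of_separated {D : Set (Finset (Fin n))} {A B : Finset (Fin n)}
    (hAB : Disjoint A B) {p q : Fin n} (hp : p ∈ A) (hq : q ∈ B) (hpD : {p} ∈ D) (hqD : {q} ∈ D)
    (hD : ∀ F ∈ D, F.card = 2 → F ⊆ A ∨ F ⊆ B) : ¬ Ex K D 1 := by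
  have hpq : p ≠ q := fun h => Finset.disjoint_left.1 hAB hp (h ▸ hq)
  intro h
  obtain ⟨y, hy, hyz⟩ := h (Pi.single {p} 1 - Pi.single {q} 1) (by
      intro F hF
      by_cases h1 : F = {p}
      · subst h1; exact ⟨hpD, Finset.card_singleton _⟩
      by_cases h2 : F = {q}
      · subst h2; exact ⟨hqD, Finset.card_singleton _⟩
      simp [h1, h2] at hF) (by
      ext F
      rw [map_sub, Pi.sub_apply, bd_apply, bd_apply, Pi.zero_apply, sub_eq_zero]
      by_cases hF : F = ∅
      · subst hF
        rw [Finset.sum_eq_single p, Finset.sum_eq_single q]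
        · simp [orderSign]
        · intro b _ hb
          rw [Pi.single_eq_of_ne (by simpa using hb), mul_zero]
        · simp
        · intro b _ hb
          rw [Pi.single_eq_of_ne (by simpa using hb), mul_zero]
        · simp
      · have h1 : ∀ r k : Fin n, k ∈ Fᶜ → (insert k F : Finset (Fin n)) ≠ {r} := by
          intro r k hk h2
          have h3 := congrArg Finset.card h2
          rw [Finset.card_insert_of_notMem (by simpa using hk), Finset.card_singleton] at h3
          exact hF (Finset.card_eq_zero.1 (by omega))
        rw [Finset.sum_eq_zero, Finset.sum_eq_zero]
        · intro k hk; rw [Pi.single_eq_of_ne (h1 q k hk), mul_zero]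
        · intro k hk; rw [Pi.single_eq_of_ne (h1 p k hk), mul_zero])
  -- the part of `y` inside `A` would have the boundary `e_p`, which is not a cycle
  have h2 : bd K n (fun F => if F ⊆ A then y F else 0) = Pi.single {p} 1 := by
    ext F
    have h0 : ∀ k ∈ Fᶜ, y (insert k F) ≠ 0 → F.card = 1 ∧ (insert k F ⊆ A ∨ insert k F ⊆ B) := by
      intro k hk hne
      obtain ⟨h3, h4⟩ := hy _ hne
      have h5 := h4
      rw [Finset.card_insert_of_notMem (by simpa using hk)] at h5
      exact ⟨by omega, hD _ h3 h4⟩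
    rw [bd_apply]
    by_cases hFA : F ⊆ A
    · by_cases hF : F.Nonempty
      · obtain ⟨f, hf⟩ := hF
        have h3 := congrFun hyz F
        rw [bd_apply, Pi.sub_apply, Pi.single_eq_of_ne (i := ({q} : Finset (Fin n))),
          sub_zero] at h3
        · rw [← h3]
          refine Finset.sum_congr rfl fun k hk => ?_
          congr 1
          split_ifs with h4
          · rfl
          · by_contra hne
            rcases (h0 k hk (Ne.symm hne)).2 with h5 | h5
            · exact h4 h5
            · exact Finset.disjoint_left.1 hAB (hFA hf) (h5 (Finset.mem_insert_of_mem hf))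
        · rintro rfl
          exact Finset.disjoint_left.1 hAB (hFA (Finset.mem_singleton_self q)) hq
      · rw [Finset.not_nonempty_iff_eq_empty] at hF
        subst hF
        rw [Pi.single_eq_of_ne (Finset.singleton_ne_empty p).symm]
        refine Finset.sum_eq_zero fun k hk => ?_
        split_ifs with h4
        · by_contra hne
          simpa using (h0 k hk (right_ne_zero_of_mul hne)).1
        · simp
    · rw [Pi.single_eq_of_ne (fun h => hFA (by rw [h]; simpa using hp))]
      refine Finset.sum_eq_zero fun k hk => ?_
      rw [if_neg (fun h4 => hFA ((Finset.subset_insert k F).trans h4)), mul_zero]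
  have h3 := congrFun (bd_bd (K := K) (fun F => if F ⊆ A then y F else 0)) ∅
  rw [h2, bd_apply, Finset.sum_eq_single p] at h3
  · simp [orderSign] at h3
  · intro b _ hb
    rw [Pi.single_eq_of_ne (by simpa using hb), mul_zero]
  · simp

/-- For two generators `u, v` of a componentwise linear ideal with minimal Taylor resolution, with
`deg u ≤ deg v = d`, the multidegree `lcm(u, v)` carries a first syzygy of `I_{⟨d⟩}`, so that
`deg lcm(u, v) = d + 1`. -/
theorem degree_sup_eq {I : Ideal (MvPolynomial (Fin n) K)} (hI : IsMonomialIdeal I)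
    (hlin : IsComponentwiseLinear I) (hT : TaylorIsMinimal I) {u v : Fin n →₀ ℕ}
    (hu : u ∈ minGens I) (hv : v ∈ minGens I) (huv : u ≠ v) (hd : u.degree ≤ v.degree) :
    (u ⊔ v).degree = v.degree + 1 := by
  by_contra hne
  have hcomp := hI.component_eq v.degree
  have hmem : ∀ b, monomial b (1 : K) ∈ component I v.degree ↔
      ∃ a, (monomial a (1 : K) ∈ I ∧ a.degree = v.degree) ∧ a ≤ b := by
    intro b; rw [hcomp, monomial_mem_span_iff]; rfl
  have hmonc : IsMonomialIdeal (component I v.degree) := ⟨_, hcomp⟩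
  have hex : Ex K (upper (component I v.degree) (u ⊔ v)) 1 :=
    ex_upper_of_bettiNumber_eq_zero hmonc (hlin _ _ _ (by omega))
  -- if the degree is larger, the variables of `lcm(u, v) / v` and those of `lcm(u, v) / u` lie in
  -- different connected components of the upper Koszul complex, since the Taylor condition lets no
  -- generators other than `u` and `v` divide `lcm(u, v)`
  obtain ⟨p, hp⟩ : ∃ p, v p < u p := by
    by_contra! h; exact huv (minGens_antichain hu hv h)
  obtain ⟨q, hq⟩ : ∃ q, u q < v q := by
    by_contra! h; exact huv (minGens_antichain hv hu h).symm
  have hsing : ∀ x, indic ({x} : Finset (Fin n)) = Finsupp.single x 1 := fun x => by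
    rw [← insert_empty_eq, indic_insert (by simp), indic_empty, zero_add]
  have hpu : v + Finsupp.single p 1 ≤ u ⊔ v := by
    intro x
    rw [Finsupp.add_apply, Finsupp.single_apply, Finsupp.sup_apply]
    split_ifs with h
    · subst h; omega
    · exact le_sup_right
  have hqv : u + Finsupp.single q 1 ≤ u ⊔ v := by
    intro x
    rw [Finsupp.add_apply, Finsupp.single_apply, Finsupp.sup_apply]
    split_ifs with h
    · subst h; omega
    · exact le_sup_left
  have hdeg : v.degree + 1 ≤ (u ⊔ v).degree := by
    have := Finsupp.degree_mono hpu
    rwa [map_add, Finsupp.degree_single] at this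
  refine not_ex_one_of_separated (K := K) (A := Finset.univ.filter fun i => v i < u i)
    (B := Finset.univ.filter fun i => u i < v i) ?_ (p := p) (q := q) (by simpa) (by simpa)
    ?_ ?_ ?_ hex
  · rw [Finset.disjoint_left]; intro x h1 h2
    simp at h1 h2; omega
  · refine ⟨?_, (hmem _).2 ⟨v, ⟨(mem_minGens.1 hv).1, rfl⟩, ?_⟩⟩
    · rw [hsing]; exact le_of_add_le_right hpu
    · rw [hsing]; exact le_tsub_of_add_le_right hpu
  · rw [upper, Set.mem_ofPred_eq, hsing]
    obtain ⟨a, h1, h2, h3⟩ := exists_degree_eq_between (le_tsub_of_add_le_right hqv) hd (by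
      have : ((u ⊔ v) - Finsupp.single q 1).degree + 1 = (u ⊔ v).degree := by
        conv_rhs => rw [← tsub_add_cancel_of_le (le_of_add_le_right hqv), map_add,
          Finsupp.degree_single]
      omega)
    exact ⟨le_of_add_le_right hqv, (hmem _).2
      ⟨a, ⟨monomial_mem_of_le h1 (mem_minGens.1 hu).1, h3⟩, h2⟩⟩
  · rintro F ⟨h1, h2⟩ -
    obtain ⟨a, ⟨h3, -⟩, h4⟩ := (hmem _).1 h2
    obtain ⟨w, hw, hwa⟩ := exists_minGens_le h3
    have hw' := hwa.trans h4
    have hwuv : w = u ∨ w = v := by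
      by_contra! h5
      refine (taylorIsMinimal_iff I).1 hT w hw ((hw'.trans tsub_le_self).trans (sup_le ?_ ?_))
      · exact le_lcmOf (Finset.mem_erase.2 ⟨h5.1.symm, hu⟩)
      · exact le_lcmOf (Finset.mem_erase.2 ⟨h5.2.symm, hv⟩)
    have h6 : ∀ x ∈ F, w x + 1 ≤ max (u x) (v x) := by
      intro x hx
      have h7 := h1 x
      have h8 := hw' x
      rw [Finsupp.tsub_apply] at h8
      rw [Finsupp.sup_apply] at h7 h8
      rw [indic_apply, if_pos hx] at h7 h8
      change 1 ≤ max (u x) (v x) at h7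
      change w x ≤ max (u x) (v x) - 1 at h8
      omega
    rcases hwuv with rfl | rfl
    · right
      intro x hx
      have := h6 x hx
      simp; omega
    · left
      intro x hx
      have := h6 x hx
      simp; omega

/-- A componentwise linear monomial ideal with minimal Taylor resolution is a staircase ideal. -/
theorem exists_staircase {I : Ideal (MvPolynomial (Fin n) K)} (hI : IsMonomialIdeal I)
    (hlin : IsComponentwiseLinear I) (hT : TaylorIsMinimal I) :
    ∃ (m : ℕ) (s : Staircase m n), I = s.ideal K := by
  classical
  have hp : ∀ u : Fin n →₀ ℕ, u ∈ minGens I →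
    ∃ p, 0 < u p ∧ ∀ v ∈ minGens I, v ≠ u → v p < u p := fun u hu => hT.exists_private hu
  rcases (minGens I).eq_empty_or_nonempty with hG | ⟨u₀, hu₀⟩
  · refine ⟨0, ⟨Fin.elim0, Fin.elim0, fun k => k.elim0, fun k => k.elim0, fun k => k.elim0⟩,
      hI.ext ⟨_, rfl⟩ fun a => ?_⟩
    rw [Staircase.ideal, monomial_mem_span_iff, monomial_mem_iff_exists_minGens, hG]
    simp
  -- `p u` is a variable that occurs in `u` with a larger exponent than in any other generator
  obtain ⟨p₀, -⟩ := hp u₀ hu₀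
  have : Nonempty (Fin n) := ⟨p₀⟩
  choose! p hp0 hpv using hp
  have hle : ∀ u ∈ minGens I, ∀ v ∈ minGens I, u ≠ v → u.degree ≤ v.degree →
      u ≤ v + Finsupp.single (p u) 1 := by
    intro u hu v hv huv hd
    have h1 := degree_sup_eq hI hlin hT hu hv huv hd
    have h2 : v + (u - v) = u ⊔ v := by
      ext x
      simp only [Finsupp.add_apply, Finsupp.tsub_apply, Finsupp.sup_apply]
      change _ = max (u x) (v x)
      omega
    -- the only variable of `u / gcd(u, v)` is the private variable `p u`
    have h3 : (u - v).degree = 1 := by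
      rw [← h2, map_add] at h1; omega
    have h4 := hpv u hu v hv (Ne.symm huv)
    intro x
    rw [Finsupp.add_apply, Finsupp.single_apply]
    rw [Finsupp.degree_eq_sum] at h3
    split_ifs with hx
    · subst hx
      have := Finset.single_le_sum (f := fun i => (u - v) i) (fun i _ => Nat.zero_le _)
        (Finset.mem_univ (p u))
      simp only [Finsupp.tsub_apply] at this h3
      omega
    · have h5 := Finset.add_le_sum (f := fun i => (u - v) i) (s := Finset.univ)
        (fun i _ => Nat.zero_le _) (Finset.mem_univ (p u)) (Finset.mem_univ x) hx
      simp only [Finsupp.tsub_apply] at h5 h3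
      omega
  have hpinj : ∀ u ∈ minGens I, ∀ v ∈ minGens I, u ≠ v → p u ≠ p v := by
    intro u hu v hv huv h
    have h1 := hpv u hu v hv (Ne.symm huv)
    have h2 := hpv v hv u hu huv
    rw [← h] at h2; omega
  -- `g` enumerates the generators by increasing degree
  let e := (minGens I).equivFin.symm
  let f : Fin (minGens I).card → ℕ := fun k => (e k).1.degree
  let g : Fin (minGens I).card → Fin n →₀ ℕ := fun k => (e (Tuple.sort f k)).1
  have hgG : ∀ k, g k ∈ minGens I := fun k => (e (Tuple.sort f k)).2
  have hgmono : ∀ k l, k ≤ l → (g k).degree ≤ (g l).degree := fun k l h =>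
    Tuple.monotone_sort f h
  have hginj : Function.Injective g := fun k l h =>
    (Tuple.sort f).injective (e.injective (Subtype.ext h))
  have hkl : ∀ k l, k < l → g k ≤ g l + Finsupp.single (p (g k)) 1 := fun k l h =>
    hle _ (hgG k) _ (hgG l) (fun h' => h.ne (hginj h')) (hgmono k l h.le)
  have hsub : ∀ k, Finsupp.single (p (g k)) 1 ≤ g k := fun k => by
    rw [Finsupp.single_le_iff]; exact hp0 _ (hgG k)
  refine ⟨_, ⟨fun k => p (g k), fun k => g k - Finsupp.single (p (g k)) 1, ?_, ?_, ?_⟩, ?_⟩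
  · intro k l h
    by_contra hne
    exact hpinj _ (hgG k) _ (hgG l) (fun h' => hne (hginj h')) h
  · intro k l h
    rcases h.eq_or_lt with rfl | h
    · exact le_rfl
    intro x
    have h1 := hkl k l h x
    have h2 := hpv _ (hgG l) _ (hgG k) (fun h' => h.ne (hginj h'))
    simp only [Finsupp.tsub_apply, Finsupp.add_apply] at h1 ⊢
    rw [Finsupp.single_apply (a := p (g l))]
    split_ifs with hx
    · subst hx; omega
    · omega
  · intro l k h
    have h1 := hkl l k h (p (g l))
    have h2 := hpv _ (hgG l) _ (hgG k) (fun h' => h.ne (hginj h'.symm))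
    have h3 := hpinj _ (hgG l) _ (hgG k) (fun h' => h.ne (hginj h'))
    simp only [Finsupp.tsub_apply, Finsupp.add_apply, Finsupp.single_eq_same] at h1 ⊢
    rw [Finsupp.single_eq_of_ne h3]
    omega
  · refine hI.ext ⟨_, rfl⟩ fun a => ?_
    rw [Staircase.ideal, monomial_mem_span_iff, monomial_mem_iff_exists_minGens]
    simp only [Set.exists_range_iff, Staircase.gen, tsub_add_cancel_of_le (hsub _)]
    constructor
    · rintro ⟨u, hu, h⟩
      refine ⟨(Tuple.sort f).symm (e.symm ⟨u, hu⟩), ?_⟩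
      simpa [g] using h
    · rintro ⟨k, h⟩
      exact ⟨_, hgG k, h⟩

end Structure

/-! ### Betti numbers and Hilbert functions of staircase ideals -/

theorem hilbertFunction_eq_card {K : Type*} [Field K] {n : ℕ}
    {I : Ideal (MvPolynomial (Fin n) K)} (hI : IsMonomialIdeal I) (d : ℕ)
    {T : Finset (Fin n →₀ ℕ)} (hT : ∀ a, a ∈ T ↔ monomial a (1 : K) ∈ I ∧ a.degree = d) :
    hilbertFunction I d = T.card := by
  have h : I.restrictScalars K ⊓ homogeneousSubmodule (Fin n) K d =
      restrictSupport K (T : Set (Fin n →₀ ℕ)) := by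
    ext f
    rw [Submodule.mem_inf, Submodule.restrictScalars_mem, hI.mem_iff, mem_restrictSupport_iff,
      mem_homogeneousSubmodule]
    constructor
    · rintro ⟨h1, h2⟩ b hb
      rw [Finset.mem_coe] at hb ⊢
      refine (hT b).2 ⟨h1 b hb, ?_⟩
      by_contra h3
      exact mem_support_iff.1 hb (h2.coeff_eq_zero h3)
    · intro h1
      refine ⟨fun b hb => ((hT b).1 (h1 hb)).1, fun b hb => ?_⟩
      rw [← ((hT b).1 (h1 (mem_support_iff.2 hb))).2, Finsupp.degree_eq_weight_one]
      rfl
  rw [hilbertFunction, h, Module.finrank_eq_card_basis (basisRestrictSupport K _)]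
  simp

namespace Staircase

variable {K : Type*} [Field K] {m n : ℕ} (s : Staircase m n)

theorem isMonomialIdeal : IsMonomialIdeal (s.ideal K) := ⟨_, rfl⟩

theorem monomial_mem_iff {a : Fin n →₀ ℕ} :
    monomial a (1 : K) ∈ s.ideal K ↔ ∃ k, s.gen k ≤ a := by
  rw [ideal, monomial_mem_span_iff, Set.exists_range_iff]

theorem gen_idx (k : Fin m) : s.gen k (s.idx k) = s.base k (s.idx k) + 1 := by
  simp [gen]

theorem gen_idx_of_ne {k l : Fin m} (h : k ≠ l) : s.gen k (s.idx l) = s.base k (s.idx l) := by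
  rw [gen, Finsupp.add_apply, Finsupp.single_eq_of_ne, add_zero]
  exact fun h' => h (s.idx_injective h').symm

theorem base_le_gen (k : Fin m) : s.base k ≤ s.gen k := le_self_add

theorem degree_gen (k : Fin m) : (s.gen k).degree = (s.base k).degree + 1 := by
  rw [gen, map_add, Finsupp.degree_single]

theorem gen_le_of_base_le {l : Fin m} {a : Fin n →₀ ℕ} (h : s.base l ≤ a)
    (h' : s.base l (s.idx l) < a (s.idx l)) : s.gen l ≤ a := by
  intro x
  have := h x
  rw [gen, Finsupp.add_apply, Finsupp.single_apply]
  split_ifs with hx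
  · subst hx; omega
  · omega

theorem eq_of_gen_le {k l : Fin m} (h : s.gen l ≤ s.gen k) : l = k := by
  by_contra hne
  have h1 := h (s.idx l)
  rw [gen_idx, gen_idx_of_ne s (Ne.symm hne)] at h1
  rcases lt_or_gt_of_ne hne with h2 | h2
  · rw [s.base_idx l k h2] at h1; omega
  · have := s.base_mono h2.le (s.idx l); omega

theorem gen_injective : Function.Injective s.gen := fun _ _ h => s.eq_of_gen_le h.le

theorem minGens_ideal : minGens (s.ideal K) = Finset.univ.image s.gen := by
  ext a
  rw [mem_minGens, s.monomial_mem_iff, Finset.mem_image]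
  constructor
  · rintro ⟨⟨k, hk⟩, h⟩
    exact ⟨k, Finset.mem_univ k, h _ (s.monomial_mem_iff.2 ⟨k, le_rfl⟩) hk⟩
  · rintro ⟨k, -, rfl⟩
    refine ⟨⟨k, le_rfl⟩, fun b hb hbk => ?_⟩
    obtain ⟨l, hl⟩ := s.monomial_mem_iff.1 hb
    have := s.eq_of_gen_le (hl.trans hbk)
    subst this
    exact le_antisymm hbk hl

theorem card_minGens : (minGens (s.ideal K)).card = m := by
  rw [minGens_ideal, Finset.card_image_of_injective _ s.gen_injective, Finset.card_fin]

theorem le_card (s : Staircase m n) : m ≤ n := by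
  simpa using Fintype.card_le_of_injective s.idx s.idx_injective

/-- The special variables of the generators that precede the `k`-th one; they generate the colon
ideal of the `k`-th step. -/
def prev (k : Fin m) : Finset (Fin n) := (Finset.Iio k).image s.idx

theorem card_prev (k : Fin m) : (s.prev k).card = k := by
  rw [prev, Finset.card_image_of_injective _ s.idx_injective, Fin.card_Iio]

theorem mem_prev {k : Fin m} {x : Fin n} : x ∈ s.prev k ↔ ∃ l < k, s.idx l = x := by
  simp [prev]

theorem idx_notMem_prev {k l : Fin m} (h : k ≤ l) : s.idx l ∉ s.prev k := by
  rw [mem_prev]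
  rintro ⟨r, hr, h'⟩
  rw [s.idx_injective h'] at hr
  exact absurd hr (not_lt.2 h)

theorem mem_upper_iff {b : Fin n →₀ ℕ} {F : Finset (Fin n)} :
    F ∈ upper (s.ideal K) b ↔ ∃ l, s.gen l + indic F ≤ b := by
  rw [upper, Set.mem_ofPred_eq, s.monomial_mem_iff]
  constructor
  · rintro ⟨h, l, hl⟩
    exact ⟨l, (le_tsub_iff_right h).1 hl⟩
  · rintro ⟨l, h⟩
    exact ⟨le_of_add_le_right h, l, le_tsub_of_add_le_right h⟩

theorem insert_mem_upper {b : Fin n →₀ ℕ} {F : Finset (Fin n)} {l : Fin m} {v : Fin n}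
    (h : s.gen l + indic F ≤ b) (hv : s.gen l v < b v) : insert v F ∈ upper (s.ideal K) b := by
  rw [mem_upper_iff]
  by_cases hvF : v ∈ F
  · rw [Finset.insert_eq_of_mem hvF]; exact ⟨l, h⟩
  · refine ⟨l, fun x => ?_⟩
    have h1 := h x
    rw [indic_insert hvF]
    simp only [Finsupp.add_apply] at h1 ⊢
    rw [Finsupp.single_apply]
    split_ifs with hx
    · subst hx
      rw [indic_apply, if_neg hvF]; omega
    · omega

/-- The multidegrees `u_k x^B` with `B` contained in `{i_l : l < k}` are distinct. -/
theorem gen_add_indic_injective {k k' : Fin m} {B B' : Finset (Fin n)} (hB : B ⊆ s.prev k)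
    (hB' : B' ⊆ s.prev k') (h : s.gen k + indic B = s.gen k' + indic B') : k = k' ∧ B = B' := by
  have key : ∀ {k k' : Fin m} {B B' : Finset (Fin n)}, B ⊆ s.prev k → B' ⊆ s.prev k' →
      s.gen k + indic B = s.gen k' + indic B' → ¬ k < k' := by
    intro k k' B B' hB hB' h hlt
    have h1 := DFunLike.congr_fun h (s.idx k')
    rw [Finsupp.add_apply, Finsupp.add_apply, gen_idx, s.gen_idx_of_ne hlt.ne, indic_apply,
      if_neg fun h' => s.idx_notMem_prev hlt.le (hB h')] at h1
    have := s.base_mono hlt.le (s.idx k')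
    omega
  have hk : k = k' := le_antisymm (not_lt.1 (key hB' hB h.symm)) (not_lt.1 (key hB hB' h))
  subst hk
  refine ⟨rfl, ?_⟩
  have h2 := add_left_cancel h
  ext x
  have h3 := DFunLike.congr_fun h2 x
  rw [indic_apply, indic_apply] at h3
  by_cases h4 : x ∈ B <;> by_cases h5 : x ∈ B' <;> simp_all

/-- In the multidegree `u_k x^B` with `B ⊆ {i_l : l < k}`, the boundary of the face
`B ∪ {i_k}` is a cycle of the upper Koszul complex. -/
theorem supp_bd_single {k : Fin m} {B : Finset (Fin n)} (hB : B ⊆ s.prev k) :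
    Supp (upper (s.ideal K) (s.gen k + indic B)) B.card
      (bd K n (Pi.single (insert (s.idx k) B) 1)) := by
  have hkB : s.idx k ∉ B := fun h => s.idx_notMem_prev le_rfl (hB h)
  intro F hF
  rw [bd_apply] at hF
  obtain ⟨x, hx, hne⟩ := Finset.exists_ne_zero_of_sum_ne_zero hF
  rw [Finset.mem_compl] at hx
  have heq : insert x F = insert (s.idx k) B := by
    by_contra h
    rw [Pi.single_eq_of_ne h, mul_zero] at hne
    exact hne rfl
  constructor
  · have h1 : s.gen k + indic B = s.base k + Finsupp.single x 1 + indic F := by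
      rw [gen, add_assoc, add_comm (Finsupp.single _ _), ← indic_insert hkB, ← heq,
        indic_insert hx, add_assoc, add_comm (indic F)]
    rw [mem_upper_iff, h1]
    have h2 : x ∈ insert (s.idx k) B := heq ▸ Finset.mem_insert_self x F
    rcases Finset.mem_insert.1 h2 with rfl | h2
    · exact ⟨k, le_rfl⟩
    · obtain ⟨l, hl, rfl⟩ := s.mem_prev.1 (hB h2)
      exact ⟨l, add_le_add_left (add_le_add_left (s.base_mono hl.le) _) _⟩
  · have h3 := congrArg Finset.card heq
    rw [Finset.card_insert_of_notMem hx, Finset.card_insert_of_notMem hkB] at h3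
    omega

/-- Let `u_k` be the last generator that divides `x^b`. The upper Koszul complex in the multidegree
`b` is a cone, unless `x^b = u_k x^B` with `B ⊆ {i_l : l < k}`, when it is the union of a cone with
apex `i_k` and the face `B`. -/
theorem exists_apex {b : Fin n →₀ ℕ} {k : Fin m} (hk : s.gen k ≤ b)
    (hmax : ∀ l, s.gen l ≤ b → l ≤ k) :
    (∃ v, ∀ F ∈ upper (s.ideal K) b, insert v F ∈ upper (s.ideal K) b) ∨
    ∃ B ⊆ s.prev k, b = s.gen k + indic B ∧
      ∀ F ∈ upper (s.ideal K) b, F ≠ B → insert (s.idx k) F ∈ upper (s.ideal K) b := by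
  have hup : ∀ F ∈ upper (s.ideal K) b, ∃ l ≤ k, s.gen l + indic F ≤ b := fun F hF => by
    obtain ⟨l, hl⟩ := s.mem_upper_iff.1 hF
    exact ⟨l, hmax l (le_of_add_le_left hl), hl⟩
  by_cases hc : ∃ v, ∀ l ≤ k, s.gen l v < b v
  · obtain ⟨v, hv⟩ := hc
    refine Or.inl ⟨v, fun F hF => ?_⟩
    obtain ⟨l, hl, h⟩ := hup F hF
    exact s.insert_mem_upper h (hv l hl)
  · right
    push Not at hc
    have key : ∀ v, s.gen k v < b v → v ∈ s.prev k ∧ b v = s.gen k v + 1 := by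
      intro v hv
      obtain ⟨l, hl, h⟩ := hc v
      have h1 := s.base_mono hl v
      have h2 := s.base_le_gen k v
      have h3 : v = s.idx l := by
        by_contra h3
        rw [gen, Finsupp.add_apply, Finsupp.single_eq_of_ne h3] at h
        omega
      have h4 : l ≠ k := by rintro rfl; omega
      subst h3
      rw [gen_idx] at h
      exact ⟨s.mem_prev.2 ⟨l, lt_of_le_of_ne hl h4, rfl⟩, by omega⟩
    have hb : b = s.gen k + indic (Finset.univ.filter fun v => s.gen k v < b v) := by
      ext v
      rw [Finsupp.add_apply, indic_apply]
      have := hk v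
      split_ifs with h
      · exact (key v (by simpa using h)).2
      · simp at h; omega
    refine ⟨Finset.univ.filter fun v => s.gen k v < b v, fun v hv => (key v (by simpa using hv)).1,
      hb, fun F hF hFB => ?_⟩
    generalize hB : (Finset.univ.filter fun v => s.gen k v < b v) = B at hb hFB
    have hBp : B ⊆ s.prev k := by
      subst hB; exact fun v hv => (key v (by simpa using hv)).1
    have hlt : ∀ l < k, s.gen l (s.idx k) < b (s.idx k) := by
      intro l hl
      have h1 := hk (s.idx k)
      have h2 := s.base_mono hl.le (s.idx k)
      rw [gen_idx] at h1
      rw [s.gen_idx_of_ne hl.ne]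
      omega
    obtain ⟨l, hl, h⟩ := hup F hF
    rcases hl.lt_or_eq with hl | rfl
    · exact s.insert_mem_upper h (hlt l hl)
    · have hFsub : F ⊆ B := by
        intro x hx
        have h1 := h x
        rw [hb, Finsupp.add_apply, Finsupp.add_apply, indic_apply, indic_apply, if_pos hx] at h1
        by_contra h2
        rw [if_neg h2] at h1
        omega
      obtain ⟨x, hxB, hxF⟩ := Finset.exists_of_ssubset (hFsub.ssubset_of_ne hFB)
      obtain ⟨r, hr, rfl⟩ := s.mem_prev.1 (hBp hxB)
      refine s.insert_mem_upper (l := r) ?_ (hlt r hr)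
      rw [hb, gen, add_assoc]
      refine add_le_add ((s.base_mono hr.le).trans (s.base_le_gen _)) ?_
      rw [add_comm, ← indic_insert hxF]
      exact indic_mono (Finset.insert_subset hxB hFsub)

theorem bettiNumber_ideal (i j : ℕ) : bettiNumber (s.ideal K) i j =
    ∑ k : Fin m, if (s.gen k).degree + i = j then (k : ℕ).choose i else 0 := by
  classical
  have hT := bettiNumber_eq_card (K := K) s.isMonomialIdeal (i := i) (j := j)
    ((Finset.univ.filter fun k => (s.gen k).degree + i = j).sigma
      fun k => (s.prev k).powersetCard i)
    (fun p => s.gen p.1 + indic p.2) (fun p => p.2) ?_ ?_ ?_ ?_ ?_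
  · rw [hT, Finset.card_sigma, Finset.sum_filter]
    refine Finset.sum_congr rfl fun k _ => ?_
    rw [Finset.card_powersetCard, card_prev]
  · rintro ⟨k, B⟩ hp ⟨k', B'⟩ hp' h
    simp only [Finset.mem_coe, Finset.mem_sigma, Finset.mem_powersetCard] at hp hp'
    obtain ⟨rfl, rfl⟩ := s.gen_add_indic_injective hp.2.1 hp'.2.1 h
    rfl
  · rintro ⟨k, B⟩ hp
    simp only [Finset.mem_sigma, Finset.mem_powersetCard, Finset.mem_filter] at hp
    rw [map_add, degree_indic, hp.2.2, hp.1.2]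
  · rintro ⟨k, B⟩ hp
    refine ⟨le_add_self, ?_⟩
    simp only [add_tsub_cancel_right, minGens_ideal]
    exact Finset.mem_image_of_mem _ (Finset.mem_univ k)
  · rintro ⟨k, B⟩ hp
    simp only [Finset.mem_sigma, Finset.mem_powersetCard] at hp
    have hkB : s.idx k ∉ B := fun h => s.idx_notMem_prev le_rfl (hp.2.1 h)
    refine ⟨bd K n (Pi.single (insert (s.idx k) B) 1), ?_, bd_bd _, ?_⟩
    · have := s.supp_bd_single (K := K) hp.2.1
      rwa [hp.2.2] at this
    · rw [bd_apply, Finset.sum_eq_single (s.idx k)]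
      · simpa using orderSign_ne_zero B (s.idx k)
      · intro x hx hne
        rw [Pi.single_eq_of_ne, mul_zero]
        intro h
        have h1 : x ∈ insert (s.idx k) B := h ▸ Finset.mem_insert_self x B
        rw [Finset.mem_insert] at h1
        rw [Finset.mem_compl] at hx
        exact h1.elim hne hx
      · intro h; simp [hkB] at h
  · intro b z hb hz h0 hzero
    by_cases hz0 : z = 0
    · exact ⟨0, fun F hF => absurd rfl hF, by simp [hz0]⟩
    obtain ⟨F, hF⟩ : ∃ F, z F ≠ 0 := by
      by_contra! h; exact hz0 (funext h)
    obtain ⟨l, hl⟩ := s.mem_upper_iff.1 (hz F hF).1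
    obtain ⟨k, hk, hmax⟩ := (Finset.univ.filter fun k => s.gen k ≤ b).exists_max_image id
      ⟨l, by simpa using le_of_add_le_left hl⟩
    simp only [Finset.mem_filter, Finset.mem_univ, true_and, id] at hk hmax
    rcases s.exists_apex (K := K) hk hmax with ⟨v, hv⟩ | ⟨B, hB, hbB, hv⟩
    · exact exists_bd_eq_of_apex hz h0 v fun F hF => hv F (hz F hF).1
    · refine exists_bd_eq_of_apex hz h0 (s.idx k) fun F hF => hv F (hz F hF).1 ?_
      rintro rfl
      refine hF (hzero ⟨k, F⟩ ?_ hbB.symm)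
      simp only [Finset.mem_sigma, Finset.mem_powersetCard, Finset.mem_filter, Finset.mem_univ,
        true_and]
      refine ⟨?_, hB, (hz F hF).2⟩
      rw [← hb, hbB, map_add, degree_indic, (hz F hF).2]

/-- The Hilbert function of a staircase ideal, from the decomposition of its monomials into the
sets `u_k · {monomials not involving x_{i_l} for l < k}`. -/
theorem hilbertFunction_ideal (d : ℕ) : hilbertFunction (s.ideal K) d =
    ∑ k : Fin m, if (s.gen k).degree ≤ d then (n - k).multichoose (d - (s.gen k).degree)
      else 0 := by
  classical
  have hT := hilbertFunction_eq_card (K := K) s.isMonomialIdeal d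
    (T := ((Finset.univ.filter fun k => (s.gen k).degree ≤ d).sigma
      fun k => (s.prev k)ᶜ.finsuppAntidiag (d - (s.gen k).degree)).image
        fun p => s.gen p.1 + p.2) ?_
  · rw [hT, Finset.card_image_of_injOn, Finset.card_sigma, Finset.sum_filter]
    · refine Finset.sum_congr rfl fun k _ => ?_
      rw [Finset.card_finsuppAntidiag_nat_eq_multichoose, Finset.card_compl, card_prev,
        Fintype.card_fin]
    · have key : ∀ (k k' : Fin m) (c c' : Fin n →₀ ℕ), (∀ x ∈ s.prev k', c' x = 0) →
          s.gen k + c = s.gen k' + c' → ¬ k < k' := by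
        intro k k' c c' hc' h hlt
        have h1 := DFunLike.congr_fun h (s.idx k)
        rw [Finsupp.add_apply, Finsupp.add_apply, gen_idx, s.gen_idx_of_ne hlt.ne',
          hc' _ (s.mem_prev.2 ⟨k, hlt, rfl⟩), s.base_idx k k' hlt] at h1
        omega
      have hz : ∀ (k : Fin m) (c : Fin n →₀ ℕ), c.support ⊆ (s.prev k)ᶜ →
          ∀ x ∈ s.prev k, c x = 0 := by
        intro k c h x hx
        by_contra h0
        have := h (Finsupp.mem_support_iff.2 h0)
        simp [hx] at this
      rintro ⟨k, c⟩ hp ⟨k', c'⟩ hp' h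
      simp only [Finset.mem_coe, Finset.mem_sigma, Finset.mem_finsuppAntidiag] at hp hp' h
      have hk : k = k' := le_antisymm
        (not_lt.1 (key _ _ _ _ (hz _ _ hp.2.2) h.symm)) (not_lt.1 (key _ _ _ _ (hz _ _ hp'.2.2) h))
      subst hk
      rw [add_left_cancel h]
  · intro a
    rw [s.monomial_mem_iff, Finset.mem_image]
    constructor
    · rintro ⟨⟨k, c⟩, hp, rfl⟩
      simp only [Finset.mem_sigma, Finset.mem_finsuppAntidiag, Finset.mem_filter] at hp ⊢
      refine ⟨⟨k, le_self_add⟩, ?_⟩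
      have : c.degree = d - (s.gen k).degree := by
        rw [Finsupp.degree_apply, ← hp.2.1]
        exact Finset.sum_subset hp.2.2 fun x _ hx => Finsupp.notMem_support_iff.1 hx
      rw [map_add, this]
      omega
    · rintro ⟨⟨l, hl⟩, hd⟩
      -- the decomposition uses the first generator that divides `x^a`
      obtain ⟨k, hk, hmin⟩ := (Finset.univ.filter fun k => s.gen k ≤ a).exists_min_image id
        ⟨l, by simpa using hl⟩
      simp only [Finset.mem_filter, Finset.mem_univ, true_and, id] at hk hmin
      have hdeg : (s.gen k).degree + (a - s.gen k).degree = a.degree := by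
        rw [← map_add, add_tsub_cancel_of_le hk]
      have hsupp : (a - s.gen k).support ⊆ (s.prev k)ᶜ := by
        intro x hx
        rw [Finset.mem_compl]
        intro hx'
        obtain ⟨r, hr, rfl⟩ := s.mem_prev.1 hx'
        rw [Finsupp.mem_support_iff, Finsupp.tsub_apply, s.gen_idx_of_ne hr.ne',
          s.base_idx r k hr] at hx
        have h1 : s.gen r ≤ a := s.gen_le_of_base_le
          ((s.base_mono hr.le).trans ((s.base_le_gen k).trans hk)) (by omega)
        exact absurd (hmin r h1) (not_le.2 hr)
      refine ⟨⟨k, a - s.gen k⟩, ?_, add_tsub_cancel_of_le hk⟩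
      simp only [Finset.mem_sigma, Finset.mem_finsuppAntidiag, Finset.mem_filter,
        Finset.mem_univ, true_and]
      refine ⟨by omega, ?_, hsupp⟩
      rw [← Finset.sum_subset hsupp fun x _ hx => Finsupp.notMem_support_iff.1 hx,
        ← Finsupp.degree_apply]
      omega

/-! ### Lexsegment staircases -/

/-- The staircase with generators `x_1^{b_1} ⋯ x_{k-1}^{b_{k-1}} x_k^{b_k + 1}` for `k ≤ m`. -/
def lex (b : Fin n → ℕ) (h : m ≤ n) : Staircase m n where
  idx := Fin.castLE h
  base k := Finsupp.equivFunOnFinite.symm fun i => if (i : ℕ) ≤ k then b i else 0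
  idx_injective := Fin.castLE_injective h
  base_mono := by
    intro k l hkl i
    simp only [Finsupp.equivFunOnFinite_symm_apply_apply]
    have : (k : ℕ) ≤ l := hkl
    split_ifs
    exacts [le_rfl, by omega, Nat.zero_le _, le_rfl]
  base_idx := by
    intro l k hlk
    have : (l : ℕ) < k := hlk
    simp [this.le]

theorem lex_base_apply (b : Fin n → ℕ) (h : m ≤ n) (k : Fin m) (i : Fin n) :
    (lex b h).base k i = if (i : ℕ) ≤ k then b i else 0 := rfl

theorem lex_gen_apply (b : Fin n → ℕ) (h : m ≤ n) (k : Fin m) (i : Fin n) :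
    (lex b h).gen k i = (if (i : ℕ) ≤ k then b i else 0) + if (i : ℕ) = k then 1 else 0 := by
  rw [gen, Finsupp.add_apply, lex_base_apply, Finsupp.single_apply]
  congr 1
  simp only [lex, Fin.ext_iff, Fin.val_castLE, eq_comm]

/-- The monomials of `lex b h` are those which are lexicographically larger than `x^b`, with the
first difference among the first `m` variables. -/
theorem monomial_mem_lex_iff {b : Fin n → ℕ} {h : m ≤ n} {v : Fin n →₀ ℕ} :
    monomial v (1 : K) ∈ (lex b h).ideal K ↔
      ∃ k : Fin n, (k : ℕ) < m ∧ (∀ l < k, v l = b l) ∧ b k < v k := by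
  classical
  rw [monomial_mem_iff]
  constructor
  · rintro ⟨k, hk⟩
    have hk' := hk (Fin.castLE h k)
    rw [lex_gen_apply] at hk'
    simp only [Fin.val_castLE, le_rfl, if_true] at hk'
    obtain ⟨p, hp, hmin⟩ := (Finset.univ.filter fun i : Fin n => v i ≠ b i).exists_min_image id
      ⟨Fin.castLE h k, by simp; omega⟩
    simp only [Finset.mem_filter, Finset.mem_univ, true_and, id] at hp hmin
    have hpk : p ≤ Fin.castLE h k := hmin _ (by omega)
    have hpk' : (p : ℕ) ≤ k := hpk
    have h1 := hk p
    rw [lex_gen_apply, if_pos hpk'] at h1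
    refine ⟨p, by omega, fun l hl => ?_, by omega⟩
    by_contra h2
    exact absurd (hmin l h2) (not_le.2 hl)
  · rintro ⟨k, hkm, h1, h2⟩
    refine ⟨⟨k, hkm⟩, fun i => ?_⟩
    rw [lex_gen_apply]
    simp only
    rcases lt_trichotomy i k with hi | rfl | hi
    · have : (i : ℕ) < k := hi
      rw [if_pos (by omega), if_neg (by omega), h1 i hi]; omega
    · simp; omega
    · have : (k : ℕ) < i := hi
      rw [if_neg (by omega), if_neg (by omega)]; omega

theorem isLexsegment_lex (b : Fin n → ℕ) (h : m ≤ n) : IsLexsegment ((lex b h).ideal K) := by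
  refine ⟨isMonomialIdeal _, fun u v _ huv hu => ?_⟩
  rw [monomial_mem_lex_iff] at hu ⊢
  obtain ⟨k, hkm, h1, h2⟩ := hu
  obtain ⟨p, h3, h4⟩ := Finsupp.Lex.lt_iff.1 huv
  simp only [ofLex_toLex] at h3 h4
  rcases lt_trichotomy p k with hp | rfl | hp
  · have : (p : ℕ) < k := hp
    refine ⟨p, by omega, fun l hl => by rw [← h3 l hl, h1 l (hl.trans hp)], ?_⟩
    rw [← h1 p hp]; exact h4
  · exact ⟨p, hkm, fun l hl => by rw [← h3 l hl, h1 l hl], h2.trans h4⟩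
  · exact ⟨k, hkm, fun l hl => by rw [← h3 l (hl.trans hp), h1 l hl], by rwa [← h3 k hp]⟩

/-- There is a lexsegment staircase whose generators have the same degrees as those of `s`. -/
theorem exists_lex_degree_eq : ∃ b : Fin n → ℕ, ∀ k,
    ((lex b s.le_card).gen k).degree = (s.gen k).degree := by
  -- `D (k + 1) = deg w_k`, and `b` consists of the differences of `D`
  let D : ℕ → ℕ := fun i => (Finset.univ.filter fun k : Fin m => (k : ℕ) < i).sup
    fun k => (s.base k).degree
  have hD : Monotone D := fun i j hij => Finset.sup_mono fun k hk => by
    simp only [Finset.mem_filter, Finset.mem_univ, true_and] at hk ⊢; omega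
  have hD0 : D 0 = 0 := by simp [D]
  have hDk : ∀ k : Fin m, D (k + 1) = (s.base k).degree := fun k =>
    le_antisymm (Finset.sup_le fun l hl => by
      simp only [Finset.mem_filter, Finset.mem_univ, true_and] at hl
      exact Finsupp.degree_mono (s.base_mono (Nat.lt_succ_iff.1 hl : l ≤ k)))
      (Finset.le_sup (f := fun k => (s.base k).degree) (by simp))
  refine ⟨fun i => D (i + 1) - D i, fun k => ?_⟩
  rw [degree_gen, degree_gen, ← hDk, Finsupp.degree_eq_sum]
  congr 1
  simp only [lex_base_apply]
  rw [Fin.sum_univ_eq_sum_range (fun i => if i ≤ (k : ℕ) then D (i + 1) - D i else 0) n,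
    ← Finset.sum_filter]
  have : (Finset.range n).filter (fun i => i ≤ (k : ℕ)) = Finset.range (k + 1) := by
    ext i
    have := k.2
    have := s.le_card
    simp only [Finset.mem_filter, Finset.mem_range]; omega
  rw [this, Finset.sum_range_tsub hD, hD0, tsub_zero]

theorem isGotzmann : IsGotzmann (s.ideal K) := by
  obtain ⟨b, hb⟩ := s.exists_lex_degree_eq
  refine ⟨(lex b s.le_card).ideal K, isLexsegment_lex _ _, fun d => ?_, fun i j => ?_⟩
  · simp only [hilbertFunction_ideal, hb]
  · simp only [bettiNumber_ideal, hb]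

end Staircase

/-! ### Lexsegment ideals with at most `n` generators -/

section Lexsegment

variable {K : Type*} [Field K] {n : ℕ}

theorem eq_of_le_of_degree_le {a b : Fin n →₀ ℕ} (h : a ≤ b) (hd : b.degree ≤ a.degree) :
    a = b := by
  have h1 : a + (b - a) = b := add_tsub_cancel_of_le h
  have h2 : (b - a).degree = 0 := by
    have := congrArg Finsupp.degree h1
    rw [map_add] at this; omega
  rw [Finsupp.degree_eq_zero_iff] at h2
  rw [h2, add_zero] at h1
  exact h1

/-- The first `k` generators, in the order of increasing degree, of a lexsegment ideal with at
least `k` generators form a lexsegment staircase (`k ≤ n`): the next generator is the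
lexicographically largest monomial of its degree outside of the staircase found so far. All other
generators have degree at least `b_1 + ⋯ + b_k + 1`, which makes this monomial exist. -/
theorem exists_lex_gen_mem {L : Ideal (MvPolynomial (Fin n) K)} (hL : IsLexsegment L)
    (htop : L ≠ ⊤) (k : ℕ) (hk : k ≤ n) (hkm : k ≤ (minGens L).card) :
    ∃ b : Fin n → ℕ, (∀ l, (Staircase.lex b hk).gen l ∈ minGens L) ∧
      ∀ u ∈ minGens L, (∀ l, (Staircase.lex b hk).gen l ≠ u) →
        (∑ i : Fin n, if (i : ℕ) < k then b i else 0) + 1 ≤ u.degree := by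
  classical
  induction k with
  | zero =>
    refine ⟨0, fun l => l.elim0, fun u hu _ => ?_⟩
    simp only [not_lt_zero, if_false, Finset.sum_const_zero, zero_add]
    rw [Nat.one_le_iff_ne_zero]
    intro h
    rw [Finsupp.degree_eq_zero_iff] at h
    exact htop (hL.1.eq_top_iff.2 (h ▸ hu))
  | succ k ih =>
    obtain ⟨b, hb1, hb2⟩ := ih (by omega) (by omega)
    have hk' : k ≤ n := by omega
    set s := Staircase.lex b hk' with hs
    let S := ∑ i : Fin n, if (i : ℕ) < k then b i else 0
    obtain ⟨u, hu, humin⟩ := ((minGens L).filter fun u => ∀ l, s.gen l ≠ u).exists_min_image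
      Finsupp.degree (by
        by_contra h
        rw [Finset.not_nonempty_iff_eq_empty, Finset.filter_eq_empty_iff] at h
        have h1 : minGens L ⊆ Finset.univ.image s.gen := fun u hu => by
          have := h hu
          push Not at this
          simpa using this
        have h2 := (Finset.card_le_card h1).trans Finset.card_image_le
        rw [Finset.card_fin] at h2
        omega)
    simp only [Finset.mem_filter, and_imp] at hu humin
    have hS : S + 1 ≤ u.degree := hb2 u hu.1 hu.2
    let p₀ : Fin n := ⟨k, hk⟩
    -- the candidate `x_1^{b_1} ⋯ x_k^{b_k} x_{k+1}^{u.degree - S}` for the next generator, where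
    -- `u` is a further generator of least degree
    let v : Fin n →₀ ℕ := Finsupp.equivFunOnFinite.symm fun i =>
      (if (i : ℕ) < k then b i else 0) + if i = p₀ then u.degree - S else 0
    have hv : ∀ i, v i = (if (i : ℕ) < k then b i else 0) + if i = p₀ then u.degree - S else 0 :=
      fun _ => rfl
    have hvdeg : v.degree = u.degree := by
      rw [Finsupp.degree_eq_sum]
      simp only [hv, Finset.sum_add_distrib, Finset.sum_ite_eq', Finset.mem_univ, if_true]
      change S + _ = _
      omega
    have hvlt : ∀ i : Fin n, (i : ℕ) < k → v i = b i := by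
      intro i hi
      rw [hv, if_pos hi, if_neg (fun h => by rw [h] at hi; exact lt_irrefl _ hi), add_zero]
    have hvgt : ∀ i : Fin n, k < (i : ℕ) → v i = 0 := by
      intro i hi
      rw [hv, if_neg (by omega), if_neg (fun h => by rw [h] at hi; exact lt_irrefl _ hi)]
    have hus : monomial u (1 : K) ∉ s.ideal K := by
      rw [s.monomial_mem_iff]
      rintro ⟨l, hl⟩
      exact hu.2 l (minGens_antichain (hb1 l) hu.1 hl)
    have hvs : monomial v (1 : K) ∉ s.ideal K := by
      rw [Staircase.monomial_mem_lex_iff]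
      rintro ⟨p, hp, -, h⟩
      rw [hvlt p hp] at h
      exact lt_irrefl _ h
    have hvL : monomial v (1 : K) ∈ L := by
      by_cases huv : u = v
      · rw [← huv]; exact (mem_minGens.1 hu.1).1
      refine hL.2 u v hvdeg.symm ?_ (mem_minGens.1 hu.1).1
      obtain ⟨q, hq⟩ : ∃ q, u q ≠ v q := by
        by_contra! h; exact huv (Finsupp.ext h)
      obtain ⟨p, hp, hpmin⟩ := (Finset.univ.filter fun q => u q ≠ v q).exists_min_image id
        ⟨q, by simpa using hq⟩
      simp only [Finset.mem_filter, Finset.mem_univ, true_and, id] at hp hpmin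
      have heq : ∀ i < p, u i = v i := fun i hi => by
        by_contra h; exact absurd (hpmin i h) (not_le.2 hi)
      refine Finsupp.Lex.lt_iff.2 ⟨p, heq, ?_⟩
      simp only [ofLex_toLex]
      by_contra hlt
      have hlt : v p < u p := by omega
      by_cases hpk : (p : ℕ) < k
      · refine hus (Staircase.monomial_mem_lex_iff.2 ⟨p, hpk, fun l hl => ?_, ?_⟩)
        · rw [heq l hl, hvlt l (lt_trans (Fin.lt_def.1 hl) hpk)]
        · rwa [← hvlt p hpk]
      · refine huv (eq_of_le_of_degree_le (fun i => ?_) hvdeg.symm.le).symm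
        rcases lt_trichotomy i p with hi | rfl | hi
        · exact (heq i hi).ge
        · exact hlt.le
        · have : (p : ℕ) < i := hi
          rw [hvgt i (by omega)]; exact Nat.zero_le _
    have hvmin : v ∈ minGens L := by
      obtain ⟨g, hg, hgv⟩ := exists_minGens_le hvL
      have hgs : ∀ l, s.gen l ≠ g := by
        rintro l rfl
        exact hvs (s.monomial_mem_iff.2 ⟨l, hgv⟩)
      have := eq_of_le_of_degree_le hgv (hvdeg.le.trans (humin g hg hgs))
      rwa [← this]
    have hgen : ∀ l : Fin (k + 1),
        (Staircase.lex (Function.update b p₀ (u.degree - S - 1)) hk).gen l =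
        if h : (l : ℕ) < k then s.gen ⟨l, h⟩ else v := by
      intro l
      ext i
      rw [Staircase.lex_gen_apply, Function.update_apply]
      split_ifs with h1 h2 h3 h4 h5 h6 <;>
        simp only [hs, Staircase.lex_gen_apply, hv, Fin.ext_iff, p₀] at * <;>
        have := l.2 <;> split_ifs <;> omega
    refine ⟨Function.update b p₀ (u.degree - S - 1), fun l => ?_, fun w hw hwl => ?_⟩
    · rw [hgen]
      split_ifs
      exacts [hb1 _, hvmin]
    · have h1 : ∀ l, s.gen l ≠ w := by
        intro l
        have := hwl l.castSucc
        rwa [hgen, dif_pos (by simp)] at this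
      refine le_trans ?_ (humin w hw h1)
      have h2 : (∑ i : Fin n, if (i : ℕ) < k + 1 then
          Function.update b p₀ (u.degree - S - 1) i else 0) = S + (u.degree - S - 1) := by
        have h3 : ∀ i : Fin n, (if (i : ℕ) < k + 1 then
            Function.update b p₀ (u.degree - S - 1) i else 0) =
            (if (i : ℕ) < k then b i else 0) + if i = p₀ then u.degree - S - 1 else 0 := by
          intro i
          rw [Function.update_apply]
          split_ifs <;> simp only [Fin.ext_iff, p₀] at * <;> omega
        simp only [h3, Finset.sum_add_distrib, Finset.sum_ite_eq', Finset.mem_univ, if_true, S]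
      rw [h2]; omega

/-- A proper lexsegment ideal with at most `n` generators is a lexsegment staircase. -/
theorem IsLexsegment.exists_eq_lex {L : Ideal (MvPolynomial (Fin n) K)} (hL : IsLexsegment L)
    (htop : L ≠ ⊤) (h : (minGens L).card ≤ n) :
    ∃ b : Fin n → ℕ, L = (Staircase.lex b h).ideal K := by
  classical
  obtain ⟨b, hb, -⟩ := exists_lex_gen_mem hL htop _ h le_rfl
  refine ⟨b, hL.1.ext (Staircase.isMonomialIdeal _) fun a => ?_⟩
  have hG : Finset.univ.image (Staircase.lex b h).gen = minGens L := by
    refine Finset.eq_of_subset_of_card_le (fun u hu => ?_) ?_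
    · obtain ⟨l, -, rfl⟩ := Finset.mem_image.1 hu
      exact hb l
    · rw [Finset.card_image_of_injective _ (Staircase.gen_injective _), Finset.card_fin]
  rw [monomial_mem_iff_exists_minGens, Staircase.monomial_mem_iff]
  constructor
  · rintro ⟨u, hu, hua⟩
    obtain ⟨l, -, rfl⟩ := Finset.mem_image.1 (hG.symm ▸ hu)
    exact ⟨l, hua⟩
  · rintro ⟨l, hl⟩
    exact ⟨_, hb l, hl⟩

theorem card_minGens_eq_of_bettiNumber_zero {I L : Ideal (MvPolynomial (Fin n) K)}
    (hI : IsMonomialIdeal I) (hL : IsMonomialIdeal L)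
    (h : ∀ j, bettiNumber I 0 j = bettiNumber L 0 j) : (minGens I).card = (minGens L).card := by
  classical
  let N := (minGens I ∪ minGens L).sup Finsupp.degree + 1
  have key : ∀ J : Ideal (MvPolynomial (Fin n) K), IsMonomialIdeal J →
      minGens J ⊆ minGens I ∪ minGens L →
      (minGens J).card = ∑ j ∈ Finset.range N, bettiNumber J 0 j := by
    intro J hJ hsub
    rw [Finset.card_eq_sum_card_fiberwise (f := Finsupp.degree) (t := Finset.range N)]
    · exact Finset.sum_congr rfl fun j _ => (bettiNumber_zero hJ j).symm
    · intro u hu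
      rw [Finset.mem_coe, Finset.mem_range]
      exact Nat.lt_succ_of_le (Finset.le_sup (hsub hu))
  rw [key I hI Finset.subset_union_left, key L hL Finset.subset_union_right]
  exact Finset.sum_congr rfl fun j _ => h j

theorem ne_top_of_bettiNumber_zero {I L : Ideal (MvPolynomial (Fin n) K)}
    (hI : IsMonomialIdeal I) (hL : IsMonomialIdeal L)
    (h : ∀ j, bettiNumber I 0 j = bettiNumber L 0 j) (htop : I ≠ ⊤) : L ≠ ⊤ := by
  intro hL'
  have h1 := h 0
  rw [bettiNumber_zero hI, bettiNumber_zero hL] at h1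
  have h2 : 0 < ((minGens I).filter fun a => a.degree = 0).card := by
    rw [h1]
    exact Finset.card_pos.2 ⟨0, Finset.mem_filter.2 ⟨hL.eq_top_iff.1 hL', by simp⟩⟩
  obtain ⟨u, hu⟩ := Finset.card_pos.1 h2
  rw [Finset.mem_filter, Finsupp.degree_eq_zero_iff] at hu
  exact htop (hI.eq_top_iff.2 (hu.2 ▸ hu.1))

/-- A Gotzmann monomial ideal with `m ≤ n` generators has a minimal Taylor resolution: its top
Betti number `β_{m-1}` agrees with that of a lexsegment staircase, hence does not vanish. -/
theorem IsGotzmann.taylorIsMinimal {I : Ideal (MvPolynomial (Fin n) K)} (hI : IsMonomialIdeal I)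
    (htop : I ≠ ⊤) (hG : IsGotzmann I) (hcard : (minGens I).card ≤ n) : TaylorIsMinimal I := by
  obtain ⟨L, hL, -, hbetti⟩ := hG
  have hcardL := card_minGens_eq_of_bettiNumber_zero hI hL.1 (hbetti 0)
  rcases Nat.eq_zero_or_pos (minGens I).card with h0 | hpos
  · rw [taylorIsMinimal_iff, Finset.card_eq_zero.1 h0]
    simp
  obtain ⟨b, hb⟩ := hL.exists_eq_lex (ne_top_of_bettiNumber_zero hI hL.1 (hbetti 0) htop)
    (by omega)
  set s := Staircase.lex b (n := n) (m := (minGens L).card) (by omega)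
  let k : Fin (minGens L).card := ⟨(minGens L).card - 1, by omega⟩
  have hne : bettiNumber I ((minGens I).card - 1)
      ((s.gen k).degree + ((minGens I).card - 1)) ≠ 0 := by
    rw [hbetti, congrArg (fun J => bettiNumber J _ _) hb, Staircase.bettiNumber_ideal,
      ← Nat.pos_iff_ne_zero]
    refine Finset.sum_pos' (fun _ _ => Nat.zero_le _) ⟨k, Finset.mem_univ _, ?_⟩
    rw [if_pos rfl, hcardL]
    exact Nat.choose_pos le_rfl
  obtain ⟨a, ha⟩ := exists_not_ex_of_bettiNumber_ne_zero hI hne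
  exact taylorIsMinimal_of_not_ex hI htop (by omega) ha

end Lexsegment

/-! ### Reverse lexicographic initial monomials -/

section RevLex

variable {K : Type*} [Field K] {n : ℕ}

/-- An embedding of the monomials into a linear order that induces the reverse lexicographic
order. -/
def revKey (a : Fin n →₀ ℕ) : ℕ ×ₗ (Colex (Fin n →₀ ℕ))ᵒᵈ :=
  toLex (a.degree, OrderDual.toDual (toColex a))

theorem revKey_injective : Function.Injective (revKey : (Fin n →₀ ℕ) → _) := fun a b h => by
  simpa [revKey] using congrArg (fun x => (ofLex x).2) h

theorem revLexLT_iff {a b : Fin n →₀ ℕ} : RevLexLT a b ↔ revKey a < revKey b := by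
  rw [revKey, revKey, Prod.Lex.toLex_lt_toLex]
  simp only [OrderDual.toDual_lt_toDual, RevLexLT]
  rw [Finsupp.Colex.lt_iff]
  simp only [ofColex_toColex, and_comm, eq_comm]

theorem RevLexLT.trans {a b c : Fin n →₀ ℕ} (h : RevLexLT a b) (h' : RevLexLT b c) :
    RevLexLT a c := by
  rw [revLexLT_iff] at *; exact h.trans h'

theorem revLexLT_irrefl (a : Fin n →₀ ℕ) : ¬ RevLexLT a a := by
  rw [revLexLT_iff]; exact lt_irrefl _

theorem RevLexLT.ne {a b : Fin n →₀ ℕ} (h : RevLexLT a b) : a ≠ b := by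
  rintro rfl; exact revLexLT_irrefl a h

theorem revLexLT_trichotomy {a b : Fin n →₀ ℕ} (h : a ≠ b) : RevLexLT a b ∨ RevLexLT b a := by
  rw [revLexLT_iff, revLexLT_iff]
  exact lt_or_gt_of_ne fun h' => h (revKey_injective h')

theorem RevLexLT.add_right {a b : Fin n →₀ ℕ} (h : RevLexLT a b) (c : Fin n →₀ ℕ) :
    RevLexLT (a + c) (b + c) := by
  rcases h with h | ⟨h, k, hk, hl⟩
  · left; rw [map_add, map_add]; omega
  · refine Or.inr ⟨by rw [map_add, map_add, h], k, by simpa using hk, fun l h' => ?_⟩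
    rw [Finsupp.add_apply, Finsupp.add_apply, hl l h']

theorem wellFounded_revLexLT : WellFounded (RevLexLT (n := n)) := by
  have hfin : ∀ b : Fin n →₀ ℕ, {a | RevLexLT a b}.Finite := fun b => by
    refine (Set.Finite.biUnion (Finset.range (b.degree + 1)).finite_toSet
      fun j _ => finite_degree_eq n j).subset fun a ha => ?_
    simp only [Set.mem_iUnion, Set.mem_ofPred_eq, Finset.coe_range, Set.mem_Iio]
    refine ⟨a.degree, ?_, rfl⟩
    rcases ha with h | ⟨h, -⟩ <;> omega
  refine Subrelation.wf (r := InvImage (· < ·) fun b => {a | RevLexLT a b}.ncard) ?_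
    (InvImage.wf _ wellFounded_lt)
  intro a b h
  refine Set.ncard_lt_ncard ⟨fun c hc => RevLexLT.trans hc h, fun hsub => ?_⟩ (hfin b)
  exact revLexLT_irrefl a (hsub h)

theorem IsInitialMonomial.coeff_ne_zero {f : MvPolynomial (Fin n) K} {a : Fin n →₀ ℕ}
    (h : IsInitialMonomial f a) : coeff a f ≠ 0 := mem_support_iff.1 h.1

theorem IsInitialMonomial.eq_or_lt {f : MvPolynomial (Fin n) K} {a b : Fin n →₀ ℕ}
    (h : IsInitialMonomial f a) (hb : b ∈ f.support) : b = a ∨ RevLexLT b a := by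
  by_cases hba : b = a
  exacts [Or.inl hba, Or.inr (h.2 b hb hba)]

theorem exists_isInitialMonomial {f : MvPolynomial (Fin n) K} (hf : f ≠ 0) :
    ∃ a, IsInitialMonomial f a := by
  obtain ⟨a, ha, hmax⟩ := f.support.exists_max_image revKey (support_nonempty.2 hf)
  refine ⟨a, ha, fun b hb hba => revLexLT_iff.2 (lt_of_le_of_ne (hmax b hb) ?_)⟩
  exact fun h => hba (revKey_injective h)

theorem isInitialMonomial_monomial (a : Fin n →₀ ℕ) {c : K} (hc : c ≠ 0) :
    IsInitialMonomial (monomial a c) a := by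
  classical
  refine ⟨by simp [hc], fun b hb hba => ?_⟩
  rw [support_monomial, if_neg hc, Finset.mem_singleton] at hb
  exact absurd hb hba

theorem IsInitialMonomial.mul {f g : MvPolynomial (Fin n) K} {a b : Fin n →₀ ℕ}
    (hf : IsInitialMonomial f a) (hg : IsInitialMonomial g b) :
    IsInitialMonomial (f * g) (a + b) := by
  classical
  have key : ∀ x ∈ f.support, ∀ y ∈ g.support, (x, y) ≠ (a, b) → RevLexLT (x + y) (a + b) := by
    intro x hx y hy hne
    rcases hf.eq_or_lt hx with rfl | h1 <;> rcases hg.eq_or_lt hy with rfl | h2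
    · exact absurd rfl hne
    · rw [add_comm x y, add_comm x b]; exact h2.add_right x
    · exact h1.add_right y
    · refine (h1.add_right y).trans ?_
      rw [add_comm a y, add_comm a b]; exact h2.add_right a
  constructor
  · rw [mem_support_iff, coeff_mul, Finset.sum_eq_single (a, b)]
    · exact mul_ne_zero hf.coeff_ne_zero hg.coeff_ne_zero
    · rintro ⟨x, y⟩ hxy hne
      rw [Finset.HasAntidiagonal.mem_antidiagonal] at hxy
      by_contra h
      refine (key x ?_ y ?_ hne).ne hxy
      · exact mem_support_iff.2 (left_ne_zero_of_mul h)
      · exact mem_support_iff.2 (right_ne_zero_of_mul h)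
    · intro h; simp at h
  · intro c hc hne
    obtain ⟨x, hx, y, hy, rfl⟩ := Finset.mem_add.1 (support_mul f g hc)
    refine key x hx y hy fun h => hne ?_
    rw [(Prod.mk.inj h).1, (Prod.mk.inj h).2]

theorem isMonomialIdeal_initialIdeal (F : Ideal (MvPolynomial (Fin n) K)) :
    IsMonomialIdeal (initialIdeal F) := by
  refine ⟨{a | ∃ f ∈ F, IsInitialMonomial f a}, ?_⟩
  rw [initialIdeal]
  congr 1
  ext m
  simp only [Set.mem_image, Set.mem_ofPred_eq]
  exact ⟨fun ⟨f, hf, a, ha, h⟩ => ⟨a, ⟨f, hf, ha⟩, h.symm⟩,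
    fun ⟨a, ⟨f, hf, ha⟩, h⟩ => ⟨f, hf, a, ha, h.symm⟩⟩

theorem monomial_mem_initialIdeal {F : Ideal (MvPolynomial (Fin n) K)} {a : Fin n →₀ ℕ} :
    monomial a (1 : K) ∈ initialIdeal F ↔ ∃ f ∈ F, IsInitialMonomial f a := by
  constructor
  · intro h
    have hset : {m | ∃ f ∈ F, ∃ a, IsInitialMonomial f a ∧ m = monomial a (1 : K)} =
        (fun a => monomial a (1 : K)) '' {a | ∃ f ∈ F, IsInitialMonomial f a} := by
      ext m
      simp only [Set.mem_image, Set.mem_ofPred_eq]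
      exact ⟨fun ⟨f, hf, a, ha, h⟩ => ⟨a, ⟨f, hf, ha⟩, h.symm⟩,
        fun ⟨a, ⟨f, hf, ha⟩, h⟩ => ⟨f, hf, a, ha, h.symm⟩⟩
    rw [initialIdeal, hset, monomial_mem_span_iff] at h
    obtain ⟨b, ⟨f, hf, hb⟩, hba⟩ := h
    refine ⟨f * monomial (a - b) 1, F.mul_mem_right _ hf, ?_⟩
    have := hb.mul (isInitialMonomial_monomial (a - b) (one_ne_zero (α := K)))
    rwa [add_tsub_cancel_of_le hba] at this
  · rintro ⟨f, hf, h⟩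
    exact Ideal.subset_span ⟨f, hf, a, h, rfl⟩

theorem IsInitialMonomial.homogeneousComponent {f : MvPolynomial (Fin n) K} {a : Fin n →₀ ℕ}
    (h : IsInitialMonomial f a) :
    IsInitialMonomial (homogeneousComponent a.degree f) a := by
  constructor
  · rw [support_homogeneousComponent, Finset.mem_filter]
    exact ⟨h.1, rfl⟩
  · intro b hb
    rw [support_homogeneousComponent, Finset.mem_filter] at hb
    exact h.2 b hb.1

/-- Polynomials with distinct initial monomials are linearly independent, so a homogeneous part of
an ideal has at least the dimension given by its initial monomials. -/
theorem card_le_hilbertFunction {F : Ideal (MvPolynomial (Fin n) K)} {d : ℕ}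
    {T : Finset (Fin n →₀ ℕ)}
    (hT : ∀ v ∈ T, ∃ f ∈ F, f.IsHomogeneous d ∧ IsInitialMonomial f v) :
    T.card ≤ hilbertFunction F d := by
  classical
  have hfin : Module.Finite K (homogeneousSubmodule (Fin n) K d) := by
    have hf := (finite_degree_eq n d).to_subtype
    have h1 : Module.Finite K (restrictSupport K {a : Fin n →₀ ℕ | a.degree = d}) :=
      Module.Finite.of_basis (basisRestrictSupport K _)
    refine Submodule.finiteDimensional_of_le
      (S₂ := restrictSupport K {a : Fin n →₀ ℕ | a.degree = d}) fun f hf => ?_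
    rw [mem_restrictSupport_iff]
    intro b hb
    by_contra h
    exact mem_support_iff.1 hb (((mem_homogeneousSubmodule _ _).1 hf).coeff_eq_zero h)
  have : Module.Finite K ↥(F.restrictScalars K ⊓ homogeneousSubmodule (Fin n) K d) :=
    Submodule.finiteDimensional_of_le (S₂ := homogeneousSubmodule (Fin n) K d) inf_le_right
  choose! f hfF hfd hfv using hT
  let φ : T → ↥(F.restrictScalars K ⊓ homogeneousSubmodule (Fin n) K d) :=
    fun v => ⟨f v, hfF v v.2, hfd v v.2⟩
  have hφ : LinearIndependent K φ := by
    rw [linearIndependent_iff']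
    intro s c hsum
    by_contra! hne
    obtain ⟨v₀, hv₀s, hv₀⟩ := hne
    obtain ⟨v, hv, hmax⟩ := (s.filter fun v => c v ≠ 0).exists_max_image (fun v => revKey v.1)
      ⟨v₀, Finset.mem_filter.2 ⟨hv₀s, hv₀⟩⟩
    rw [Finset.mem_filter] at hv
    have h1 := congrArg (fun x => coeff v.1 x.1) hsum
    simp only [Submodule.coe_sum, Submodule.coe_smul, coeff_sum, coeff_smul, φ,
      Submodule.coe_zero, coeff_zero] at h1
    rw [Finset.sum_eq_single v] at h1
    · exact mul_ne_zero hv.2 (hfv v v.2).coeff_ne_zero h1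
    · intro w hw hne
      by_cases hcw : c w = 0
      · rw [hcw, zero_smul]
      · have h2 : ¬ RevLexLT v.1 w.1 := by
          rw [revLexLT_iff]
          exact not_lt.2 (hmax w (Finset.mem_filter.2 ⟨hw, hcw⟩))
        have h3 : v.1 ∉ (f w).support := fun h =>
          h2 ((hfv w w.2).2 _ h fun h' => hne (Subtype.ext h'.symm))
        rw [notMem_support_iff.1 h3, smul_zero]
    · intro h; exact absurd hv.1 h
  simpa [hilbertFunction] using hφ.fintype_card_le_finrank

end RevLex

/-! ### Linear changes of coordinates -/

section CoordChange

variable {K : Type*} [Field K] {n : ℕ}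

theorem coordChange_X (g : GL (Fin n) K) (j : Fin n) :
    coordChange g (X j) = ∑ i, C ((g : Matrix (Fin n) (Fin n) K) i j) * X i := by
  simp [coordChange]

theorem coordChange_mul (g h : GL (Fin n) K) (f : MvPolynomial (Fin n) K) :
    coordChange (g * h) f = coordChange g (coordChange h f) := by
  suffices coordChange (g * h) = (coordChange g).comp (coordChange h) by
    rw [this, AlgHom.comp_apply]
  refine algHom_ext fun j => ?_
  rw [AlgHom.comp_apply, coordChange_X, coordChange_X, map_sum]
  simp_rw [map_mul, coordChange_X, algHom_C, algebraMap_eq, Finset.mul_sum]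
  rw [Finset.sum_comm]
  refine Finset.sum_congr rfl fun i _ => ?_
  rw [Units.val_mul, Matrix.mul_apply, map_sum, Finset.sum_mul]
  refine Finset.sum_congr rfl fun k _ => ?_
  rw [C_mul]; ring

theorem coordChange_one (f : MvPolynomial (Fin n) K) : coordChange (1 : GL (Fin n) K) f = f := by
  suffices coordChange (1 : GL (Fin n) K) = AlgHom.id K _ by rw [this, AlgHom.id_apply]
  refine algHom_ext fun j => ?_
  rw [coordChange_X, AlgHom.id_apply, Finset.sum_eq_single j]
  · simp
  · intro i _ hij; simp [Matrix.one_apply_ne hij]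
  · simp

theorem coordChange_inv_apply (g : GL (Fin n) K) (f : MvPolynomial (Fin n) K) :
    coordChange g⁻¹ (coordChange g f) = f := by
  rw [← coordChange_mul, inv_mul_cancel, coordChange_one]

theorem coordChange_apply_inv (g : GL (Fin n) K) (f : MvPolynomial (Fin n) K) :
    coordChange g (coordChange g⁻¹ f) = f := by
  rw [← coordChange_mul, mul_inv_cancel, coordChange_one]

theorem mem_map_coordChange {g : GL (Fin n) K} {I : Ideal (MvPolynomial (Fin n) K)}
    {f : MvPolynomial (Fin n) K} : f ∈ I.map (coordChange g) ↔ coordChange g⁻¹ f ∈ I := by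
  rw [Ideal.mem_map_iff_of_surjective _ fun f => ⟨_, coordChange_apply_inv g f⟩]
  constructor
  · rintro ⟨x, hx, rfl⟩
    rwa [coordChange_inv_apply]
  · intro h
    exact ⟨_, h, coordChange_apply_inv g f⟩

theorem coordChange_isHomogeneous (g : GL (Fin n) K) {f : MvPolynomial (Fin n) K} {d : ℕ}
    (hf : f.IsHomogeneous d) : (coordChange g f).IsHomogeneous d := by
  have := hf.aeval (n := 1) (fun j => ∑ i, C ((g : Matrix (Fin n) (Fin n) K) i j) * X i)
    fun j => IsHomogeneous.sum _ _ _ fun i _ => by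
      simpa using (isHomogeneous_C (Fin n) _).mul (isHomogeneous_X K i)
  rwa [one_mul] at this

theorem homogeneousComponent_coordChange (g : GL (Fin n) K) (d : ℕ)
    (f : MvPolynomial (Fin n) K) :
    homogeneousComponent d (coordChange g f) = coordChange g (homogeneousComponent d f) := by
  conv_lhs => rw [← sum_homogeneousComponent f]
  conv_rhs => rw [← sum_homogeneousComponent f]
  simp only [map_sum]
  refine Finset.sum_congr rfl fun i _ => ?_
  have h1 := homogeneousComponent_isHomogeneous i f
  rw [homogeneousComponent_of_mem ((mem_homogeneousSubmodule _ _).2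
    (coordChange_isHomogeneous g h1)), homogeneousComponent_of_mem
      ((mem_homogeneousSubmodule _ _).2 h1)]
  split_ifs <;> simp

theorem IsMonomialIdeal.homogeneousComponent_mem_map {I : Ideal (MvPolynomial (Fin n) K)}
    (hI : IsMonomialIdeal I) (g : GL (Fin n) K) {f : MvPolynomial (Fin n) K}
    (hf : f ∈ I.map (coordChange g)) (d : ℕ) :
    homogeneousComponent d f ∈ I.map (coordChange g) := by
  rw [mem_map_coordChange] at hf ⊢
  rw [← homogeneousComponent_coordChange, hI.mem_iff]
  intro b hb
  rw [support_homogeneousComponent, Finset.mem_filter] at hb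
  exact hI.mem_iff.1 hf b hb.1

theorem hilbertFunction_map_coordChange (g : GL (Fin n) K)
    (I : Ideal (MvPolynomial (Fin n) K)) (d : ℕ) :
    hilbertFunction (I.map (coordChange g)) d = hilbertFunction I d := by
  have h : (I.map (coordChange g)).restrictScalars K ⊓ homogeneousSubmodule (Fin n) K d =
      (I.restrictScalars K ⊓ homogeneousSubmodule (Fin n) K d).map
        (coordChange g).toLinearMap := by
    ext f
    simp only [Submodule.mem_inf, Submodule.restrictScalars_mem, mem_map_coordChange,
      mem_homogeneousSubmodule, Submodule.mem_map, AlgHom.toLinearMap_apply]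
    constructor
    · rintro ⟨h1, h2⟩
      exact ⟨_, ⟨h1, coordChange_isHomogeneous _ h2⟩, coordChange_apply_inv g f⟩
    · rintro ⟨x, ⟨h1, h2⟩, rfl⟩
      rw [coordChange_inv_apply]
      exact ⟨h1, coordChange_isHomogeneous g h2⟩
  have hinj : Function.Injective (coordChange g).toLinearMap := fun x y hxy => by
    simpa [coordChange_inv_apply] using congrArg (coordChange g⁻¹) hxy
  rw [hilbertFunction, h]
  exact (Submodule.equivMapOfInjective _ hinj _).finrank_eq.symm

end CoordChange

/-! ### Generic matrices -/

section Generic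

variable {K : Type*} [Field K] {n : ℕ}

/-- The minor of the generic `n × n` matrix with the first `j` rows and the columns `τ`. -/
def topMinor (K : Type*) [Field K] {n : ℕ} {j : ℕ} (hj : j ≤ n) (τ : Fin j → Fin n) :
    MvPolynomial (Fin n × Fin n) K :=
  ((Matrix.mvPolynomialX (Fin n) (Fin n) K).submatrix (Fin.castLE hj) τ).det

theorem eval_topMinor {j : ℕ} (hj : j ≤ n) (τ : Fin j → Fin n) (g : Matrix (Fin n) (Fin n) K) :
    eval (fun e => g e.1 e.2) (topMinor K hj τ) = (g.submatrix (Fin.castLE hj) τ).det := by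
  rw [topMinor, RingHom.map_det]
  congr 1
  ext r c
  simp

theorem topMinor_ne_zero {j : ℕ} (hj : j ≤ n) {τ : Fin j → Fin n} (hτ : Function.Injective τ) :
    topMinor K hj τ ≠ 0 := by
  intro h
  -- evaluate at the matrix whose entries `(r, τ r)` are `1` and whose other entries are `0`
  have h1 := eval_topMinor (K := K) hj τ
    (Matrix.of fun r c => if ∃ s : Fin j, Fin.castLE hj s = r ∧ τ s = c then 1 else 0)
  rw [h, map_zero] at h1
  have h2 : (Matrix.of fun r c => if ∃ s : Fin j, Fin.castLE hj s = r ∧ τ s = c then (1 : K)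
      else 0).submatrix (Fin.castLE hj) τ = 1 := by
    ext r c
    rw [Matrix.submatrix_apply, Matrix.of_apply, Matrix.one_apply]
    by_cases hrc : r = c
    · subst hrc
      rw [if_pos rfl, if_pos ⟨r, rfl, rfl⟩]
    · rw [if_neg hrc, if_neg]
      rintro ⟨s, hs, hs'⟩
      exact hrc ((Fin.castLE_injective hj hs).symm.trans (hτ hs'))
  rw [h2, Matrix.det_one] at h1
  exact zero_ne_one h1

/-- The product of all minors of the generic matrix with rows `1, …, j`, for all `j`. -/
def topMinorProduct (K : Type*) [Field K] (n : ℕ) : MvPolynomial (Fin n × Fin n) K :=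
  ∏ j : Fin (n + 1), ∏ τ : Fin j ↪ Fin n, topMinor K (Nat.lt_succ_iff.1 j.2) τ

theorem topMinorProduct_ne_zero : topMinorProduct K n ≠ 0 :=
  Finset.prod_ne_zero_iff.2 fun _ _ => Finset.prod_ne_zero_iff.2 fun τ _ =>
    topMinor_ne_zero _ τ.injective

theorem det_submatrix_ne_zero {g : Matrix (Fin n) (Fin n) K}
    (hg : eval (fun e => g e.1 e.2) (topMinorProduct K n) ≠ 0) {j : ℕ} (hj : j ≤ n)
    {τ : Fin j → Fin n} (hτ : Function.Injective τ) :
    (g.submatrix (Fin.castLE hj) τ).det ≠ 0 := by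
  rw [topMinorProduct, map_prod] at hg
  have h1 := Finset.prod_ne_zero_iff.1 hg ⟨j, Nat.lt_succ_iff.2 hj⟩ (Finset.mem_univ _)
  rw [map_prod] at h1
  have h2 := Finset.prod_ne_zero_iff.1 h1 ⟨τ, hτ⟩ (Finset.mem_univ _)
  rwa [eval_topMinor] at h2

/-- If the top minors of `g` do not vanish, then column `x` can be reduced by the columns `τ` to a
vector whose first nonzero entry is in row `j`. -/
theorem exists_column_reduction {g : Matrix (Fin n) (Fin n) K}
    (hg : eval (fun e => g e.1 e.2) (topMinorProduct K n) ≠ 0) {j : ℕ} (hj : j < n)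
    {τ : Fin j → Fin n} (hτ : Function.Injective τ) {x : Fin n} (hx : ∀ s, τ s ≠ x) :
    ∃ c : Fin j → K, (∀ t : Fin n, (t : ℕ) < j → ∑ s, c s * g t (τ s) + g t x = 0) ∧
      ∑ s, c s * g ⟨j, hj⟩ (τ s) + g ⟨j, hj⟩ x ≠ 0 := by
  set A := g.submatrix (Fin.castLE hj.le) τ with hA
  have hdet : IsUnit A.det := isUnit_iff_ne_zero.2 (det_submatrix_ne_zero hg hj.le hτ)
  set c : Fin j → K := -(A⁻¹.mulVec fun r => g (Fin.castLE hj.le r) x) with hc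
  have h1 : A.mulVec c = -fun r => g (Fin.castLE hj.le r) x := by
    rw [hc, Matrix.mulVec_neg, Matrix.mulVec_mulVec, Matrix.mul_nonsing_inv _ hdet,
      Matrix.one_mulVec]
  have h2 : ∀ t : Fin n, (t : ℕ) < j → ∑ s, c s * g t (τ s) + g t x = 0 := by
    intro t ht
    have h3 := congrFun h1 ⟨t, ht⟩
    simp only [Matrix.mulVec, dotProduct, hA, Matrix.submatrix_apply, Pi.neg_apply] at h3
    have h4 : Fin.castLE hj.le ⟨t, ht⟩ = t := rfl
    rw [h4] at h3
    rw [← sub_neg_eq_add, ← h3, sub_eq_zero]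
    exact Finset.sum_congr rfl fun s _ => mul_comm _ _
  refine ⟨c, h2, fun h3 => ?_⟩
  have hinj : Function.Injective (Fin.snoc τ x : Fin (j + 1) → Fin n) := by
    intro a b hab
    induction a using Fin.lastCases with
    | last =>
      induction b using Fin.lastCases with
      | last => rfl
      | cast b => rw [Fin.snoc_last, Fin.snoc_castSucc] at hab; exact absurd hab.symm (hx b)
    | cast a =>
      induction b using Fin.lastCases with
      | last => rw [Fin.snoc_last, Fin.snoc_castSucc] at hab; exact absurd hab (hx a)
      | cast b =>
        rw [Fin.snoc_castSucc, Fin.snoc_castSucc] at hab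
        rw [hτ hab]
  have h4 := Matrix.eq_zero_of_mulVec_eq_zero
    (det_submatrix_ne_zero hg (Nat.succ_le_of_lt hj) hinj)
    (v := (Fin.snoc c 1 : Fin (j + 1) → K)) (by
      ext r
      simp only [Matrix.mulVec, dotProduct, Fin.sum_univ_castSucc, Fin.snoc_castSucc,
        Fin.snoc_last, Matrix.submatrix_apply, mul_one, Pi.zero_apply]
      have hr : ((Fin.castLE (Nat.succ_le_of_lt hj) r : Fin n) : ℕ) < j + 1 := r.2
      rw [← (show ∑ s, c s * g (Fin.castLE (Nat.succ_le_of_lt hj) r) (τ s) +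
        g (Fin.castLE (Nat.succ_le_of_lt hj) r) x = 0 from ?_)]
      · congr 1
        exact Finset.sum_congr rfl fun s _ => mul_comm _ _
      · rcases Nat.lt_succ_iff_lt_or_eq.1 hr with hr | hr
        · exact h2 _ hr
        · rw [show (Fin.castLE (Nat.succ_le_of_lt hj) r : Fin n) = ⟨j, hj⟩ from Fin.ext hr]
          exact h3)
  have h5 := congrFun h4 (Fin.last j)
  rw [Fin.snoc_last] at h5
  exact one_ne_zero h5

theorem isInitialMonomial_linear {y : Fin n → K} {j : Fin n} (h0 : ∀ t < j, y t = 0)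
    (hj : y j ≠ 0) : IsInitialMonomial (∑ t, C (y t) * X t) (Finsupp.single j 1) := by
  classical
  have hcoeff : ∀ b, coeff b (∑ t, C (y t) * X t : MvPolynomial (Fin n) K) =
      ∑ t, if Finsupp.single t 1 = b then y t else 0 := by
    intro b
    rw [coeff_sum]
    refine Finset.sum_congr rfl fun t _ => ?_
    rw [coeff_C_mul, coeff_X, mul_ite, mul_one, mul_zero]
  constructor
  · rw [mem_support_iff, hcoeff, Finset.sum_eq_single j]
    · rwa [if_pos rfl]
    · intro t _ htj
      rw [if_neg fun h => htj (Finsupp.single_left_injective one_ne_zero h)]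
    · simp
  · intro b hb hbj
    rw [mem_support_iff, hcoeff] at hb
    obtain ⟨t, -, ht⟩ := Finset.exists_ne_zero_of_sum_ne_zero hb
    split_ifs at ht with h
    · subst h
      have htj : t ≠ j := fun h => hbj (by rw [h])
      have hlt : j < t := by
        by_contra hlt
        exact ht (h0 t (lt_of_le_of_ne (not_lt.1 hlt) htj))
      refine Or.inr ⟨by simp, t, ?_, fun l hl => ?_⟩
      · rw [Finsupp.single_eq_of_ne htj, Finsupp.single_eq_same]; exact Nat.one_pos
      · rw [Finsupp.single_eq_of_ne hl.ne', Finsupp.single_eq_of_ne (hlt.trans hl).ne']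
    · exact absurd rfl ht

end Generic

/-! ### The generic initial ideal of a staircase ideal -/

namespace Staircase

variable {K : Type*} [Field K] {m n : ℕ} (s : Staircase m n)

/-- Polynomials `q` which behave in `g I` like `g w`, for a monomial `w` dividing all generators
`u_t`, `t ≥ κ`: multiplication by `g x_{i_l}`, for `l < κ`, and by `g (u_t / w)`, for `t ≥ κ`,
leads into `g I`. -/
def Admissible (F : Ideal (MvPolynomial (Fin n) K)) (g : GL (Fin n) K) (κ : Fin m)
    (w : Fin n →₀ ℕ) (q : MvPolynomial (Fin n) K) : Prop :=
  (∀ l < κ, q * coordChange g (X (s.idx l)) ∈ F) ∧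
    ∀ t, κ ≤ t → q * coordChange g (monomial (s.gen t - w) 1) ∈ F

variable {g : GL (Fin n) K}

/-- Modulo the linear forms `g x_{i_l}`, `l < κ`, the linear form `g x` is congruent to one with
the initial monomial `x_κ`, if `x` is not among the `x_{i_l}`. -/
theorem exists_reduced_form
    (hg : eval (fun e => (g : Matrix (Fin n) (Fin n) K) e.1 e.2) (topMinorProduct K n) ≠ 0)
    (κ : Fin m) {x : Fin n} (hx : x ∉ s.prev κ) :
    ∃ (c : Fin m → K) (h : MvPolynomial (Fin n) K),
      h = ∑ l ∈ Finset.Iio κ, C (c l) * coordChange g (X (s.idx l)) + coordChange g (X x) ∧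
      IsInitialMonomial h (Finsupp.single (Fin.castLE s.le_card κ) 1) := by
  have hκn : (κ : ℕ) < n := κ.2.trans_le s.le_card
  let τ : Fin κ → Fin n := fun l => s.idx (Fin.castLE κ.2.le l)
  obtain ⟨c, h0, h1⟩ := exists_column_reduction hg hκn (τ := τ)
    (fun a b h => Fin.castLE_injective _ (s.idx_injective h)) (x := x)
    (fun l h => hx (s.mem_prev.2 ⟨_, Fin.lt_def.2 l.2, h⟩))
  refine ⟨fun l => if h : l < κ then c ⟨l, h⟩ else 0, _, rfl, ?_⟩
  have hsum : ∀ f : Fin m → MvPolynomial (Fin n) K,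
      ∑ l ∈ Finset.Iio κ, f l = ∑ l : Fin κ, f (Fin.castLE κ.2.le l) := by
    intro f
    symm
    refine Finset.sum_bij (fun l _ => Fin.castLE κ.2.le l) ?_ ?_ ?_ ?_
    · intro l _; rw [Finset.mem_Iio]; exact Fin.lt_def.2 l.2
    · intro a _ b _ h; exact Fin.castLE_injective _ h
    · intro l hl
      exact ⟨⟨l, Fin.lt_def.1 (Finset.mem_Iio.1 hl)⟩, Finset.mem_univ _, rfl⟩
    · intros; rfl
  have heq : ∑ l ∈ Finset.Iio κ, C (if h : l < κ then c ⟨l, h⟩ else 0) *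
      coordChange g (X (s.idx l)) + coordChange g (X x) = ∑ t, C (∑ l, c l *
        (g : Matrix (Fin n) (Fin n) K) t (τ l) + (g : Matrix (Fin n) (Fin n) K) t x) * X t := by
    rw [hsum]
    have hc : ∀ l : Fin κ, (if h : Fin.castLE κ.2.le l < κ then
        c ⟨Fin.castLE κ.2.le l, h⟩ else 0) = c l := fun l => dif_pos (Fin.lt_def.2 l.2)
    simp only [hc, coordChange_X, map_add, map_sum, add_mul, Finset.sum_add_distrib,
      Finset.mul_sum, Finset.sum_mul, C_mul]
    rw [Finset.sum_comm]
    congr 1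
    refine Finset.sum_congr rfl fun t _ => Finset.sum_congr rfl fun l _ => ?_
    rw [mul_assoc]
  rw [heq]
  exact isInitialMonomial_linear (fun t ht => h0 t (Fin.lt_def.1 ht)) h1

theorem Admissible.mul_mem {F : Ideal (MvPolynomial (Fin n) K)} {κ : Fin m} {w : Fin n →₀ ℕ}
    {q p : MvPolynomial (Fin n) K} (hq : s.Admissible F g κ w q) (c : Fin m → K) :
    q * (∑ l ∈ Finset.Iio κ, C (c l) * coordChange g (X (s.idx l))) * p ∈ F := by
  refine F.mul_mem_right _ ?_
  rw [Finset.mul_sum]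
  refine F.sum_mem fun l hl => ?_
  rw [mul_left_comm]
  exact F.mul_mem_left _ (hq.1 l (Finset.mem_Iio.1 hl))

/-- Multiplication by a reduced linear form takes the place of multiplication by `g x`. -/
theorem Admissible.exists_single
    (hg : eval (fun e => (g : Matrix (Fin n) (Fin n) K) e.1 e.2) (topMinorProduct K n) ≠ 0)
    {F : Ideal (MvPolynomial (Fin n) K)} {κ : Fin m} {w v : Fin n →₀ ℕ}
    {q : MvPolynomial (Fin n) K} (hq : s.Admissible F g κ w q) (hv : IsInitialMonomial q v)
    {x : Fin n} (hx : x ∉ s.prev κ) (hw : ∀ t, κ ≤ t → w + Finsupp.single x 1 ≤ s.gen t) :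
    ∃ q', s.Admissible F g κ (w + Finsupp.single x 1) q' ∧
      IsInitialMonomial q' (v + Finsupp.single (Fin.castLE s.le_card κ) 1) := by
  obtain ⟨c, h, rfl, hin⟩ := s.exists_reduced_form hg κ hx
  refine ⟨_, ⟨fun l hl => ?_, fun t ht => ?_⟩, hv.mul hin⟩
  · rw [mul_right_comm]
    exact F.mul_mem_right _ (hq.1 l hl)
  · rw [mul_add, add_mul]
    refine F.add_mem (hq.mul_mem s c) ?_
    have h1 : Finsupp.single x 1 + (s.gen t - (w + Finsupp.single x 1)) = s.gen t - w := by
      rw [tsub_add_eq_tsub_tsub, add_tsub_cancel_of_le]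
      exact le_tsub_of_add_le_left (hw t ht)
    rw [mul_assoc, ← map_mul, X, monomial_mul, one_mul, h1]
    exact hq.2 t ht

theorem Admissible.exists_add
    (hg : eval (fun e => (g : Matrix (Fin n) (Fin n) K) e.1 e.2) (topMinorProduct K n) ≠ 0)
    {F : Ideal (MvPolynomial (Fin n) K)} {κ : Fin m} (N : ℕ) {w v c : Fin n →₀ ℕ}
    {q : MvPolynomial (Fin n) K} (hq : s.Admissible F g κ w q) (hv : IsInitialMonomial q v)
    (hN : c.degree = N) (hc : ∀ x ∈ s.prev κ, c x = 0)
    (hw : ∀ t, κ ≤ t → w + c ≤ s.gen t) :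
    ∃ q', s.Admissible F g κ (w + c) q' ∧
      IsInitialMonomial q' (v + Finsupp.single (Fin.castLE s.le_card κ) N) := by
  induction N generalizing w v c q with
  | zero =>
    rw [Finsupp.degree_eq_zero_iff] at hN
    subst hN
    exact ⟨q, by rwa [add_zero], by rwa [Finsupp.single_zero, add_zero]⟩
  | succ N ih =>
    obtain ⟨x, hx⟩ : ∃ x, c x ≠ 0 := by
      by_contra! h
      have : c = 0 := Finsupp.ext h
      subst this
      simp at hN
    have hsub : c - Finsupp.single x 1 + Finsupp.single x 1 = c :=
      tsub_add_cancel_of_le (Finsupp.single_le_iff.2 (Nat.one_le_iff_ne_zero.2 hx))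
    obtain ⟨q₁, h1, h2⟩ := hq.exists_single s hg hv (x := x) (fun h => hx (hc x h))
      fun t ht => le_trans (by gcongr; rw [← hsub]; exact le_add_self) (hw t ht)
    have hc' : w + Finsupp.single x 1 + (c - Finsupp.single x 1) = w + c := by
      rw [add_assoc, add_comm (Finsupp.single x 1), hsub]
    obtain ⟨q₂, h3, h4⟩ := ih h1 h2 (c := c - Finsupp.single x 1) (by
      have := congrArg Finsupp.degree hsub
      rw [map_add, Finsupp.degree_single] at this; omega) (by
      intro y hy; rw [Finsupp.tsub_apply, hc y hy, zero_tsub]) (by rwa [hc'])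
    refine ⟨q₂, by rwa [hc'] at h3, ?_⟩
    rwa [add_assoc, ← Finsupp.single_add, add_comm 1 N] at h4

/-- For generic `g`, some polynomial takes the place of `g w_κ` in `g I` and has the initial
monomial `x_1^{b_1} ⋯ x_κ^{b_κ}` of the same degree. -/
theorem exists_admissible_base
    (hg : eval (fun e => (g : Matrix (Fin n) (Fin n) K) e.1 e.2) (topMinorProduct K n) ≠ 0)
    {b : Fin n → ℕ}
    (hb : ∀ k, ((lex b s.le_card).gen k).degree = (s.gen k).degree) (κ : Fin m) :
    ∃ q, s.Admissible ((s.ideal K).map (coordChange g)) g κ (s.base κ) q ∧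
      IsInitialMonomial q ((lex b s.le_card).base κ) := by
  obtain ⟨κ, hκ⟩ := κ
  have hb' : ∀ k, ((lex b s.le_card).base k).degree = (s.base k).degree := fun k => by
    have := hb k
    rw [degree_gen, degree_gen] at this; omega
  have hle : ∀ k t : Fin m, k ≤ t → s.base k ≤ s.gen t := fun k t h =>
    (s.base_mono h).trans (s.base_le_gen t)
  induction κ with
  | zero =>
    have h1 : s.Admissible ((s.ideal K).map (coordChange g)) g ⟨0, hκ⟩ 0 1 := by
      refine ⟨fun l hl => absurd (Fin.lt_def.1 hl) (Nat.not_lt_zero _), fun t _ => ?_⟩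
      rw [tsub_zero, one_mul]
      exact Ideal.mem_map_of_mem _ (s.monomial_mem_iff.2 ⟨t, le_rfl⟩)
    obtain ⟨q, h2, h3⟩ := h1.exists_add s hg _
      (isInitialMonomial_monomial 0 (one_ne_zero (α := K))) (c := s.base ⟨0, hκ⟩) rfl
      (fun x hx => by
        obtain ⟨l, hl, -⟩ := s.mem_prev.1 hx
        exact absurd (Fin.lt_def.1 hl) (Nat.not_lt_zero _))
      (fun t ht => by rw [zero_add]; exact hle _ _ ht)
    rw [zero_add] at h2 h3
    refine ⟨q, h2, ?_⟩
    convert h3 using 1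
    have h4 : (lex b s.le_card).base ⟨0, hκ⟩ =
        Finsupp.single (Fin.castLE s.le_card ⟨0, hκ⟩) (b (Fin.castLE s.le_card ⟨0, hκ⟩)) := by
      ext i
      rw [lex_base_apply, Finsupp.single_apply]
      simp only [Fin.ext_iff, Fin.val_castLE, Nat.le_zero]
      by_cases hi : (i : ℕ) = 0
      · rw [if_pos hi, if_pos hi.symm]
        congr 1; exact Fin.ext hi
      · rw [if_neg hi, if_neg (Ne.symm hi)]
    have h5 := hb' ⟨0, hκ⟩
    rw [h4, Finsupp.degree_single] at h5
    rw [h4, h5]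
  | succ κ ih =>
    have hκ' : κ < m := by omega
    obtain ⟨q₀, h0, hv0⟩ := ih hκ'
    have hlt : (⟨κ, hκ'⟩ : Fin m) < ⟨κ + 1, hκ⟩ := Fin.lt_def.2 (Nat.lt_succ_self κ)
    have hgen : s.gen ⟨κ, hκ'⟩ - s.base ⟨κ, hκ'⟩ = Finsupp.single (s.idx ⟨κ, hκ'⟩) 1 := by
      rw [gen, add_tsub_cancel_left]
    have h1 : s.Admissible ((s.ideal K).map (coordChange g)) g ⟨κ + 1, hκ⟩
        (s.base ⟨κ, hκ'⟩) q₀ := by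
      refine ⟨fun l hl => ?_, fun t ht => h0.2 t (hlt.le.trans ht)⟩
      rcases Nat.lt_succ_iff_lt_or_eq.1 (Fin.lt_def.1 hl) with h | h
      · exact h0.1 l (Fin.lt_def.2 h)
      · have := h0.2 ⟨κ, hκ'⟩ le_rfl
        rw [hgen] at this
        rwa [show l = ⟨κ, hκ'⟩ from Fin.ext h]
    have hadd : s.base ⟨κ, hκ'⟩ + (s.base ⟨κ + 1, hκ⟩ - s.base ⟨κ, hκ'⟩) = s.base ⟨κ + 1, hκ⟩ :=
      add_tsub_cancel_of_le (s.base_mono hlt.le)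
    obtain ⟨q, h2, h3⟩ := h1.exists_add s hg _ hv0
      (c := s.base ⟨κ + 1, hκ⟩ - s.base ⟨κ, hκ'⟩) rfl
      (fun x hx => by
        obtain ⟨l, hl, rfl⟩ := s.mem_prev.1 hx
        rw [Finsupp.tsub_apply, s.base_idx l _ hl]
        rcases Nat.lt_succ_iff_lt_or_eq.1 (Fin.lt_def.1 hl) with h | h
        · rw [s.base_idx l ⟨κ, hκ'⟩ (Fin.lt_def.2 h), tsub_self]
        · rw [show l = ⟨κ, hκ'⟩ from Fin.ext h, tsub_self])
      (fun t ht => by rw [hadd]; exact hle _ _ ht)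
    rw [hadd] at h2
    refine ⟨q, h2, ?_⟩
    convert h3 using 1
    have h4 : (lex b s.le_card).base ⟨κ + 1, hκ⟩ = (lex b s.le_card).base ⟨κ, hκ'⟩ +
        Finsupp.single (Fin.castLE s.le_card ⟨κ + 1, hκ⟩)
          (b (Fin.castLE s.le_card ⟨κ + 1, hκ⟩)) := by
      ext i
      rw [Finsupp.add_apply, lex_base_apply, lex_base_apply, Finsupp.single_apply]
      simp only [Fin.ext_iff, Fin.val_castLE]
      by_cases hi : (i : ℕ) = κ + 1
      · rw [if_pos (by omega), if_neg (by omega), if_pos hi.symm, zero_add]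
        congr 1; exact Fin.ext hi
      · rw [if_neg (Ne.symm hi), add_zero]
        split_ifs <;> first | rfl | omega
    have h5 := congrArg Finsupp.degree h4
    rw [map_add, Finsupp.degree_single, hb', hb'] at h5
    have h6 := congrArg Finsupp.degree hadd
    rw [map_add] at h6
    rw [h4]
    congr 2
    omega

/-- For generic `g`, the initial ideal of `g I` is the lexsegment staircase with the same degrees
of generators: it contains this ideal, and both have the same Hilbert function. -/
theorem initialIdeal_map_eq
    (hg : eval (fun e => (g : Matrix (Fin n) (Fin n) K) e.1 e.2) (topMinorProduct K n) ≠ 0)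
    {b : Fin n → ℕ}
    (hb : ∀ k, ((lex b s.le_card).gen k).degree = (s.gen k).degree) :
    initialIdeal ((s.ideal K).map (coordChange g)) = (lex b s.le_card).ideal K := by
  classical
  set F := (s.ideal K).map (coordChange g) with hF
  set L := (lex b s.le_card).ideal K with hL
  have hsub : ∀ v, monomial v (1 : K) ∈ L → monomial v (1 : K) ∈ initialIdeal F := by
    intro v hv
    obtain ⟨k, hk⟩ := (monomial_mem_iff _).1 hv
    refine monomial_mem_of_le hk (monomial_mem_initialIdeal.2 ?_)
    obtain ⟨q, hq, hqv⟩ := s.exists_admissible_base hg hb k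
    obtain ⟨c, h, rfl, hin⟩ := s.exists_reduced_form hg k (s.idx_notMem_prev le_rfl)
    refine ⟨_, ?_, hqv.mul hin⟩
    rw [mul_add]
    refine F.add_mem ?_ ?_
    · have := hq.mul_mem s c (p := 1)
      rwa [mul_one] at this
    · have := hq.2 k le_rfl
      rwa [gen, add_tsub_cancel_left] at this
  have hhom : ∀ v, monomial v (1 : K) ∈ initialIdeal F →
      ∃ f ∈ F, f.IsHomogeneous v.degree ∧ IsInitialMonomial f v := by
    intro v hv
    obtain ⟨f, hf, hfv⟩ := monomial_mem_initialIdeal.1 hv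
    exact ⟨_, s.isMonomialIdeal.homogeneousComponent_mem_map g hf _,
      homogeneousComponent_isHomogeneous _ _, hfv.homogeneousComponent⟩
  refine (isMonomialIdeal_initialIdeal F).ext (isMonomialIdeal _) fun v =>
    ⟨fun hv => ?_, hsub v⟩
  by_contra hvL
  set T := (finite_degree_eq n v.degree).toFinset.filter
    fun a => monomial a (1 : K) ∈ L with hT
  have hTmem : ∀ a, a ∈ T ↔ monomial a (1 : K) ∈ L ∧ a.degree = v.degree := by
    intro a; simp [hT, and_comm]
  have h1 : hilbertFunction L v.degree = T.card :=
    hilbertFunction_eq_card (isMonomialIdeal _) _ hTmem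
  have h2 : hilbertFunction F v.degree = hilbertFunction L v.degree := by
    rw [hF, hilbertFunction_map_coordChange, hL, hilbertFunction_ideal, hilbertFunction_ideal]
    simp only [hb]
  have h3 : (insert v T).card ≤ hilbertFunction F v.degree := by
    refine card_le_hilbertFunction fun a ha => ?_
    rcases Finset.mem_insert.1 ha with rfl | ha
    · exact hhom a hv
    · obtain ⟨h4, h5⟩ := (hTmem a).1 ha
      rw [← h5]
      exact hhom a (hsub a h4)
  rw [Finset.card_insert_of_notMem fun h => hvL ((hTmem v).1 h).1] at h3
  omega

theorem maxIndex_lex_gen (b : Fin n → ℕ) (h : m ≤ n) (k : Fin m) :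
    maxIndex ((lex b h).gen k) = k + 1 := by
  apply le_antisymm
  · refine Finset.sup_le fun i hi => ?_
    rw [Finsupp.mem_support_iff, lex_gen_apply] at hi
    by_contra hlt
    rw [if_neg (by omega), if_neg (by omega)] at hi
    exact hi rfl
  · refine Finset.le_sup (f := fun i : Fin n => (i : ℕ) + 1) (b := Fin.castLE h k) ?_
    rw [Finsupp.mem_support_iff, lex_gen_apply]
    simp

theorem exists_isGenericInitialIdeal : ∃ J : Ideal (MvPolynomial (Fin n) K),
    IsGenericInitialIdeal (s.ideal K) J ∧ (minGens J).sup maxIndex = (minGens J).card := by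
  obtain ⟨b, hb⟩ := s.exists_lex_degree_eq
  refine ⟨(lex b s.le_card).ideal K, ⟨topMinorProduct K n, topMinorProduct_ne_zero,
    fun g hg => s.initialIdeal_map_eq hg hb⟩, ?_⟩
  rw [card_minGens, minGens_ideal, Finset.sup_image]
  simp only [Function.comp_def, maxIndex_lex_gen]
  apply le_antisymm
  · exact Finset.sup_le fun k _ => k.2
  · rcases Nat.eq_zero_or_pos m with rfl | hm
    · exact Nat.zero_le _
    · have := Finset.le_sup (f := fun k : Fin m => (k : ℕ) + 1)
        (Finset.mem_univ ⟨m - 1, by omega⟩)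
      simp only at this
      omega

end Staircase

/-! ### Numbers of generators -/

section Generators

variable {K : Type*} [Field K] {n : ℕ}

/-- A monomial ideal cannot be generated by fewer elements than it has minimal monomial
generators: the coefficients at the minimal generators identify `I / 𝔪 I` with `K^{G(I)}`. -/
theorem card_minGens_le {I : Ideal (MvPolynomial (Fin n) K)} (hI : IsMonomialIdeal I)
    {ι : Type*} [Fintype ι] (f : ι → MvPolynomial (Fin n) K) (hf : I = Ideal.span (Set.range f)) :
    (minGens I).card ≤ Fintype.card ι := by
  classical
  have hfI : ∀ k, f k ∈ I := fun k => hf ▸ Ideal.subset_span ⟨k, rfl⟩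
  have hcoeff : ∀ (p : MvPolynomial (Fin n) K) (k : ι) (v : Fin n →₀ ℕ), v ∈ minGens I →
      coeff v (p * f k) = coeff 0 p * coeff v (f k) := by
    intro p k v hv
    rw [coeff_mul, Finset.sum_eq_single (0, v)]
    · rintro ⟨x, y⟩ hxy hne
      rw [Finset.HasAntidiagonal.mem_antidiagonal] at hxy
      by_contra h
      have hy := hI.mem_iff.1 (hfI k) y (mem_support_iff.2 (right_ne_zero_of_mul h))
      have h1 : y = v := (mem_minGens.1 hv).2 y hy (hxy ▸ le_add_self)
      subst h1
      have h2 : x = 0 := by simpa using hxy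
      exact hne (by rw [h2])
    · intro h; simp at h
  let φ : (ι → K) →ₗ[K] (minGens I → K) :=
    { toFun := fun c v => ∑ k, c k * coeff v.1 (f k)
      map_add' := fun c d => by ext v; simp [add_mul, Finset.sum_add_distrib]
      map_smul' := fun r c => by ext v; simp [mul_assoc, Finset.mul_sum] }
  have hφ : Function.Surjective φ := by
    rw [← LinearMap.range_eq_top, eq_top_iff, ← (Pi.basisFun K (minGens I)).span_eq,
      Submodule.span_le]
    rintro _ ⟨u, rfl⟩
    obtain ⟨p, hp⟩ := Ideal.mem_span_range_iff_exists_fun.1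
      (hf.le (mem_minGens.1 u.2).1 : monomial u.1 (1 : K) ∈ Ideal.span (Set.range f))
    refine ⟨fun k => coeff 0 (p k), ?_⟩
    ext v
    change ∑ k, coeff 0 (p k) * coeff v.1 (f k) = _
    rw [Pi.basisFun_apply, Pi.single_apply]
    have h1 := congrArg (coeff v.1) hp
    rw [coeff_sum, coeff_monomial] at h1
    simp_rw [hcoeff _ _ _ v.2] at h1
    rw [h1]
    simp only [Subtype.ext_iff, eq_comm]
  simpa using LinearMap.finrank_le_finrank_of_surjective hφ

/-- Elements of an ideal whose initial monomials generate the initial ideal generate the ideal. -/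
theorem span_eq_of_isInitialMonomial {F : Ideal (MvPolynomial (Fin n) K)}
    {f : minGens (initialIdeal F) → MvPolynomial (Fin n) K} (hfF : ∀ v, f v ∈ F)
    (hf : ∀ v, IsInitialMonomial (f v) v.1) : F = Ideal.span (Set.range f) := by
  classical
  refine le_antisymm ?_ (Ideal.span_le.2 (by rintro _ ⟨v, rfl⟩; exact hfF v))
  suffices h : ∀ a, ∀ p ∈ F, IsInitialMonomial p a → p ∈ Ideal.span (Set.range f) by
    intro p hp
    by_cases h0 : p = 0
    · rw [h0]; exact zero_mem _
    · obtain ⟨a, ha⟩ := exists_isInitialMonomial h0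
      exact h a p hp ha
  intro a
  induction a using wellFounded_revLexLT.induction with
  | h a ih =>
    intro p hp hpa
    obtain ⟨v, hv, hva⟩ := exists_minGens_le (monomial_mem_initialIdeal.2 ⟨p, hp, hpa⟩)
    set c := coeff a p / coeff v (f ⟨v, hv⟩) with hc
    set r := monomial (a - v) c * f ⟨v, hv⟩ with hr
    have hrs : r ∈ Ideal.span (Set.range f) :=
      Ideal.mul_mem_left _ _ (Ideal.subset_span ⟨_, rfl⟩)
    have hc0 : c ≠ 0 := div_ne_zero hpa.coeff_ne_zero (hf ⟨v, hv⟩).coeff_ne_zero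
    have hra : IsInitialMonomial r a := by
      have := (isInitialMonomial_monomial (a - v) hc0).mul (hf ⟨v, hv⟩)
      rwa [tsub_add_cancel_of_le hva] at this
    have hra' : coeff a r = coeff a p := by
      have h := coeff_monomial_mul v (a - v) c (f ⟨v, hv⟩)
      rw [tsub_add_cancel_of_le hva] at h
      rw [hr, h, hc, div_mul_cancel₀ _ (hf ⟨v, hv⟩).coeff_ne_zero]
    suffices h : p - r ∈ Ideal.span (Set.range f) by
      have := add_mem h hrs
      rwa [sub_add_cancel] at this
    by_cases h0 : p - r = 0
    · rw [h0]; exact zero_mem _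
    obtain ⟨b, hb⟩ := exists_isInitialMonomial h0
    refine ih b ?_ (p - r) (sub_mem hp (F.mul_mem_left _ (hfF _))) hb
    have hba : b ≠ a := by
      rintro rfl
      exact hb.coeff_ne_zero (by rw [coeff_sub, hra', sub_self])
    rcases Finset.mem_union.1 (support_sub _ p r hb.1) with h | h
    exacts [hpa.2 b h hba, hra.2 b h hba]

/-- The number of generators does not decrease under passage to an initial ideal. -/
theorem card_minGens_le_initialIdeal {I : Ideal (MvPolynomial (Fin n) K)}
    (hI : IsMonomialIdeal I) (g : GL (Fin n) K) :
    (minGens I).card ≤ (minGens (initialIdeal (I.map (coordChange g)))).card := by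
  have h : ∀ v : minGens (initialIdeal (I.map (coordChange g))),
      ∃ f ∈ I.map (coordChange g), IsInitialMonomial f v.1 := fun v =>
    monomial_mem_initialIdeal.1 (mem_minGens.1 v.2).1
  choose f hfF hf using h
  have h1 := span_eq_of_isInitialMonomial hfF hf
  have h2 : I = Ideal.span (Set.range fun v => coordChange g⁻¹ (f v)) := by
    rw [show (Set.range fun v => coordChange g⁻¹ (f v)) = coordChange g⁻¹ '' Set.range f from
      Set.range_comp _ _, ← Ideal.map_span, ← h1]
    ext p
    rw [mem_map_coordChange, inv_inv, mem_map_coordChange, coordChange_inv_apply]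
  simpa using card_minGens_le hI _ h2

end Generators

/-! ### Koszul homology of quotients and regular linear forms -/

section Depth

variable {K : Type*} [Field K] {n : ℕ}

theorem koszulDifferential_comp_self (c : Finset (Fin n) → MvPolynomial (Fin n) K) :
    koszulDifferential K n (koszulDifferential K n c) = 0 := by
  refine ext_of_slice fun a => ?_
  rw [slice_koszulDifferential, slice_koszulDifferential, bd_bd]
  ext F; simp [slice]

/-- The chain `c` has homological degree `i`. -/
def IsChain (i : ℕ) (c : Finset (Fin n) → MvPolynomial (Fin n) K) : Prop :=
  ∀ F, c F ≠ 0 → F.card = i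

theorem IsChain.koszulDifferential {i : ℕ} {c : Finset (Fin n) → MvPolynomial (Fin n) K}
    (hc : IsChain (i + 1) c) : IsChain i (koszulDifferential K n c) := by
  intro F hF
  rw [koszulDifferential_apply] at hF
  obtain ⟨k, hk, hne⟩ := Finset.exists_ne_zero_of_sum_ne_zero hF
  have := hc _ (right_ne_zero_of_mul (right_ne_zero_of_mul hne))
  rw [Finset.card_insert_of_notMem (by simpa using hk)] at this
  omega

theorem IsChain.sub {i : ℕ} {c d : Finset (Fin n) → MvPolynomial (Fin n) K}
    (hc : IsChain i c) (hd : IsChain i d) : IsChain i (c - d) := by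
  intro F hF
  by_cases h : c F = 0
  · exact hd F fun h' => hF (by simp [h, h'])
  · exact hc F h

theorem IsChain.smul {i : ℕ} {c : Finset (Fin n) → MvPolynomial (Fin n) K} (hc : IsChain i c)
    (p : MvPolynomial (Fin n) K) : IsChain i (p • c) :=
  fun F hF => hc F (right_ne_zero_of_mul hF)

theorem koszulDifferential_mem {Q : Ideal (MvPolynomial (Fin n) K)}
    {c : Finset (Fin n) → MvPolynomial (Fin n) K} (hc : ∀ A, c A ∈ Q) (A : Finset (Fin n)) :
    koszulDifferential K n c A ∈ Q := by
  rw [koszulDifferential_apply]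
  exact Q.sum_mem fun k _ => Q.mul_mem_left _ (Q.mul_mem_left _ (hc _))

/-- The Koszul complex with coefficients in `S / Q` is exact in homological degree `i`. -/
def QuotEx (Q : Ideal (MvPolynomial (Fin n) K)) (i : ℕ) : Prop :=
  ∀ z : Finset (Fin n) → MvPolynomial (Fin n) K, IsChain i z →
    (∀ A, koszulDifferential K n z A ∈ Q) →
    ∃ y, IsChain (i + 1) y ∧ ∀ A, z A - koszulDifferential K n y A ∈ Q

theorem exists_koszulDifferential_eq_of_ex {I : Ideal (MvPolynomial (Fin n) K)}
    (hI : IsMonomialIdeal I) {i : ℕ} (hex : ∀ a, Ex K (upper I a) i)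
    {c : Finset (Fin n) → MvPolynomial (Fin n) K} (hc : IsChain i c) (hcI : ∀ A, c A ∈ I)
    (h0 : koszulDifferential K n c = 0) :
    ∃ y, IsChain (i + 1) y ∧ (∀ A, y A ∈ I) ∧ koszulDifferential K n y = c := by
  classical
  obtain ⟨y, hy, hyI⟩ := exists_koszulDifferential_eq (I := I) (i := i) (c := c)
    (Finset.univ.biUnion fun F => (c F).support.image (· + indic F)) (fun a ha => by
      ext F
      by_contra hne
      rw [Pi.zero_apply, slice] at hne
      split_ifs at hne with h
      · refine ha (Finset.mem_biUnion.2 ⟨F, Finset.mem_univ F, Finset.mem_image.2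
          ⟨_, mem_support_iff.2 hne, tsub_add_cancel_of_le h⟩⟩)
      · exact absurd rfl hne)
    (fun a _ => hex a _ (supp_slice_of_coeff (fun A b hb =>
      ⟨hc A fun h => hb (by rw [h, coeff_zero]),
        hI.mem_iff.1 (hcI A) b (mem_support_iff.2 hb)⟩) a) (by
      rw [← slice_koszulDifferential, h0]; ext F; simp [slice]))
  refine ⟨y, fun F hF => ?_, fun A => hI.mem_iff.2 fun b hb =>
    (hyI A b (mem_support_iff.1 hb)).2.1, hy⟩
  obtain ⟨b, hb⟩ := support_nonempty.2 hF
  exact (hyI F b (mem_support_iff.1 hb)).1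

theorem ex_upper_top (a : Fin n →₀ ℕ) (i : ℕ) :
    Ex K (upper (⊤ : Ideal (MvPolynomial (Fin n) K)) a) (i + 1) := by
  rw [upper_eq_simplexUnion]
  refine ex_simplexUnion_of_card_le _ _ _ ?_
  have h : minGens (⊤ : Ideal (MvPolynomial (Fin n) K)) ⊆ {0} := by
    intro u hu
    rw [Finset.mem_singleton]
    exact ((mem_minGens.1 hu).2 0 trivial bot_le).symm
  have := Finset.card_le_card ((Finset.filter_subset (· ≤ a) _).trans h)
  rw [Finset.card_singleton] at this
  omega

/-- The homology of `S / I` in degree `i + 1` is that of `I` in degree `i`. -/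
theorem quotEx_of_ex {I : Ideal (MvPolynomial (Fin n) K)} (hI : IsMonomialIdeal I) {i : ℕ}
    (hex : ∀ a, Ex K (upper I a) i) : QuotEx I (i + 1) := by
  intro z hz hzI
  obtain ⟨y, hy, hyI, hyz⟩ := exists_koszulDifferential_eq_of_ex hI hex hz.koszulDifferential hzI
    (koszulDifferential_comp_self z)
  obtain ⟨x, hx, -, hxz⟩ := exists_koszulDifferential_eq_of_ex isMonomialIdeal_top
    (fun a => ex_upper_top a i) (hz.sub hy) (fun _ => trivial) (by rw [map_sub, hyz, sub_self])
  refine ⟨x, hx, fun A => ?_⟩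
  rw [hxz, Pi.sub_apply, sub_sub_cancel]
  exact hyI A

/-- Dividing by a regular element costs one degree of exactness. -/
theorem QuotEx.sup_span {Q : Ideal (MvPolynomial (Fin n) K)} {i : ℕ} (h : QuotEx Q i)
    (h' : QuotEx Q (i + 1)) {p : MvPolynomial (Fin n) K} (hp : ∀ f, p * f ∈ Q → f ∈ Q) :
    QuotEx (Q ⊔ Ideal.span {p}) (i + 1) := by
  intro z hz hzQ
  have hdz := hz.koszulDifferential
  have hex : ∀ A, ∃ y, koszulDifferential K n z A - p * y ∈ Q ∧
      (koszulDifferential K n z A = 0 → y = 0) := by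
    intro A
    by_cases h0 : koszulDifferential K n z A = 0
    · exact ⟨0, by rw [h0, mul_zero, sub_zero]; exact zero_mem _, fun _ => rfl⟩
    · obtain ⟨q, hq, r, hr, hqr⟩ := Submodule.mem_sup.1 (hzQ A)
      obtain ⟨y, rfl⟩ := Ideal.mem_span_singleton'.1 hr
      exact ⟨y, by rw [← hqr, mul_comm p, add_sub_cancel_right]; exact hq, fun h => absurd h h0⟩
  choose y hyQ hy0 using hex
  have hy : IsChain i y := fun F hF => hdz F fun h0 => hF (hy0 F h0)
  have hdy : ∀ A, koszulDifferential K n y A ∈ Q := by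
    intro A
    apply hp
    have h1 := koszulDifferential_mem (c := koszulDifferential K n z - p • y) (Q := Q) hyQ A
    rw [map_sub, koszulDifferential_comp_self, map_smul, zero_sub] at h1
    exact neg_mem_iff.1 h1
  obtain ⟨w, hw, hyw⟩ := h y hy hdy
  obtain ⟨x, hx, hzx⟩ := h' (z - p • w) (hz.sub (hw.smul p)) (by
    intro A
    rw [map_sub, map_smul]
    have h1 := add_mem (hyQ A) (Q.mul_mem_left p (hyw A))
    have h2 : (koszulDifferential K n z - p • koszulDifferential K n w) A =
        koszulDifferential K n z A - p * y A + p * (y A - koszulDifferential K n w A) := by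
      simp only [Pi.sub_apply, Pi.smul_apply, smul_eq_mul]; ring
    rwa [h2])
  refine ⟨x, hx, fun A => ?_⟩
  have h1 : z A - koszulDifferential K n x A =
      (z - p • w) A - koszulDifferential K n x A + w A * p := by
    simp only [Pi.sub_apply, Pi.smul_apply, smul_eq_mul]; ring
  rw [h1]
  exact Submodule.add_mem_sup (hzx A) (Ideal.mem_span_singleton'.2 ⟨_, rfl⟩)

/-- Exactness at the top of the Koszul complex says that `S / Q` has no socle. -/
theorem QuotEx.mem_of_X_mul_mem {Q : Ideal (MvPolynomial (Fin n) K)} (h : QuotEx Q n)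
    {f : MvPolynomial (Fin n) K} (hf : ∀ k, X k * f ∈ Q) : f ∈ Q := by
  classical
  obtain ⟨y, hy, hyf⟩ := h (Pi.single Finset.univ f) (fun F hF => by
      by_contra hne
      rw [Pi.single_eq_of_ne (fun h => hne (by rw [h, Finset.card_fin]))] at hF
      exact hF rfl) (fun A => by
      rw [koszulDifferential_apply]
      refine Q.sum_mem fun k _ => Q.mul_mem_left _ ?_
      by_cases hA : insert k A = Finset.univ
      · rw [hA, Pi.single_eq_same]; exact hf k
      · rw [Pi.single_eq_of_ne hA, mul_zero]; exact zero_mem _)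
  have h0 : y = 0 := by
    ext1 F
    by_contra hne
    have h1 := hy F hne
    have h2 := Finset.card_le_univ F
    rw [Fintype.card_fin] at h2
    omega
  have h1 := hyf Finset.univ
  rwa [h0, map_zero, Pi.single_eq_same, Pi.zero_apply, sub_zero] at h1

/-- If `S / Q` has no socle, a generic linear form is regular on it: each associated prime contains
only a proper subspace of the linear forms. -/
theorem QuotEx.exists_regular {Q : Ideal (MvPolynomial (Fin n) K)} (h : QuotEx Q n) :
    ∃ P : MvPolynomial (Fin n) K, P ≠ 0 ∧ ∀ c : Fin n → K, eval c P ≠ 0 →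
      ∀ f, (∑ i, C (c i) * X i) * f ∈ Q → f ∈ Q := by
  classical
  set S := MvPolynomial (Fin n) K
  have hfin := associatedPrimes.finite S (S ⧸ Q)
  have hP : ∀ p ∈ associatedPrimes S (S ⧸ Q), ∃ P : S, P ≠ 0 ∧
      ∀ c : Fin n → K, ∑ i, C (c i) * X i ∈ p → eval c P = 0 := by
    intro p hp
    obtain ⟨k, hk⟩ : ∃ k, (X k : S) ∉ p := by
      by_contra! hX
      obtain ⟨hprime, x, hx⟩ := isAssociatedPrime_iff.1 (AssociatedPrimes.mem_iff.1 hp)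
      obtain ⟨f, rfl⟩ := Ideal.Quotient.mk_surjective x
      have hmem : ∀ r : S, r ∈ p ↔ r * f ∈ Q := by
        intro r
        rw [hx, Submodule.mem_colon_singleton, Submodule.mem_bot, ← Ideal.Quotient.eq_zero_iff_mem]
        rfl
      have hf : f ∈ Q := h.mem_of_X_mul_mem fun k => (hmem _).1 (hX k)
      exact hprime.ne_top ((Ideal.eq_top_iff_one p).2 ((hmem 1).2 (by rwa [one_mul])))
    let W : Submodule K (Fin n → K) :=
      { carrier := {c | ∑ i, C (c i) * X i ∈ p}
        add_mem' := fun {c d} hc hd => by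
          simp only [Set.mem_ofPred_eq, Pi.add_apply, C_add, add_mul, Finset.sum_add_distrib] at *
          exact p.add_mem hc hd
        zero_mem' := by simp
        smul_mem' := fun r c hc => by
          simp only [Set.mem_ofPred_eq, Pi.smul_apply, smul_eq_mul, C_mul, mul_assoc,
            ← Finset.mul_sum] at *
          exact p.mul_mem_left _ hc }
    have hW : W < ⊤ := by
      refine lt_top_iff_ne_top.2 fun hW => hk ?_
      have h1 : Pi.single k 1 ∈ W := hW ▸ trivial
      change ∑ i, C ((Pi.single k 1 : Fin n → K) i) * X i ∈ p at h1
      rw [Finset.sum_eq_single k] at h1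
      · simpa using h1
      · intro i _ hi; rw [Pi.single_eq_of_ne hi, C_0, zero_mul]
      · simp
    obtain ⟨φ, hφ0, hφ⟩ := W.exists_le_ker_of_lt_top hW
    have hev : ∀ c : Fin n → K, eval c (∑ i, C (φ (Pi.single i 1)) * X i) = φ c := by
      intro c
      rw [map_sum]
      conv_rhs => rw [← Finset.univ_sum_single c, map_sum]
      refine Finset.sum_congr rfl fun i _ => ?_
      rw [map_mul, eval_C, eval_X, mul_comm, ← smul_eq_mul, ← map_smul, ← Pi.single_smul,
        smul_eq_mul, mul_one]
    refine ⟨∑ i, C (φ (Pi.single i 1)) * X i, fun h0 => hφ0 ?_, fun c hc => ?_⟩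
    · ext c
      rw [LinearMap.comp_apply, ← hev, h0]; simp
    · rw [hev]; exact hφ hc
  choose! P hP0 hPe using hP
  refine ⟨∏ p ∈ hfin.toFinset, P p, Finset.prod_ne_zero_iff.2 fun p hp =>
    hP0 p (hfin.mem_toFinset.1 hp), fun c hc f hf => ?_⟩
  by_contra hfQ
  have h1 : (∑ i, C (c i) * X i : S) ∈ {r : S | ∃ x : S ⧸ Q, x ≠ 0 ∧ r • x = 0} := by
    refine ⟨Ideal.Quotient.mk Q f, fun h0 => hfQ (Ideal.Quotient.eq_zero_iff_mem.1 h0), ?_⟩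
    exact Ideal.Quotient.eq_zero_iff_mem.2 hf
  rw [← biUnion_associatedPrimes_eq_zero_divisors] at h1
  simp only [Set.mem_iUnion, SetLike.mem_coe] at h1
  obtain ⟨p, hp, hcp⟩ := h1
  rw [map_prod] at hc
  exact Finset.prod_ne_zero_iff.1 hc p (hfin.mem_toFinset.2 hp) (hPe p hp c hcp)

end Depth

/-! ### Generic regular sequences of linear forms -/

section GenericRegular

variable {K : Type*} [Field K] {n : ℕ}

theorem eval_mul_of_isHomogeneous {σ : Type*} {p : MvPolynomial σ K} {d : ℕ}
    (hp : p.IsHomogeneous d) (r : K) (v : σ → K) :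
    eval (fun e => r * v e) p = r ^ d * eval v p := by
  rw [eval_eq, eval_eq, Finset.mul_sum]
  refine Finset.sum_congr rfl fun b hb => ?_
  have h1 : b.degree = d := by
    by_contra h
    exact mem_support_iff.1 hb (hp.coeff_eq_zero h)
  simp_rw [mul_pow]
  rw [Finset.prod_mul_distrib, Finset.prod_pow_eq_pow_sum, ← Finsupp.degree_apply, h1]
  ring

theorem eval_aeval {σ τ : Type*} (v : τ → K) (G : σ → MvPolynomial τ K) (p : MvPolynomial σ K) :
    eval v (aeval G p) = eval (fun e => eval v (G e)) p := by
  induction p using MvPolynomial.induction_on with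
  | C a => simp
  | add p q hp hq => rw [map_add, map_add, map_add, hp, hq]
  | mul_X p i hp => rw [map_mul, map_mul, map_mul, hp, aeval_X, eval_X]

theorem exists_eval_ne_zero [Infinite K] {σ : Type*} {p : MvPolynomial σ K} (hp : p ≠ 0) :
    ∃ v, eval v p ≠ 0 := by
  by_contra! h
  exact hp (MvPolynomial.funext fun v => by rw [h v, map_zero])

/-- The polynomial `P(h⁻¹)` in the entries of `h`, with denominators cleared by a power of `det h`:
each homogeneous component of `P` is evaluated at the adjugate of `h`. -/
def invPoly (P : MvPolynomial (Fin n × Fin n) K) : MvPolynomial (Fin n × Fin n) K :=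
  (Matrix.mvPolynomialX (Fin n) (Fin n) K).det *
    ∑ d ∈ Finset.range (P.totalDegree + 1),
      (Matrix.mvPolynomialX (Fin n) (Fin n) K).det ^ (P.totalDegree - d) *
        aeval (fun e => (Matrix.mvPolynomialX (Fin n) (Fin n) K).adjugate e.1 e.2)
          (homogeneousComponent d P)

theorem eval_invPoly (P : MvPolynomial (Fin n × Fin n) K) (h : Matrix (Fin n) (Fin n) K) :
    eval (fun e => h e.1 e.2) (invPoly P) =
      h.det ^ (P.totalDegree + 1) * eval (fun e => h⁻¹ e.1 e.2) P := by
  have hX : (Matrix.mvPolynomialX (Fin n) (Fin n) K).map (eval fun e => h e.1 e.2) = h := by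
    ext i j; simp
  have hdet : eval (fun e => h e.1 e.2) (Matrix.mvPolynomialX (Fin n) (Fin n) K).det = h.det := by
    rw [RingHom.map_det, RingHom.mapMatrix_apply, hX]
  have hadj : ∀ i j, eval (fun e => h e.1 e.2)
      ((Matrix.mvPolynomialX (Fin n) (Fin n) K).adjugate i j) = h.adjugate i j := by
    intro i j
    have h1 := RingHom.map_adjugate (eval fun e : Fin n × Fin n => h e.1 e.2)
      (Matrix.mvPolynomialX (Fin n) (Fin n) K)
    rw [RingHom.mapMatrix_apply, RingHom.mapMatrix_apply, hX] at h1
    rw [← h1, Matrix.map_apply]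
  rw [invPoly, map_mul, hdet]
  by_cases h0 : h.det = 0
  · rw [h0]; simp
  have hadj' : ∀ i j, h.adjugate i j = h.det * h⁻¹ i j := by
    intro i j
    rw [Matrix.inv_def, Matrix.smul_apply, smul_eq_mul, Ring.inverse_eq_inv', ← mul_assoc,
      mul_inv_cancel₀ h0, one_mul]
  rw [pow_succ', mul_assoc]
  congr 1
  rw [map_sum]
  have hsum : eval (fun e => h⁻¹ e.1 e.2) P = ∑ d ∈ Finset.range (P.totalDegree + 1),
      eval (fun e => h⁻¹ e.1 e.2) (homogeneousComponent d P) := by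
    rw [← map_sum, sum_homogeneousComponent]
  rw [hsum, Finset.mul_sum]
  refine Finset.sum_congr rfl fun d hd => ?_
  rw [map_mul, map_pow, hdet]
  have h2 : eval (fun e => h e.1 e.2)
      (aeval (fun e => (Matrix.mvPolynomialX (Fin n) (Fin n) K).adjugate e.1 e.2)
        (homogeneousComponent d P)) = h.det ^ d *
          eval (fun e => h⁻¹ e.1 e.2) (homogeneousComponent d P) := by
    rw [← eval_mul_of_isHomogeneous (homogeneousComponent_isHomogeneous d P), eval_aeval]
    simp_rw [hadj, hadj']
  rw [h2, ← mul_assoc, ← pow_add, Nat.sub_add_cancel (Nat.lt_succ_iff.1 (Finset.mem_range.1 hd))]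

/-- One column of a matrix can be chosen generically while preserving `R ≠ 0`. -/
theorem exists_updateCol [Infinite K] {R : MvPolynomial (Fin n × Fin n) K}
    {h : Matrix (Fin n) (Fin n) K} (hR : eval (fun e => h e.1 e.2) R ≠ 0) (p : Fin n)
    {P : MvPolynomial (Fin n) K} (hP : P ≠ 0) :
    ∃ c : Fin n → K, eval (fun e => h.updateCol p c e.1 e.2) R ≠ 0 ∧ eval c P ≠ 0 := by
  let r : MvPolynomial (Fin n) K := aeval (fun e => if e.2 = p then X e.1 else C (h e.1 e.2)) R
  have hr : ∀ c, eval c r = eval (fun e => h.updateCol p c e.1 e.2) R := by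
    intro c
    simp only [r, eval_aeval]
    congr 2
    ext e
    rw [Matrix.updateCol_apply]
    split_ifs <;> simp
  have hr0 : r ≠ 0 := by
    intro h0
    apply hR
    have h1 := hr fun i => h i p
    rw [h0, map_zero] at h1
    rw [h1]
    congr 2
    ext e
    rw [Matrix.updateCol_apply]
    split_ifs with h2
    · rw [h2]
    · rfl
  obtain ⟨c, hc⟩ := exists_eval_ne_zero (mul_ne_zero hr0 hP)
  rw [map_mul, hr] at hc
  exact ⟨c, left_ne_zero_of_mul hc, right_ne_zero_of_mul hc⟩

/-- The linear form whose coefficients are the `k`-th column of `h`. -/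
def columnForm (h : Matrix (Fin n) (Fin n) K) (k : Fin n) : MvPolynomial (Fin n) K :=
  ∑ i, C (h i k) * X i

/-- The ideal generated by `I` and the linear forms of the last `j` columns of `h`. -/
def addColumns (I : Ideal (MvPolynomial (Fin n) K)) (h : Matrix (Fin n) (Fin n) K) (j : ℕ) :
    Ideal (MvPolynomial (Fin n) K) :=
  I ⊔ Ideal.span (columnForm h '' {k | n ≤ (k : ℕ) + j})

theorem addColumns_updateCol (I : Ideal (MvPolynomial (Fin n) K))
    (h : Matrix (Fin n) (Fin n) K) {j : ℕ} {p : Fin n} (hp : (p : ℕ) + j < n) (c : Fin n → K) :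
    addColumns I (h.updateCol p c) j = addColumns I h j := by
  rw [addColumns, addColumns]
  congr 2
  refine Set.image_congr fun k hk => ?_
  have hkp : k ≠ p := by
    rintro rfl
    simp only [Set.mem_ofPred_eq] at hk
    omega
  simp only [columnForm, Matrix.updateCol_ne hkp]

theorem addColumns_succ (I : Ideal (MvPolynomial (Fin n) K)) (h : Matrix (Fin n) (Fin n) K)
    {j : ℕ} {p : Fin n} (hp : (p : ℕ) + j + 1 = n) :
    addColumns I h (j + 1) = addColumns I h j ⊔ Ideal.span {columnForm h p} := by
  rw [addColumns, addColumns, sup_assoc, ← Ideal.span_union]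
  congr 2
  rw [← Set.image_singleton, ← Set.image_union]
  congr 1
  ext k
  simp only [Set.mem_ofPred_eq, Set.mem_union, Set.mem_singleton_iff, Fin.ext_iff]
  omega

/-- If `S / I` has no Koszul homology in degrees `≥ M`, then, for `j ≤ n - M` and a suitable matrix
subject to the open condition `R ≠ 0`, the linear form of the next column is regular modulo `I` and
the linear forms of the last `j` columns. -/
theorem exists_regular_columns [Infinite K] {I : Ideal (MvPolynomial (Fin n) K)} {M : ℕ}
    (hex : ∀ i, M ≤ i → QuotEx I i) {R : MvPolynomial (Fin n × Fin n) K}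
    {h₀ : Matrix (Fin n) (Fin n) K} (hR : eval (fun e => h₀ e.1 e.2) R ≠ 0) (j : ℕ) {p : Fin n}
    (hp : (p : ℕ) + j + 1 = n) (hM : M + j ≤ n) :
    ∃ h : Matrix (Fin n) (Fin n) K, eval (fun e => h e.1 e.2) R ≠ 0 ∧
      (∀ i, M + j ≤ i → QuotEx (addColumns I h j) i) ∧
      ∀ f, columnForm h p * f ∈ addColumns I h j → f ∈ addColumns I h j := by
  suffices hs : ∃ h : Matrix (Fin n) (Fin n) K, eval (fun e => h e.1 e.2) R ≠ 0 ∧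
      ∀ i, M + j ≤ i → QuotEx (addColumns I h j) i by
    obtain ⟨h, h1, h2⟩ := hs
    obtain ⟨P, hP, hreg⟩ := (h2 n hM).exists_regular
    obtain ⟨c, hc1, hc2⟩ := exists_updateCol h1 p hP
    have hQ := addColumns_updateCol I h (j := j) (p := p) (by omega) c
    refine ⟨h.updateCol p c, hc1, by rwa [hQ], fun f hf => ?_⟩
    rw [hQ] at hf ⊢
    refine hreg c hc2 f ?_
    simpa only [columnForm, Matrix.updateCol_self] using hf
  induction j generalizing p with
  | zero =>
    refine ⟨h₀, hR, fun i hi => ?_⟩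
    have h1 : {k : Fin n | n ≤ (k : ℕ) + 0} = ∅ := by
      ext k
      simp only [add_zero, Set.mem_ofPred_eq, Set.mem_empty_iff_false, iff_false, not_le]
      exact k.2
    rw [addColumns, h1, Set.image_empty, Ideal.span_empty, sup_bot_eq]
    exact hex i hi
  | succ j ih =>
    let p' : Fin n := ⟨p + 1, by omega⟩
    obtain ⟨h, h1, h2⟩ := ih (p := p') (by simp only [p']; omega) (by omega)
    obtain ⟨P, hP, hreg⟩ := (h2 n (by omega)).exists_regular
    obtain ⟨c, hc1, hc2⟩ := exists_updateCol h1 p' hP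
    have hQ := addColumns_updateCol I h (j := j) (p := p') (by simp only [p']; omega) c
    refine ⟨h.updateCol p' c, hc1, fun i hi => ?_⟩
    rw [addColumns_succ _ _ (p := p') (by simp only [p']; omega), hQ]
    obtain ⟨i, rfl⟩ : ∃ i', i = i' + 1 := ⟨i - 1, by omega⟩
    refine (h2 i (by omega)).sup_span (h2 (i + 1) (by omega)) fun f hf => hreg c hc2 f ?_
    simpa only [columnForm, Matrix.updateCol_self] using hf

end GenericRegular

/-! ### Last variables in reverse lexicographic initial ideals -/

section LastVariable

variable {K : Type*} [Field K] {n : ℕ}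

/-- If `x_p` is regular modulo a homogeneous ideal `F` and the variables after `x_p`, then no
minimal generator of the reverse lexicographic initial ideal of `F` has `x_p` as its last variable:
for an element `f` of `F` with such an initial monomial, `f` is divisible by `x_p` modulo the later
variables, and the quotient would lie in `F` as well. -/
theorem not_mem_minGens_initialIdeal {F : Ideal (MvPolynomial (Fin n) K)}
    (hF : ∀ f ∈ F, ∀ d, homogeneousComponent d f ∈ F) {p : Fin n}
    (hreg : ∀ f, X p * f ∈ F ⊔ Ideal.span (X '' {k | p < k}) →
      f ∈ F ⊔ Ideal.span (X '' {k | p < k})) {v : Fin n →₀ ℕ} (hvp : v p ≠ 0)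
    (hvl : ∀ l, p < l → v l = 0) : v ∉ minGens (initialIdeal F) := by
  classical
  intro hv
  obtain ⟨f', hf', hfv'⟩ := monomial_mem_initialIdeal.1 (mem_minGens.1 hv).1
  set f := homogeneousComponent v.degree f' with hf_def
  have hf : f ∈ F := hF f' hf' _
  have hfv : IsInitialMonomial f v := hfv'.homogeneousComponent
  have hfd : ∀ b ∈ f.support, b.degree = v.degree := by
    intro b hb
    rw [hf_def, support_homogeneousComponent, Finset.mem_filter] at hb
    exact hb.2
  have hfp : ∀ b ∈ f.support, (∀ l, p < l → b l = 0) → b p ≠ 0 := by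
    intro b hb hbl
    rcases hfv.eq_or_lt hb with rfl | h | ⟨-, k, hk, hkl⟩
    · exact hvp
    · have := hfd b hb; omega
    · rcases lt_trichotomy k p with h | rfl | h
      · rw [hkl p h]; exact hvp
      · omega
      · rw [hbl k h] at hk; omega
  set e := Finsupp.single p 1 with he
  have hle : ∀ b : Fin n →₀ ℕ, b p ≠ 0 → b - e + e = b := fun b hb =>
    tsub_add_cancel_of_le (Finsupp.single_le_iff.2 (Nat.one_le_iff_ne_zero.2 hb))
  -- `x_p q` is the part of `f` without the variables after `x_p`
  let T := f.support.filter fun b => ∀ l, p < l → b l = 0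
  set q : MvPolynomial (Fin n) K := ∑ b ∈ T, monomial (b - e) (coeff b f) with hq
  have hXq : X p * q = ∑ b ∈ T, monomial b (coeff b f) := by
    rw [hq, Finset.mul_sum]
    refine Finset.sum_congr rfl fun b hb => ?_
    obtain ⟨hb1, hb2⟩ := Finset.mem_filter.1 hb
    rw [X, monomial_mul, one_mul, add_comm, hle b (hfp b hb1 hb2)]
  have hqmem : q ∈ F ⊔ Ideal.span (X '' {k | p < k}) := by
    apply hreg
    have h1 : X p * q = f + -∑ b ∈ f.support.filter (fun b => ¬ ∀ l, p < l → b l = 0),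
        monomial b (coeff b f) := by
      rw [hXq]
      refine eq_add_neg_of_add_eq ?_
      rw [Finset.sum_filter_add_sum_filter_not]
      exact f.as_sum.symm
    rw [h1]
    refine Submodule.add_mem_sup hf (neg_mem (sum_mem fun b hb => ?_))
    rw [mem_ideal_span_X_image]
    intro b' hb'
    have h2 := support_monomial_subset hb'
    rw [Finset.mem_singleton] at h2
    subst h2
    have h3 := (Finset.mem_filter.1 hb).2
    push Not at h3
    exact h3
  -- `h` lies in `F` and has the coefficients of `q` at the monomials without later variables
  obtain ⟨h, hhF, r, hr, hhr⟩ := Submodule.mem_sup.1 hqmem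
  have hcoeff : ∀ b : Fin n →₀ ℕ, (∀ l, p < l → b l = 0) →
      coeff b h = coeff (b + e) f := by
    intro b hb
    have h1 : coeff b r = 0 := by
      by_contra h1
      obtain ⟨l, hl, hne⟩ := mem_ideal_span_X_image.1 hr b (mem_support_iff.2 h1)
      exact hne (hb l hl)
    have h2 : coeff b h = coeff b q := by rw [← hhr, coeff_add, h1, add_zero]
    have h3 : coeff b q = coeff (b + e) (X p * q) := by
      rw [X, add_comm, coeff_monomial_mul, one_mul]
    have hbe : ∀ l, p < l → (b + e) l = 0 := by
      intro l hl
      rw [Finsupp.add_apply, hb l hl, he, Finsupp.single_eq_of_ne hl.ne', add_zero]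
    rw [h2, h3, hXq, coeff_sum]
    simp_rw [coeff_monomial]
    rw [Finset.sum_ite_eq']
    split_ifs with h4
    · rfl
    · by_contra h5
      exact h4 (Finset.mem_filter.2 ⟨mem_support_iff.2 (Ne.symm h5), hbe⟩)
  have hve := hle v hvp
  have hvel : ∀ l, p < l → (v - e) l = 0 := fun l hl => by
    rw [Finsupp.tsub_apply, hvl l hl, zero_tsub]
  have hinit : IsInitialMonomial (homogeneousComponent (v - e).degree h) (v - e) := by
    constructor
    · rw [support_homogeneousComponent, Finset.mem_filter, mem_support_iff, hcoeff _ hvel, hve]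
      exact ⟨hfv.coeff_ne_zero, rfl⟩
    · intro b hb hne
      rw [support_homogeneousComponent, Finset.mem_filter] at hb
      by_cases hbl : ∀ l, p < l → b l = 0
      · have h1 : b + e ∈ f.support := by
          rw [mem_support_iff, ← hcoeff b hbl]; exact mem_support_iff.1 hb.1
        have h2 : RevLexLT (b + e) v := hfv.2 _ h1 fun h => hne (by
          rw [← h, add_tsub_cancel_right])
        rcases revLexLT_trichotomy hne with h3 | h3
        · exact h3
        · have h4 := h3.add_right e
          rw [hve] at h4
          exact absurd (h4.trans h2) (revLexLT_irrefl v)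
      · push Not at hbl
        obtain ⟨l₀, hl₀⟩ := hbl
        obtain ⟨l, hl, hmax⟩ := (Finset.univ.filter fun l => p < l ∧ b l ≠ 0).exists_max_image id
          ⟨l₀, by simpa using hl₀⟩
        simp only [Finset.mem_filter, Finset.mem_univ, true_and, id] at hl hmax
        refine Or.inr ⟨hb.2, l, ?_, fun k hk => ?_⟩
        · rw [hvel l hl.1]; omega
        · rw [hvel k (hl.1.trans hk)]
          by_contra h1
          exact absurd (hmax k ⟨hl.1.trans hk, h1⟩) (not_le.2 hk)
  have hmem : monomial (v - e) (1 : K) ∈ initialIdeal F :=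
    monomial_mem_initialIdeal.2 ⟨_, hF h hhF _, hinit⟩
  have h1 := (mem_minGens.1 hv).2 _ hmem tsub_le_self
  have h2 := DFunLike.congr_fun h1 p
  rw [Finsupp.tsub_apply, he, Finsupp.single_eq_same] at h2
  omega

/-- Let `M` be the largest index of a variable in the minimal generators of the generic initial
ideal of `I`. If the generic initial ideal has only `M` generators, then the Taylor resolution of
`S / I` is minimal. Indeed, `I` has at most `M` generators, so otherwise `S / I` has no Koszul
homology in degrees `≥ M`, and the `n - M + 1` last variables form a regular sequence in generic
coordinates. -/
theorem IsGenericInitialIdeal.taylorIsMinimal [Infinite K] {I J : Ideal (MvPolynomial (Fin n) K)}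
    (hI : IsMonomialIdeal I) (htop : I ≠ ⊤) (hJ : IsGenericInitialIdeal I J)
    (hmax : (minGens J).sup maxIndex = (minGens J).card) : TaylorIsMinimal I := by
  classical
  obtain ⟨P, hP0, hP⟩ := hJ
  set M := (minGens J).card with hM
  have hdet0 : (Matrix.mvPolynomialX (Fin n) (Fin n) K).det ≠ 0 :=
    Matrix.det_mvPolynomialX_ne_zero (Fin n) K
  obtain ⟨v₀, hv₀⟩ := exists_eval_ne_zero (mul_ne_zero hdet0 hP0)
  set g₀ : Matrix (Fin n) (Fin n) K := Matrix.of fun i j => v₀ (i, j) with hg₀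
  have hg₀v : (fun e : Fin n × Fin n => g₀ e.1 e.2) = v₀ := rfl
  have hdetev : eval v₀ (Matrix.mvPolynomialX (Fin n) (Fin n) K).det = g₀.det := by
    rw [RingHom.map_det, RingHom.mapMatrix_apply]
    congr 1
    ext i j; simp [hg₀]
  rw [map_mul, hdetev] at hv₀
  have hdet : g₀.det ≠ 0 := left_ne_zero_of_mul hv₀
  have hR : eval (fun e => g₀⁻¹ e.1 e.2) (invPoly P) ≠ 0 := by
    rw [eval_invPoly, Matrix.nonsing_inv_nonsing_inv _ (isUnit_iff_ne_zero.2 hdet), hg₀v]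
    refine mul_ne_zero (pow_ne_zero _ ?_) (right_ne_zero_of_mul hv₀)
    rw [Matrix.det_nonsing_inv, Ring.inverse_eq_inv']
    exact inv_ne_zero hdet
  -- matrices `h` with `invPoly P ≠ 0` are inverses of admissible changes of coordinates
  have hgl : ∀ h : Matrix (Fin n) (Fin n) K, eval (fun e => h e.1 e.2) (invPoly P) ≠ 0 →
      ∃ g : GL (Fin n) K, ((g⁻¹ : GL (Fin n) K) : Matrix (Fin n) (Fin n) K) = h ∧
        initialIdeal (I.map (coordChange g)) = J := by
    intro h hh
    rw [eval_invPoly] at hh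
    have hd : h.det ≠ 0 := fun h0 => hh (by rw [h0, zero_pow (Nat.succ_ne_zero _), zero_mul])
    let γ : GL (Fin n) K := Matrix.GeneralLinearGroup.mkOfDetNeZero h hd
    refine ⟨γ⁻¹, by rw [inv_inv]; rfl, hP _ ?_⟩
    rw [Matrix.coe_units_inv]
    exact right_ne_zero_of_mul hh
  have hcard : (minGens I).card ≤ M := by
    obtain ⟨g, -, hg⟩ := hgl _ hR
    have := card_minGens_le_initialIdeal hI g
    rwa [hg] at this
  rcases Nat.eq_zero_or_pos M with h0 | hpos
  · have hempty : minGens I = ∅ := Finset.card_eq_zero.1 (Nat.le_zero.1 (hcard.trans h0.le))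
    rw [taylorIsMinimal_iff, hempty]
    simp
  by_contra hT
  have hex : ∀ i, M ≤ i → QuotEx I i := by
    intro i hi
    obtain ⟨i, rfl⟩ : ∃ i', i = i' + 1 := ⟨i - 1, by omega⟩
    refine quotEx_of_ex hI fun a => ?_
    by_contra hne
    exact hT (taylorIsMinimal_of_not_ex hI htop (by omega) hne)
  obtain ⟨v, hvJ, hv⟩ := Finset.exists_mem_eq_sup (minGens J) (Finset.card_pos.1 hpos) maxIndex
  rw [hmax] at hv
  have hvne : v.support.Nonempty := by
    by_contra h
    have h1 : maxIndex v = 0 := by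
      rw [maxIndex, Finset.not_nonempty_iff_eq_empty.1 h, Finset.sup_empty, Nat.bot_eq_zero]
    omega
  obtain ⟨p, hp, hpM⟩ := Finset.exists_mem_eq_sup v.support hvne fun i : Fin n => (i : ℕ) + 1
  have hpM : M = (p : ℕ) + 1 := hv.trans hpM
  obtain ⟨h, hhR, -, hreg⟩ := exists_regular_columns hex hR (n - M) (p := p) (by omega) (by omega)
  obtain ⟨g, hgh, hgJ⟩ := hgl h hhR
  have hform : ∀ k, coordChange g⁻¹ (X k) = columnForm h k := fun k => by
    rw [coordChange_X, hgh, columnForm]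
  have hmap : I.map (coordChange g) ⊔ Ideal.span (X '' {k | p < k}) =
      (addColumns I h (n - M)).map (coordChange g) := by
    rw [addColumns, Ideal.map_sup, Ideal.map_span, ← Set.image_comp]
    congr 2
    have hset : {k : Fin n | n ≤ (k : ℕ) + (n - M)} = {k | p < k} := by
      ext k
      simp only [Set.mem_ofPred_eq, Fin.lt_def]
      omega
    rw [hset]
    refine Set.image_congr fun k _ => ?_
    rw [Function.comp_apply, ← hform, coordChange_apply_inv]
  refine not_mem_minGens_initialIdeal (F := I.map (coordChange g)) (p := p) (v := v)
    (fun f hf d => hI.homogeneousComponent_mem_map g hf d) (fun f hf => ?_)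
    (Finsupp.mem_support_iff.1 hp) (fun l hl => ?_) (by rwa [hgJ])
  · rw [hmap, mem_map_coordChange] at hf ⊢
    rw [map_mul, hform] at hf
    exact hreg _ hf
  · by_contra hne
    have h1 := Finset.le_sup (f := fun i : Fin n => (i : ℕ) + 1) (Finsupp.mem_support_iff.2 hne)
    have h2 : (l : ℕ) + 1 ≤ M := by rw [hv]; exact h1
    have h3 : (p : ℕ) < l := hl
    omega

end LastVariable

end

end MonIdeal

theorem mainTheorem1 {K : Type*} [Field K] {n : ℕ} (I : Ideal (MvPolynomial (Fin n) K))
    (hmon : MonIdeal.IsMonomialIdeal I) (hproper : I ≠ ⊤)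
    (hlin : MonIdeal.IsComponentwiseLinear I) :
    (MonIdeal.TaylorIsMinimal I ↔ (MonIdeal.IsGotzmann I ∧ (MonIdeal.minGens I).card ≤ n)) ∧
    (Infinite K → List.TFAE [
      MonIdeal.TaylorIsMinimal I,
      ∃ J : Ideal (MvPolynomial (Fin n) K), MonIdeal.IsGenericInitialIdeal I J ∧
        (MonIdeal.minGens J).sup MonIdeal.maxIndex = (MonIdeal.minGens J).card,
      MonIdeal.IsGotzmann I ∧ (MonIdeal.minGens I).card ≤ n]) := by
  have hac : MonIdeal.TaylorIsMinimal I ↔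
      (MonIdeal.IsGotzmann I ∧ (MonIdeal.minGens I).card ≤ n) := by
    refine ⟨fun hT => ?_, fun h => h.1.taylorIsMinimal hmon hproper h.2⟩
    obtain ⟨m, s, rfl⟩ := MonIdeal.exists_staircase hmon hlin hT
    exact ⟨s.isGotzmann, s.card_minGens.trans_le s.le_card⟩
  refine ⟨hac, fun _ => ?_⟩
  tfae_have 1 ↔ 3 := hac
  tfae_have 1 → 2 := by
    intro hT
    obtain ⟨m, s, rfl⟩ := MonIdeal.exists_staircase hmon hlin hT
    exact s.exists_isGenericInitialIdeal
  tfae_have 2 → 1 := fun ⟨_, hJ, hmax⟩ => hJ.taylorIsMinimal hmon hproper hmax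
  tfae_finish
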